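/- Let $p$ be a prime, let $F_n$ be the free pro-$p$ group on $g_1,\dots,g_n$, and let $G=\langle g_1,\dots,g_n\mid r_1=\cdots=r_m=1\rangle^{\text{pro-}p}$ be a finitely presented pro-$p$ group, with natural homomorphism $\pi:F_n\to G$, such that every relator $r_j$ has total degree $0$ (the total degree being the continuous homomorphism $F_n\to\mathbb Z_p$ with $g_i\mapsto 1$ for all $i$). Let $\Gamma=\mathbb Z_p$ (written multiplicatively) with topological generator $\gamma$, and let $\alpha:G\to\Gamma$ be a surjective homomorphism with $\alpha(\pi(g_i))=\gamma$ for all $i$. All homomorphisms of topological groups and all crossed homomorphisms are continuous. Let $k\ge 2$, let $\varphi_{k-2}:F_n\to \mathrm{GL}(k-1;\overline{\mathbb Q_p})$ be a homomorphism that factors through $G$, and let $\widetilde{\varphi_{k-2}}=\varphi_{k-2}\otimes(\alpha\circ\pi):F_n\to\mathrm{GL}(k-1;R)$, $x\mapsto\varphi_{k-2}(x)\cdot(\alpha\circ\pi)(x)$, where $R=\overline{\mathbb Q_p}\otimes_{\mathbb Z_p}\mathbb Z_p[[\Gamma]]$; the same symbol denotes its extension $\mathbb Z_p[[F_n]]\to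 \mathrm M(k-1;R)$. Let $$Q=Q_{\widetilde{\varphi_{k-2}}}=\left(\widetilde{\varphi_{k-2}}\left(\frac{\partial r_j}{\partial g_i}\right)\right)_{j,i}\in \mathrm M(m(k-1),n(k-1);R)$$ be the twisted pro-$p$ Fox Jacobian. Let $A_{\widetilde{\varphi_{k-2}}}$ be the left $\mathrm M(k-1;R)$-module with generators $dg_1,\dots,dg_n$ and relations $\sum_i\widetilde{\varphi_{k-2}}(\partial r_j/\partial g_i)\,dg_i=0$ $(1\le j\le m)$. Let $\Delta_{k-1}(A_{\widetilde{\varphi_{k-2}}})\in R$, the arithmetic twisted Alexander polynomial, be the greatest common divisor (defined up to a unit of $R$) of the ideal of $R$ generated by the minors of $Q$ of size $n(k-1)-(k-1)$; this ideal is $0$ if the size exceeds $m(k-1)$, and $R$ if the size is $0$. Let $a_{k-1}\in\overline{\mathbb Q_p}^\times$ with $|a_{k-1}-1|_p<1$, and write $|_{\gamma=a_{k-1}}$ for the evaluation $R\to\overline{\mathbb Q_p}$ at $\gamma=a_{k-1}$. (1) Let $\overline{\beta_{k-1}}:F_n\to\overline{\mathbb Q_p}^{\oplus(k-1)}$ be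 a crossed homomorphism with respect to $\widetilde{\varphi_{k-2}}|_{\gamma=a_{k-1}}$, that is, $\overline{\beta_{k-1}}(xy)=\overline{\beta_{k-1}}(x)+\widetilde{\varphi_{k-2}}(x)|_{\gamma=a_{k-1}}\,\overline{\beta_{k-1}}(y)$ for all $x,y\in F_n$. There is exactly one homomorphism $\varphi_{k-1}:F_n\to\mathrm{GL}(k;\overline{\mathbb Q_p})$ with $$\varphi_{k-1}(g_i)=\begin{pmatrix}\widetilde{\varphi_{k-2}}(g_i)|_{\gamma=a_{k-1}}&\overline{\beta_{k-1}}(g_i)\\ \mathbf 0&1\end{pmatrix}\qquad(1\le i\le n),$$ and it factors through $G$ as a representation $\rho_{k-1}:G\to\mathrm{GL}(k;\overline{\mathbb Q_p})$, $\rho_{k-1}\circ\pi=\varphi_{k-1}$, if and only if $Q|_{\gamma=a_{k-1}}\cdot\mathbf b=0$, where $\mathbf b={}^t(\overline{\beta_{k-1}}(g_1),\dots,\overline{\beta_{k-1}}(g_n))\in\overline{\mathbb Q_p}^{\oplus n(k-1)}$. (2) The greatest common divisor $\Delta_{k-1}(A_{\widetilde{\varphi_{k-2}}})$ exists in $R$,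 and the following are equivalent: (a) $\dim_{\overline{\mathbb Q_p}}\mathrm{Hom}(A_{\widetilde{\varphi_{k-2}}},\overline{\mathbb Q_p}^{\oplus(k-1)})\ge k$, where $\mathrm{Hom}$ denotes the $\mathrm M(k-1;R)$-linear maps and $\mathrm M(k-1;R)$ acts on $\overline{\mathbb Q_p}^{\oplus(k-1)}$ through $\gamma=a_{k-1}$; (b) there are at least $k$ linearly independent extensions, i.e. $k$ linearly independent crossed homomorphisms $\overline{\beta_{k-1}}$ as in (1) whose $\varphi_{k-1}$ factors through $G$; (c) $a_{k-1}$ is a zero of $\Delta_{k-1}(A_{\widetilde{\varphi_{k-2}}})$, i.e. $\Delta_{k-1}(A_{\widetilde{\varphi_{k-2}}})|_{\gamma=a_{k-1}}=0$. -/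

import Mathlib

open Filter Topology
open scoped TensorProduct

noncomputable section

namespace ArithAlexander

/-! ## The free pro-`p` group -/

/-- The normal subgroups of `p`-power index of the free group on `n` letters. -/
def PPowerIndexSubgroup (p n : ℕ) : Type :=
  {N : Subgroup (FreeGroup (Fin n)) // N.Normal ∧ ∃ e : ℕ, N.index = p ^ e}

instance (p n : ℕ) (N : PPowerIndexSubgroup p n) : N.1.Normal := N.2.1

/-- The free pro-`p` group `F_n` on `n` generators: the inverse limit of the finite `p`-groups
`F / N`, where `F` is the (discrete) free group on `n` letters and `N` runs through the normal
subgroups of `p`-power index. -/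
def FreeProP (p n : ℕ) : Subgroup (∀ N : PPowerIndexSubgroup p n, FreeGroup (Fin n) ⧸ N.1) where
  carrier := {x | ∀ (M N : PPowerIndexSubgroup p n) (h : M.1 ≤ N.1),
    QuotientGroup.map M.1 N.1 (MonoidHom.id _) h (x M) = x N}
  mul_mem' := by
    intro x y hx hy M N h
    simp only [Pi.mul_apply, map_mul, hx M N h, hy M N h]
  one_mem' := by
    intro M N h
    simp only [Pi.one_apply, map_one]
  inv_mem' := by
    intro x hx M N h
    simp only [Pi.inv_apply, map_inv, hx M N h]

/-- The inverse limit topology (every finite quotient `F / N` is discrete). -/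
instance (p n : ℕ) : TopologicalSpace (FreeProP p n) :=
  ⨅ N : PPowerIndexSubgroup p n, TopologicalSpace.induced (fun x : FreeProP p n => x.1 N) ⊥

/-- The canonical homomorphism from the discrete free group to the free pro-`p` group. -/
def ofFree (p n : ℕ) : FreeGroup (Fin n) →* FreeProP p n where
  toFun w := ⟨fun N => (w : FreeGroup (Fin n) ⧸ N.1), fun _ _ _ => rfl⟩
  map_one' := rfl
  map_mul' _ _ := rfl

/-- The generators `g_1, …, g_n` of the free pro-`p` group. -/
def gen (p : ℕ) {n : ℕ} (i : Fin n) : FreeProP p n := ofFree p n (FreeGroup.of i)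

/-- The total degree `F_n → ℤ_p`, the extension by continuity of the homomorphism `F → ℤ` that
sends every generator of the free group `F` to `1`. -/
def totalDegree (p : ℕ) [Fact p.Prime] {n : ℕ} (x : FreeProP p n) : ℤ_[p] :=
  limUnder (comap (ofFree p n) (𝓝 x)) fun w : FreeGroup (Fin n) =>
    ((Multiplicative.toAdd
      (FreeGroup.lift (fun _ : Fin n => Multiplicative.ofAdd (1 : ℤ)) w) : ℤ) : ℤ_[p])

/-- A presentation `G = ⟨g_1, …, g_n ∣ r_1 = ⋯ = r_m = 1⟩` of a topological group `G` as a pro-`p`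
group: a continuous surjection `π : F_n → G` whose kernel is the closed normal subgroup generated
by the relators. (A Hausdorff topological group with such a presentation is automatically a
pro-`p` group, namely the quotient of `F_n` by that closed normal subgroup.) -/
structure ProPPresentation (p n m : ℕ) (G : Type*) [Group G] [TopologicalSpace G] where
  /-- the relators -/
  rel : Fin m → FreeProP p n
  /-- the natural homomorphism `π` -/
  proj : FreeProP p n →ₜ* G
  surjective_proj : Function.Surjective proj
  ker_proj : {x : FreeProP p n | proj x = 1} =
    closure (Subgroup.normalClosure (Set.range rel) : Set (FreeProP p n))

/-! ## Complete group algebras -/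

/-- The complete group algebra `ℤ_p[[H]]`: the inverse limit of the group algebras `ℤ_p[H / U]`,
where `U` runs through the open normal subgroups of `H`. -/
def CompleteGroupAlgebra (p : ℕ) [Fact p.Prime] (H : Type*) [Group H] [TopologicalSpace H] :
    Subalgebra ℤ_[p] (∀ U : OpenNormalSubgroup H, MonoidAlgebra ℤ_[p] (H ⧸ U.toSubgroup)) where
  carrier := {x | ∀ (U V : OpenNormalSubgroup H) (h : U.toSubgroup ≤ V.toSubgroup),
    MonoidAlgebra.mapDomainAlgHom ℤ_[p] ℤ_[p]
      (QuotientGroup.map U.toSubgroup V.toSubgroup (MonoidHom.id H) h) (x U) = x V}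
  mul_mem' := by
    intro x y hx hy U V h
    rw [Pi.mul_apply, Pi.mul_apply, map_mul, hx U V h, hy U V h]
  add_mem' := by
    intro x y hx hy U V h
    rw [Pi.add_apply, Pi.add_apply, map_add, hx U V h, hy U V h]
  algebraMap_mem' := by
    intro c U V h
    rw [Pi.algebraMap_apply, Pi.algebraMap_apply, AlgHom.commutes]

variable (p : ℕ) [Fact p.Prime] {H : Type*} [Group H] [TopologicalSpace H]

/-- The coefficient in `ℤ_p` of an element of `ℤ_p[[H]]` at a class `c ∈ H / U`. -/
def coeff (U : OpenNormalSubgroup H) (c : H ⧸ U.toSubgroup) :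
    CompleteGroupAlgebra p H →ₗ[ℤ_[p]] ℤ_[p] where
  toFun x := (x.1 U).coeff c
  map_add' _ _ := rfl
  map_smul' _ _ := rfl

/-- The inverse limit topology of `ℤ_p[[H]]` (for profinite `H`): all coefficients at all finite
levels converge `p`-adically. -/
instance : TopologicalSpace (CompleteGroupAlgebra p H) :=
  ⨅ (U : OpenNormalSubgroup H) (c : H ⧸ U.toSubgroup),
    TopologicalSpace.induced (coeff p U c) inferInstance

/-- The canonical homomorphism `H → ℤ_p[[H]]`. -/
def groupLike : H →* CompleteGroupAlgebra p H where
  toFun x := ⟨fun U => MonoidAlgebra.of ℤ_[p] (H ⧸ U.toSubgroup) (x : H ⧸ U.toSubgroup), by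
    intro U V h
    simp only [MonoidAlgebra.of_apply, MonoidAlgebra.mapDomainAlgHom_apply,
      MonoidAlgebra.mapDomain_single]
    rfl⟩
  map_one' := by
    ext U : 2
    simp [MonoidAlgebra.one_def]
  map_mul' x y := by
    ext U : 2
    simp

/-- The canonical algebra homomorphism `ℤ_p[H] → ℤ_p[[H]]`. -/
def ofGroupAlgebra : MonoidAlgebra ℤ_[p] H →ₐ[ℤ_[p]] CompleteGroupAlgebra p H :=
  MonoidAlgebra.lift ℤ_[p] (CompleteGroupAlgebra p H) H (groupLike p)

instance {H : Type*} [CommGroup H] [TopologicalSpace H] : CommRing (CompleteGroupAlgebra p H) :=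
  { (inferInstance : Ring (CompleteGroupAlgebra p H)) with
    mul_comm := fun x y => by
      ext U : 2
      exact mul_comm (x.1 U) (y.1 U) }

/-! ## Pro-`p` Fox derivatives -/

/-- The Fox derivative `∂/∂g_i` of a word in the letters `g_j` (`(j, true)`) and `g_j⁻¹`
(`(j, false)`), computed from `∂(uv) = ∂u + u ∂v`, `∂g_j = δ_ij` and `∂(g_j⁻¹) = -δ_ij g_j⁻¹`. -/
def foxWord {n : ℕ} (i : Fin n) : List (Fin n × Bool) → MonoidAlgebra ℤ (FreeGroup (Fin n))
  | [] => 0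
  | (j, true) :: w =>
      (if j = i then 1 else 0) + MonoidAlgebra.of ℤ _ (FreeGroup.of j) * foxWord i w
  | (j, false) :: w =>
      (if j = i then -MonoidAlgebra.of ℤ _ (FreeGroup.of j)⁻¹ else 0) +
        MonoidAlgebra.of ℤ _ (FreeGroup.of j)⁻¹ * foxWord i w

/-- The classical Fox derivative `∂/∂g_i : F → ℤ[F]` on the discrete free group. -/
def foxFree {n : ℕ} (i : Fin n) (w : FreeGroup (Fin n)) : MonoidAlgebra ℤ (FreeGroup (Fin n)) :=
  foxWord i w.toWord

/-- The pro-`p` Fox derivative `∂/∂g_i : F_n → ℤ_p[[F_n]]`, the extension by continuity of the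
classical Fox derivative. -/
def fox {n : ℕ} (i : Fin n) (x : FreeProP p n) : CompleteGroupAlgebra p (FreeProP p n) :=
  limUnder (comap (ofFree p n) (𝓝 x)) fun w : FreeGroup (Fin n) =>
    MonoidAlgebra.lift ℤ (CompleteGroupAlgebra p (FreeProP p n)) (FreeGroup (Fin n))
      ((groupLike p).comp (ofFree p n)) (foxFree i w)

/-! ## The coefficient ring and evaluation at `γ = a` -/

/-- The group `Γ = ℤ_p`, written multiplicatively. -/
abbrev Gam : Type := Multiplicative ℤ_[p]

/-- The ring `Q̄_p ⊗_{ℤ_p} ℤ_p[[Γ]]`. -/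
abbrev IwasawaRing : Type := PadicAlgCl p ⊗[ℤ_[p]] CompleteGroupAlgebra p (Gam p)

/-- The coefficient in `Q̄_p` of an element of `Q̄_p ⊗ ℤ_p[[Γ]]` at a class `c ∈ Γ / U`, that is
`q ⊗ x ↦ q * (coefficient of x at c)`. -/
def coeffBar (U : OpenNormalSubgroup (Gam p)) (c : Gam p ⧸ U.toSubgroup) :
    IwasawaRing p →ₗ[ℤ_[p]] PadicAlgCl p :=
  TensorProduct.lift ((LinearMap.mul ℤ_[p] (PadicAlgCl p)).compl₂
    ((Algebra.linearMap ℤ_[p] (PadicAlgCl p)).comp (coeff p U c)))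

/-- The topology on `Q̄_p ⊗ ℤ_p[[Γ]]` in which convergence means `p`-adic convergence of all
coefficients at all finite levels `Γ / U`. -/
instance : TopologicalSpace (IwasawaRing p) :=
  ⨅ (U : OpenNormalSubgroup (Gam p)) (c : Gam p ⧸ U.toSubgroup),
    TopologicalSpace.induced (coeffBar p U c) inferInstance

variable {p}

/-- Evaluation `f ↦ f|_{γ = a}` of an element of `Q̄_p ⊗ ℤ_p[[Γ]]`, for a topological generator `γ`
of `Γ` and `|a - 1|_p < 1`. The image of `f` at a finite level is `∑ c_j [γ^j] ∈ Q̄_p[Γ / U]` with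
`0 ≤ j < [Γ : U]`, and `f|_{γ = a}` is the limit of the numbers `∑ c_j a^j` as `U` shrinks. -/
def evalAt (γ : Gam p) (a : PadicAlgCl p) (f : IwasawaRing p) : PadicAlgCl p :=
  limUnder (atBot : Filter (OpenNormalSubgroup (Gam p))) fun U =>
    ∑ j ∈ Finset.range U.toSubgroup.index,
      coeffBar p U ((γ ^ j : Gam p) : Gam p ⧸ U.toSubgroup) f * a ^ j

/-! ## The twisted Fox Jacobian -/

variable {n m l : ℕ}

/-- The tensor product representation `φ̃ = φ ⊗ ψ`, `x ↦ φ(x) · ψ(x)`, of a homomorphism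
`φ : F_n → GL(l, Q̄_p)` with a homomorphism `ψ : F_n → Γ`. -/
def tensorRep (φ : FreeProP p n →ₜ* GL (Fin l) (PadicAlgCl p)) (ψ : FreeProP p n →ₜ* Gam p)
    (x : FreeProP p n) : Matrix (Fin l) (Fin l) (IwasawaRing p) :=
  (φ x : Matrix (Fin l) (Fin l) (PadicAlgCl p)).map fun q => q ⊗ₜ[ℤ_[p]] groupLike p (ψ x)

/-- The extension `ℤ_p[[F_n]] → M(l, Q̄_p ⊗ ℤ_p[[Γ]])` of `φ̃`: the extension by continuity of the
linear extension `∑ c_x x ↦ ∑ c_x φ̃(x)` of `φ̃` to the group algebra `ℤ_p[F_n]`. -/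
def tensorRepAlg (φ : FreeProP p n →ₜ* GL (Fin l) (PadicAlgCl p)) (ψ : FreeProP p n →ₜ* Gam p)
    (f : CompleteGroupAlgebra p (FreeProP p n)) : Matrix (Fin l) (Fin l) (IwasawaRing p) :=
  limUnder (comap (ofGroupAlgebra p (H := FreeProP p n)) (𝓝 f)) fun h =>
    h.coeff.sum fun x c => c • tensorRep φ ψ x

/-- The twisted Fox Jacobian `Q_φ̃ = (φ̃(∂r_j / ∂g_i))`, an `ml × nl` matrix made of `l × l`
blocks, as a block matrix with entry `φ̃(∂r_j / ∂g_i)` in block row `j` and block column `i`. -/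
def foxJacobianBlock (r : Fin m → FreeProP p n) (φ : FreeProP p n →ₜ* GL (Fin l) (PadicAlgCl p))
    (ψ : FreeProP p n →ₜ* Gam p) (j : Fin m) (i : Fin n) :
    Matrix (Fin l) (Fin l) (IwasawaRing p) :=
  tensorRepAlg φ ψ (fox p i (r j))

/-- The twisted Fox Jacobian `Q_φ̃` as an `ml × nl` matrix over `Q̄_p ⊗ ℤ_p[[Γ]]`. -/
def foxJacobian (r : Fin m → FreeProP p n) (φ : FreeProP p n →ₜ* GL (Fin l) (PadicAlgCl p))
    (ψ : FreeProP p n →ₜ* Gam p) :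
    Matrix (Fin m × Fin l) (Fin n × Fin l) (IwasawaRing p) :=
  Matrix.of fun s t => foxJacobianBlock r φ ψ s.1 t.1 s.2 t.2

/-- The `d`-th Fitting ideal of the module presented by a matrix `Q` (rows are relations, columns
are generators): the ideal generated by the minors of `Q` of size `#columns - d`. It is `0` if that
size exceeds the number of rows, and the unit ideal if the size is `0`. -/
def fittingIdeal {R : Type*} [CommRing R] {rows cols : Type*} [Fintype cols]
    (Q : Matrix rows cols R) (d : ℕ) : Ideal R :=
  Ideal.span {x | ∃ (s : Fin (Fintype.card cols - d) ↪ rows)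
    (t : Fin (Fintype.card cols - d) ↪ cols), x = (Q.submatrix s t).det}

/-- `D` is a greatest common divisor of the elements (equivalently, of any generators) of `I`. -/
def IsGCDOfIdeal {R : Type*} [CommRing R] (I : Ideal R) (D : R) : Prop :=
  (∀ x ∈ I, D ∣ x) ∧ ∀ c : R, (∀ x ∈ I, c ∣ x) → c ∣ D

/-- `D` is the arithmetic twisted Alexander polynomial `Δ_d(A_φ̃)`, which is determined up to a unit
of `Q̄_p ⊗ ℤ_p[[Γ]]`: a greatest common divisor of the `d`-th Fitting ideal of `A_φ̃`. -/
def IsAlexanderPolynomial (r : Fin m → FreeProP p n)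
    (φ : FreeProP p n →ₜ* GL (Fin l) (PadicAlgCl p)) (ψ : FreeProP p n →ₜ* Gam p) (d : ℕ)
    (D : IwasawaRing p) : Prop :=
  IsGCDOfIdeal (fittingIdeal (foxJacobian r φ ψ) d) D

/-! ## The module `A_φ̃` and its homomorphisms to `Q̄_p^l` -/

/-- The twisted complete differential module `A_φ̃`: the left module over
`M(l, Q̄_p ⊗ ℤ_p[[Γ]])` with generators `dg_1, …, dg_n` and relations
`∑_i φ̃(∂r_j / ∂g_i) dg_i = 0`. -/
abbrev DiffModule (r : Fin m → FreeProP p n) (φ : FreeProP p n →ₜ* GL (Fin l) (PadicAlgCl p))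
    (ψ : FreeProP p n →ₜ* Gam p) : Type :=
  (Fin n → Matrix (Fin l) (Fin l) (IwasawaRing p)) ⧸
    Submodule.span (Matrix (Fin l) (Fin l) (IwasawaRing p))
      (Set.range (foxJacobianBlock r φ ψ))

/-- The `Q̄_p`-vector space `Hom(A_φ̃, Q̄_p^l)` of the module homomorphisms from `A_φ̃` to `Q̄_p^l`, on
which `M(l, Q̄_p ⊗ ℤ_p[[Γ]])` acts through `γ = a`. -/
def homSpace (r : Fin m → FreeProP p n) (φ : FreeProP p n →ₜ* GL (Fin l) (PadicAlgCl p))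
    (ψ : FreeProP p n →ₜ* Gam p) (γ : Gam p) (a : PadicAlgCl p) :
    Submodule (PadicAlgCl p) (DiffModule r φ ψ → Fin l → PadicAlgCl p) where
  carrier := {f | (∀ u v, f (u + v) = f u + f v) ∧
    ∀ (X : Matrix (Fin l) (Fin l) (IwasawaRing p)) (u : DiffModule r φ ψ),
      f (X • u) = (X.map (evalAt γ a)).mulVec (f u)}
  add_mem' := by
    rintro f g ⟨hf, hf'⟩ ⟨hg, hg'⟩
    refine ⟨fun u v => ?_, fun X u => ?_⟩
    · simp only [Pi.add_apply, hf, hg]; abel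
    · simp only [Pi.add_apply, hf', hg', Matrix.mulVec_add]
  zero_mem' := ⟨fun _ _ => by simp, fun _ _ => by simp⟩
  smul_mem' := by
    rintro c f ⟨hf, hf'⟩
    refine ⟨fun u v => ?_, fun X u => ?_⟩
    · simp only [Pi.smul_apply, hf, smul_add]
    · simp only [Pi.smul_apply, hf', Matrix.mulVec_smul]

/-! ## Crossed homomorphisms and extensions of representations -/

/-- `β : F_n → Q̄_p^l` is a (continuous) crossed homomorphism with respect to `φ̃|_{γ = a}`. -/
def IsCrossedHom (φ : FreeProP p n →ₜ* GL (Fin l) (PadicAlgCl p)) (ψ : FreeProP p n →ₜ* Gam p)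
    (γ : Gam p) (a : PadicAlgCl p) (β : FreeProP p n → Fin l → PadicAlgCl p) : Prop :=
  Continuous β ∧
    ∀ x y, β (x * y) = β x + ((tensorRep φ ψ x).map (evalAt γ a)).mulVec (β y)

/-- The block matrix with first row `(A, b)` and last row `(0, 1)`. -/
def affineMatrix {K : Type*} [Field K] (A : Matrix (Fin l) (Fin l) K) (b : Fin l → K) :
    Matrix (Fin l ⊕ Unit) (Fin l ⊕ Unit) K :=
  Matrix.fromBlocks A (Matrix.replicateCol Unit b) 0 1

/-- `φ'` is the (continuous) homomorphism `F_n → GL(l + 1, Q̄_p)` that sends each generator `g_i` to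
the block matrix with rows `(φ̃(g_i)|_{γ = a}, β(g_i))` and `(0, 1)`. -/
def IsExtensionHom (φ : FreeProP p n →ₜ* GL (Fin l) (PadicAlgCl p)) (ψ : FreeProP p n →ₜ* Gam p)
    (γ : Gam p) (a : PadicAlgCl p) (β : FreeProP p n → Fin l → PadicAlgCl p)
    (φ' : FreeProP p n →ₜ* GL (Fin l ⊕ Unit) (PadicAlgCl p)) : Prop :=
  ∀ i : Fin n, (φ' (gen p i) : Matrix (Fin l ⊕ Unit) (Fin l ⊕ Unit) (PadicAlgCl p)) =
    affineMatrix ((tensorRep φ ψ (gen p i)).map (evalAt γ a)) (β (gen p i))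

/-- A homomorphism `φ` on `F_n` factors through `π : F_n → G` as a (continuous) homomorphism `ρ` on
`G`, that is `ρ ∘ π = φ`. -/
def FactorsThrough {F G M : Type*} [Group F] [TopologicalSpace F] [Group G] [TopologicalSpace G]
    [Group M] [TopologicalSpace M] (φ : F →ₜ* M) (π : F →ₜ* G) : Prop :=
  ∃ ρ : G →ₜ* M, ρ.comp π = φ

end ArithAlexander

end

open ArithAlexander

open Filter Topology
open scoped TensorProduct

noncomputable section

namespace ArithAlexander

/-! ## Riemann sums and integrals over the complete group algebra -/

section Coefficients

variable {p : ℕ} [Fact p.Prime] {H : Type*} [Group H] [TopologicalSpace H]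

/-! Elements of `ℤ_p[[H]]` are treated as measures: Riemann sums of a continuous `ℤ_p`-valued
function over the cosets of open normal subgroups converge. Since `Q̄_p` is not complete, integrals
in `Q̄_p` are restricted to `tame` functions, the finite `Q̄_p`-combinations of continuous
`ℤ_p`-valued ones. These suffice: the entries of `φ` lie in one finite extension of `ℚ_p` because
`F_n` is topologically finitely generated (`entry_mem_tame`), and so do the values of the character
`χ` with `χ(γ) = a` (`exists_character`). Evaluation at `γ = a` is integration of `χ`, hence a ring
homomorphism (`evalAt_eq_evalHom`). It takes an entry of `φ̃(f)` to the integral against `f` of the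
same entry of `ρ = χ(ψ) · φ` (`evalAt_tensorRepAlg`).

Part (1) is then Fox calculus. The map `x ↦ ∑_i ρ(∂x/∂g_i) b_i` is the unique crossed homomorphism
with value `b_i` at `g_i` (`crossedOf_mul`, `crossedOf_gen`, `IsCrossedHom.ext`), so `Q|_{γ=a} b`
lists the values of `β` at the relators (`mulVec_foxJacobian`). A crossed homomorphism is the same
thing as a block triangular extension of `ρ`. The extension factors through `G` exactly when it is
trivial at the relators, and there `ρ` is trivial already, so the condition is `β(r_j) = 0`.

For part (2), restriction to the generators identifies both `Hom(A, Q̄_p^{k-1})` and the space of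
extendable crossed homomorphisms with `ker Q|_{γ=a}`. By rank-nullity its dimension is at least `k`
exactly when all minors of size `n(k-1) - (k-1)` vanish at `a`. To replace the minors by their gcd,
the gcd must generate the Fitting ideal, so the point is that `R` is a Bézout domain. The Mahler
transform identifies `ℤ_p[[Γ]]` with `ℤ_p⟦X⟧`. Every nonzero element of `R` divides a nonzero
element of `ℤ_p[[Γ]]`, hence, by Weierstrass preparation, a polynomial `P`; Weierstrass division
shows that polynomials exhaust `R` modulo `P` (`exists_weierstrass`). Therefore principal ideals of
`R` are extended from the principal ideal ring `Q̄_p[X]`, and a sum of two of them is again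
principal (`isBezout_of_forall_exists_dvd`). -/

instance : Nonempty (OpenNormalSubgroup H) := ⟨⟨⊤, Subgroup.normal_of_characteristic ⊤⟩⟩

lemma mapDomain_level (x : CompleteGroupAlgebra p H) {U V : OpenNormalSubgroup H} (h : U ≤ V) :
    MonoidAlgebra.mapDomain
      (QuotientGroup.map U.toSubgroup V.toSubgroup (MonoidHom.id H) h) (x.1 U) = x.1 V :=
  x.2 U V h

lemma CompleteGroupAlgebra.ext_coeff {x y : CompleteGroupAlgebra p H}
    (h : ∀ U c, coeff p U c x = coeff p U c y) : x = y :=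
  Subtype.ext <| funext fun U => MonoidAlgebra.ext <| Finsupp.ext fun c => h U c

lemma continuous_coeff (U : OpenNormalSubgroup H) (c : H ⧸ U.toSubgroup) :
    Continuous (coeff p U c) :=
  continuous_iInf_dom (i := U) (continuous_iInf_dom (i := c) continuous_induced_dom)

lemma tendsto_completeGroupAlgebra {ι : Type*} {l : Filter ι} {F : ι → CompleteGroupAlgebra p H}
    {x : CompleteGroupAlgebra p H} :
    Tendsto F l (𝓝 x) ↔ ∀ U c, Tendsto (fun i => coeff p U c (F i)) l (𝓝 (coeff p U c x)) := by
  simp only [nhds_iInf, nhds_induced, tendsto_iInf, tendsto_comap_iff, Function.comp_def]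

lemma continuous_completeGroupAlgebra {X : Type*} [TopologicalSpace X]
    {F : X → CompleteGroupAlgebra p H} (h : ∀ U c, Continuous fun i => coeff p U c (F i)) :
    Continuous F :=
  continuous_iff_continuousAt.2 fun _ =>
    tendsto_completeGroupAlgebra.2 fun U c => (h U c).continuousAt

instance : T2Space (CompleteGroupAlgebra p H) := by
  refine .of_injective_continuous
    (f := fun x (q : Σ U : OpenNormalSubgroup H, H ⧸ U.toSubgroup) =>
      coeff p q.1 q.2 x) (fun _ _ h => ?_) (continuous_pi fun q => continuous_coeff _ _)
  exact CompleteGroupAlgebra.ext_coeff fun U c => congrFun h ⟨U, c⟩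

instance : RegularSpace (CompleteGroupAlgebra p H) :=
  regularSpace_iInf fun _ => regularSpace_iInf fun _ => regularSpace_induced _

lemma ofGroupAlgebra_level (y : MonoidAlgebra ℤ_[p] H) (V : OpenNormalSubgroup H) :
    (ofGroupAlgebra p y).1 V =
      MonoidAlgebra.mapDomain (fun h : H => (h : H ⧸ V.toSubgroup)) y := by
  induction y using MonoidAlgebra.induction_linear with
  | zero => simp
  | add x y hx hy =>
    rw [map_add, MonoidAlgebra.mapDomain_add, ← hx, ← hy]; rfl
  | single h t =>
    simp only [ofGroupAlgebra, MonoidAlgebra.lift_single, MonoidAlgebra.mapDomain_single]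
    change t • MonoidAlgebra.single _ _ = _
    simp

lemma groupLike_level (h : H) (V : OpenNormalSubgroup H) :
    (groupLike p h).1 V = MonoidAlgebra.single (h : H ⧸ V.toSubgroup) 1 := rfl

/-- Choosing representatives lifts the component of `x` at level `U` to `ℤ_p[H]`. The lift agrees
with `x` at every level above `U`, so the lifts converge to `x` as `U` shrinks. -/
lemma denseRange_ofGroupAlgebra : DenseRange (ofGroupAlgebra p (H := H)) := by
  intro x
  refine mem_closure_of_tendsto (b := (atBot : Filter (OpenNormalSubgroup H)))
    (f := fun U => ofGroupAlgebra p (MonoidAlgebra.mapDomain Quotient.out (x.1 U))) ?_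
    (Eventually.of_forall fun U => ⟨_, rfl⟩)
  refine tendsto_completeGroupAlgebra.2 fun V c => tendsto_const_nhds.congr' ?_
  filter_upwards [eventually_le_atBot V] with U hU
  change (x.1 V).coeff c = ((ofGroupAlgebra p _).1 V).coeff c
  congr 2
  rw [ofGroupAlgebra_level, ← mapDomain_level x hU]
  apply MonoidAlgebra.coeff_injective
  simp only [MonoidAlgebra.coeff_mapDomain, ← Finsupp.mapDomain_comp]
  congr 1
  funext d
  conv_lhs => rw [← QuotientGroup.out_eq' d]
  rfl

lemma eq_of_groupLike {A : Type*} [AddCommMonoid A] [Module ℤ_[p] A] [TopologicalSpace A]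
    [T2Space A] {S T : CompleteGroupAlgebra p H →ₗ[ℤ_[p]] A} (hS : Continuous S)
    (hT : Continuous T) (h : ∀ g, S (groupLike p g) = T (groupLike p g)) : S = T := by
  have : S ∘ₗ (ofGroupAlgebra p).toLinearMap = T ∘ₗ (ofGroupAlgebra p).toLinearMap := by
    refine LinearMap.ext fun y => ?_
    induction y using MonoidAlgebra.induction_linear with
    | zero => simp
    | add x y hx hy => rw [map_add, map_add, hx, hy]
    | single g t => simp [ofGroupAlgebra, h]
  exact LinearMap.ext fun x => congrFun (denseRange_ofGroupAlgebra.equalizer hS hT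
    (funext fun y => LinearMap.congr_fun this y)) x

/-- With one factor fixed, a coefficient of the product is a finite combination of coefficients of
the other factor, because `MonoidAlgebra` elements have finite support. This yields separate
continuity of multiplication. -/
lemma coeff_mul_eq_sum_left (U : OpenNormalSubgroup H) (c : H ⧸ U.toSubgroup)
    (x y : CompleteGroupAlgebra p H) :
    coeff p U c (x * y) = (y.1 U).coeff.sum fun b t => coeff p U (c * b⁻¹) x * t := by
  change (x.1 U * y.1 U).coeff c = _
  generalize y.1 U = z
  induction z using MonoidAlgebra.induction_linear with
  | zero => simp
  | add u v hu hv =>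
    rw [mul_add, MonoidAlgebra.coeff_add, Finsupp.add_apply, hu, hv, MonoidAlgebra.coeff_add,
      Finsupp.sum_add_index'] <;> simp [mul_add]
  | single b t =>
    rw [MonoidAlgebra.coeff_mul_single_eq_coeff_mul (m₂ := c * b⁻¹)]
    · rw [MonoidAlgebra.coeff_single, Finsupp.sum_single_index (by simp)]; rfl
    · intro d _; exact eq_mul_inv_iff_mul_eq.symm

lemma coeff_mul_eq_sum_right (U : OpenNormalSubgroup H) (c : H ⧸ U.toSubgroup)
    (x y : CompleteGroupAlgebra p H) :
    coeff p U c (x * y) = (x.1 U).coeff.sum fun b t => t * coeff p U (b⁻¹ * c) y := by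
  change (x.1 U * y.1 U).coeff c = _
  generalize x.1 U = z
  induction z using MonoidAlgebra.induction_linear with
  | zero => simp
  | add u v hu hv =>
    rw [add_mul, MonoidAlgebra.coeff_add, Finsupp.add_apply, hu, hv, MonoidAlgebra.coeff_add,
      Finsupp.sum_add_index'] <;> simp [add_mul]
  | single b t =>
    rw [MonoidAlgebra.coeff_single_mul_eq_mul_coeff (m₂ := b⁻¹ * c)]
    · rw [MonoidAlgebra.coeff_single, Finsupp.sum_single_index (by simp)]; rfl
    · intro d _; exact eq_inv_mul_iff_mul_eq.symm

lemma continuous_mul_left' (x : CompleteGroupAlgebra p H) : Continuous fun y => x * y :=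
  continuous_completeGroupAlgebra fun U c => by
    simp_rw [coeff_mul_eq_sum_right]
    exact continuous_finsetSum _ fun b _ => continuous_const.mul (continuous_coeff _ _)

lemma continuous_mul_right' (y : CompleteGroupAlgebra p H) : Continuous fun x => x * y :=
  continuous_completeGroupAlgebra fun U c => by
    simp_rw [coeff_mul_eq_sum_left]
    exact continuous_finsetSum _ fun b _ => (continuous_coeff _ _).mul continuous_const

/-- Comultiplication formulas hold on `ℤ_p[[H]]` as soon as they hold on `H`. -/
lemma comul_of_groupLike {A : Type*} [Ring A] [Algebra ℤ_[p] A] [TopologicalSpace A]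
    [T2Space A] [IsTopologicalRing A] {ι : Type*} (s : Finset ι)
    {T : CompleteGroupAlgebra p H →ₗ[ℤ_[p]] A} (hT : Continuous T)
    {S S' : ι → CompleteGroupAlgebra p H →ₗ[ℤ_[p]] A} (hS : ∀ i, Continuous (S i))
    (hS' : ∀ i, Continuous (S' i))
    (h : ∀ g g', T (groupLike p (g * g')) =
      ∑ i ∈ s, S i (groupLike p g) * S' i (groupLike p g')) (x y : CompleteGroupAlgebra p H) :
    T (x * y) = ∑ i ∈ s, S i x * S' i y := by
  -- Multiplication is only known to be separately continuous, so the identity is extended from `H`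
  -- in one variable at a time.
  have h1 (g : H) (y : CompleteGroupAlgebra p H) :
      T (groupLike p g * y) = ∑ i ∈ s, S i (groupLike p g) * S' i y := by
    have := eq_of_groupLike (S := T ∘ₗ LinearMap.mulLeft ℤ_[p] (groupLike p g))
      (T := ∑ i ∈ s, LinearMap.mulLeft ℤ_[p] (S i (groupLike p g)) ∘ₗ S' i)
      (hT.comp (continuous_mul_left' _))
      (by
        simp only [LinearMap.coe_sum, Finset.sum_fn]
        exact continuous_finsetSum _ fun i _ => continuous_const.mul (hS' i))
      (fun g' => by simpa using h g g')
    simpa using LinearMap.congr_fun this y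
  have := eq_of_groupLike (S := T ∘ₗ LinearMap.mulRight ℤ_[p] y)
      (T := ∑ i ∈ s, LinearMap.mulRight ℤ_[p] (S' i y) ∘ₗ S i)
      (hT.comp (continuous_mul_right' _))
      (by
        simp only [LinearMap.coe_sum, Finset.sum_fn]
        exact continuous_finsetSum _ fun i _ => (hS i).mul continuous_const)
      (fun g' => by simpa using h1 g' y)
  simpa using LinearMap.congr_fun this x

end Coefficients

/-! ### Limits of Riemann sums with values in a topological module -/

section HasIntegral

variable {p : ℕ} [Fact p.Prime] {H : Type*} [Group H] [TopologicalSpace H]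
variable {V W : Type*} [AddCommGroup V] [Module ℤ_[p] V] [AddCommGroup W] [Module ℤ_[p] W]

/-- The Riemann sum `∑_c x_c g(τ c)` of `g` over the classes `c ∈ H / U` with tags `τ c ∈ c`. -/
def riemannSum (U : OpenNormalSubgroup H) (τ : H ⧸ U.toSubgroup → H)
    (x : CompleteGroupAlgebra p H) (g : H → V) : V :=
  (x.1 U).coeff.sum fun c t => t • g (τ c)

/-- `v` is the integral of `g` against `x`, that is the limit of the Riemann sums. -/
def HasIntegral [TopologicalSpace V] (x : CompleteGroupAlgebra p H) (g : H → V) (v : V) : Prop :=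
  ∀ τ : ∀ U : OpenNormalSubgroup H, H ⧸ U.toSubgroup → H,
    (∀ U c, ((τ U c : H) : H ⧸ U.toSubgroup) = c) →
      Tendsto (fun U => riemannSum U (τ U) x g) atBot (𝓝 v)

lemma riemannSum_add (U : OpenNormalSubgroup H) (τ) (x : CompleteGroupAlgebra p H) (g g' : H → V) :
    riemannSum U τ x (g + g') = riemannSum U τ x g + riemannSum U τ x g' := by
  simp [riemannSum, Finsupp.sum_add]

lemma riemannSum_map (U : OpenNormalSubgroup H) (τ) (x : CompleteGroupAlgebra p H) (g : H → V)
    (L : V →ₗ[ℤ_[p]] W) : riemannSum U τ x (L ∘ g) = L (riemannSum U τ x g) := by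
  simp [riemannSum, Finsupp.sum, map_sum]

lemma riemannSum_add_left (U : OpenNormalSubgroup H) (τ) (x y : CompleteGroupAlgebra p H)
    (g : H → V) : riemannSum U τ (x + y) g = riemannSum U τ x g + riemannSum U τ y g := by
  change ((x.1 U).coeff + (y.1 U).coeff).sum _ = _
  rw [Finsupp.sum_add_index'] <;> simp [add_smul, riemannSum]

lemma riemannSum_smul_left (U : OpenNormalSubgroup H) (τ) (t : ℤ_[p])
    (x : CompleteGroupAlgebra p H) (g : H → V) :
    riemannSum U τ (t • x) g = t • riemannSum U τ x g := by
  change (t • (x.1 U).coeff).sum _ = _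
  rw [Finsupp.sum_smul_index'] <;> simp [mul_smul, riemannSum, Finsupp.smul_sum]

lemma riemannSum_eq_sum (U : OpenNormalSubgroup H) [Fintype (H ⧸ U.toSubgroup)] (τ)
    (x : CompleteGroupAlgebra p H) (g : H → V) :
    riemannSum U τ x g = ∑ c, coeff p U c x • g (τ c) := by
  rw [riemannSum, Finsupp.sum_fintype _ _ (by simp)]; rfl

variable [TopologicalSpace V] [TopologicalSpace W]

lemma HasIntegral.unique [T2Space V] {x : CompleteGroupAlgebra p H} {g : H → V} {v v' : V}
    (h : HasIntegral x g v) (h' : HasIntegral x g v') : v = v' :=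
  tendsto_nhds_unique (h (fun _ => Quotient.out) fun _ c => QuotientGroup.out_eq' c)
    (h' _ fun _ c => QuotientGroup.out_eq' c)

lemma HasIntegral.add [ContinuousAdd V] {x : CompleteGroupAlgebra p H} {g g' : H → V} {v v' : V}
    (h : HasIntegral x g v) (h' : HasIntegral x g' v') : HasIntegral x (g + g') (v + v') :=
  fun τ hτ => by simpa only [riemannSum_add] using (h τ hτ).add (h' τ hτ)

lemma HasIntegral.add_left [ContinuousAdd V] {x y : CompleteGroupAlgebra p H} {g : H → V}
    {v v' : V} (h : HasIntegral x g v) (h' : HasIntegral y g v') :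
    HasIntegral (x + y) g (v + v') :=
  fun τ hτ => by simpa only [riemannSum_add_left] using (h τ hτ).add (h' τ hτ)

lemma HasIntegral.smul_left [ContinuousConstSMul ℤ_[p] V] (t : ℤ_[p])
    {x : CompleteGroupAlgebra p H} {g : H → V}
    {v : V} (h : HasIntegral x g v) : HasIntegral (t • x) g (t • v) :=
  fun τ hτ => by simpa only [riemannSum_smul_left] using (h τ hτ).const_smul t

lemma HasIntegral.map {x : CompleteGroupAlgebra p H} {g : H → V} {v : V} (h : HasIntegral x g v)
    (L : V →ₗ[ℤ_[p]] W) (hL : Continuous L) : HasIntegral x (L ∘ g) (L v) :=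
  fun τ hτ => by
    simp only [riemannSum_map]
    exact (hL.tendsto v).comp (h τ hτ)

end HasIntegral

/-! ### Integration over profinite groups and representation of functionals -/

section Profinite

variable {p : ℕ} [Fact p.Prime] {H : Type*} [Group H] [TopologicalSpace H] [IsTopologicalGroup H]
  [CompactSpace H] [TotallyDisconnectedSpace H]

instance (U : OpenNormalSubgroup H) : Fintype (H ⧸ U.toSubgroup) :=
  have := Subgroup.quotient_finite_of_isOpen _ U.toOpenSubgroup.isOpen
  Fintype.ofFinite _

/-- Uniform continuity on a compact group, combined with the fact that open normal subgroups form a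
neighbourhood basis of `1` in a profinite group. -/
lemma exists_openNormalSubgroup_norm_sub_le {E : Type*} [SeminormedAddCommGroup E] (g : C(H, E))
    {ε : ℝ} (hε : 0 < ε) : ∃ U : OpenNormalSubgroup H, ∀ h h' : H,
      (h : H ⧸ U.toSubgroup) = h' → ‖g h - g h'‖ ≤ ε := by
  have h1 : ∀ᶠ u in 𝓝 (1 : H), ∀ h ∈ (Set.univ : Set H), ‖g (h * u) - g h‖ < ε := by
    refine isCompact_univ.eventually_forall_of_forall_eventually fun h _ => ?_
    have hc : Continuous fun q : H × H => ‖g (q.2 * q.1) - g q.2‖ := by fun_prop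
    have := hc.tendsto ((1 : H), h)
    simp only [mul_one, sub_self, norm_zero] at this
    exact this.eventually_lt_const hε
  obtain ⟨O, hO, hO', h1O⟩ := mem_nhds_iff.1 h1
  obtain ⟨U, hU⟩ := ProfiniteGrp.exist_openNormalSubgroup_sub_open_nhds_of_one hO' h1O
  refine ⟨U, fun h h' e => ?_⟩
  have := hO (hU (QuotientGroup.eq.1 e)) h trivial
  rw [mul_inv_cancel_left, norm_sub_rev] at this
  exact this.le

omit [IsTopologicalGroup H] [CompactSpace H] [TotallyDisconnectedSpace H] in
-- By coherence of `x`, the coarser sum can be rewritten over `H / U` with the same weights, so the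
-- difference is a single sum of weighted differences of `g`. The weights have norm at most `1`, and
-- the ultrametric inequality makes the number of terms irrelevant.
lemma norm_riemannSum_sub_le {U W : OpenNormalSubgroup H} (hUW : U ≤ W) {g : H → ℤ_[p]} {ε : ℝ}
    (hg : ∀ h h' : H, (h : H ⧸ W.toSubgroup) = h' → ‖g h - g h'‖ ≤ ε)
    {τ : H ⧸ U.toSubgroup → H} {σ : H ⧸ W.toSubgroup → H}
    (hτ : ∀ c, (τ c : H ⧸ U.toSubgroup) = c) (hσ : ∀ c, (σ c : H ⧸ W.toSubgroup) = c)
    (x : CompleteGroupAlgebra p H) : ‖riemannSum U τ x g - riemannSum W σ x g‖ ≤ ε := by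
  have hε : 0 ≤ ε := (norm_nonneg _).trans (hg 1 1 rfl)
  have hW : riemannSum W σ x g = (x.1 U).coeff.sum fun c t => t • g (σ
      (QuotientGroup.map U.toSubgroup W.toSubgroup (MonoidHom.id H) hUW c)) := by
    rw [riemannSum, ← mapDomain_level x hUW, MonoidAlgebra.coeff_mapDomain,
      Finsupp.sum_mapDomain_index (by simp) (by simp [add_mul])]
  rw [hW, riemannSum, Finsupp.sum, Finsupp.sum, ← Finset.sum_sub_distrib]
  refine IsUltrametricDist.norm_sum_le_of_forall_le_of_nonneg hε fun c _ => ?_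
  rw [← smul_sub, smul_eq_mul, norm_mul]
  refine (mul_le_of_le_one_left (norm_nonneg _) (PadicInt.norm_le_one _)).trans (hg _ _ ?_)
  rw [hσ]
  conv_rhs => rw [← hτ c]
  rfl

lemma exists_norm_riemannSum_sub_le (g : C(H, ℤ_[p])) {ε : ℝ} (hε : 0 < ε) :
    ∃ W : OpenNormalSubgroup H, ∀ (x : CompleteGroupAlgebra p H) (U U' : OpenNormalSubgroup H) τ τ',
      U ≤ W → U' ≤ W → (∀ c, ((τ c : H) : H ⧸ U.toSubgroup) = c) →
      (∀ c, ((τ' c : H) : H ⧸ U'.toSubgroup) = c) →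
      ‖riemannSum U τ x g - riemannSum U' τ' x g‖ ≤ ε := by
  obtain ⟨W, hW⟩ := exists_openNormalSubgroup_norm_sub_le g hε
  refine ⟨W, fun x U U' τ τ' hU hU' hτ hτ' => ?_⟩
  have h1 := norm_riemannSum_sub_le hU hW hτ (fun c => QuotientGroup.out_eq' c) x
  have h2 := norm_riemannSum_sub_le hU' hW hτ' (fun c => QuotientGroup.out_eq' c) x
  rw [norm_sub_rev] at h2
  rw [← sub_add_sub_cancel]
  exact (IsUltrametricDist.norm_add_le_max _ _).trans (max_le h1 h2)

lemma exists_hasIntegral (x : CompleteGroupAlgebra p H) (g : C(H, ℤ_[p])) :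
    ∃ v, HasIntegral x g v := by
  have hc : Cauchy (map (fun U => riemannSum U Quotient.out x g)
      (atBot : Filter (OpenNormalSubgroup H))) := by
    rw [Metric.cauchy_iff]
    refine ⟨inferInstance, fun ε hε => ?_⟩
    obtain ⟨W, hW⟩ := exists_norm_riemannSum_sub_le g (ε := ε / 2) (by positivity)
    refine ⟨_, image_mem_map (Iic_mem_atBot W), ?_⟩
    rintro _ ⟨U, hU, rfl⟩ _ ⟨U', hU', rfl⟩
    rw [dist_eq_norm]
    exact (hW x U U' _ _ hU hU' (fun c => QuotientGroup.out_eq' c)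
      (fun c => QuotientGroup.out_eq' c)).trans_lt (by linarith)
  obtain ⟨v, hv⟩ := CompleteSpace.complete hc
  refine ⟨v, fun τ hτ => ?_⟩
  have hv' : Tendsto (fun U => riemannSum U Quotient.out x g) atBot (𝓝 v) := hv
  refine hv'.congr_dist (Metric.tendsto_nhds.2 fun ε hε => ?_)
  obtain ⟨W, hW⟩ := exists_norm_riemannSum_sub_le g (ε := ε / 2) (by positivity)
  filter_upwards [eventually_le_atBot W] with U hU
  rw [dist_zero_right, dist_eq_norm, norm_norm]
  exact (hW x U U _ _ hU hU (fun c => QuotientGroup.out_eq' c) (hτ U)).trans_lt (by linarith)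

/-- The integral of a continuous `ℤ_p`-valued function against an element of `ℤ_p[[H]]`. -/
def integral (x : CompleteGroupAlgebra p H) : C(H, ℤ_[p]) →ₗ[ℤ_[p]] ℤ_[p] where
  toFun g := (exists_hasIntegral x g).choose
  map_add' g g' := (exists_hasIntegral x (g + g')).choose_spec.unique
    ((exists_hasIntegral x g).choose_spec.add (exists_hasIntegral x g').choose_spec)
  map_smul' t g := (exists_hasIntegral x (t • g)).choose_spec.unique
    ((exists_hasIntegral x g).choose_spec.map (LinearMap.mulLeft ℤ_[p] t)
      (continuous_const.mul continuous_id))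

lemma hasIntegral_integral (x : CompleteGroupAlgebra p H) (g : C(H, ℤ_[p])) :
    HasIntegral x g (integral x g) :=
  (exists_hasIntegral x g).choose_spec

lemma integral_add_left (x y : CompleteGroupAlgebra p H) (g : C(H, ℤ_[p])) :
    integral (x + y) g = integral x g + integral y g :=
  (hasIntegral_integral (x + y) g).unique
    ((hasIntegral_integral x g).add_left (hasIntegral_integral y g))

lemma integral_smul_left (t : ℤ_[p]) (x : CompleteGroupAlgebra p H) (g : C(H, ℤ_[p])) :
    integral (t • x) g = t * integral x g :=
  (hasIntegral_integral (t • x) g).unique ((hasIntegral_integral x g).smul_left t)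

/-- The integral of a fixed function, as a functional on `ℤ_p[[H]]`. -/
def integralLeft (g : C(H, ℤ_[p])) : CompleteGroupAlgebra p H →ₗ[ℤ_[p]] ℤ_[p] where
  toFun x := integral x g
  map_add' x y := integral_add_left x y g
  map_smul' t x := integral_smul_left t x g

lemma hasIntegral_groupLike {V : Type*} [AddCommGroup V] [Module ℤ_[p] V] [TopologicalSpace V]
    (h : H) {g : H → V} (hg : Continuous g) : HasIntegral (groupLike p h) g (g h) := by
  intro τ hτ
  have e (U : OpenNormalSubgroup H) :
      riemannSum U (τ U) (groupLike p h) g = g (τ U (h : H ⧸ U.toSubgroup)) := by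
    rw [riemannSum, groupLike_level, MonoidAlgebra.coeff_single, Finsupp.sum_single_index] <;> simp
  simp_rw [e]
  refine (hg.tendsto h).comp ?_
  intro O hO
  obtain ⟨O', hO', ho, h1⟩ := mem_nhds_iff.1
    ((continuous_const_mul h).tendsto' 1 h (mul_one h) hO)
  obtain ⟨U, hU⟩ := ProfiniteGrp.exist_openNormalSubgroup_sub_open_nhds_of_one ho h1
  refine mem_map.2 ?_
  filter_upwards [eventually_le_atBot U] with W hW
  have := hO' (hU (hW (QuotientGroup.eq.1 (hτ W h).symm)))
  simpa using this

lemma integral_groupLike (h : H) (g : C(H, ℤ_[p])) : integral (groupLike p h) g = g h :=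
  (hasIntegral_integral _ g).unique (hasIntegral_groupLike h g.continuous)

lemma norm_integral_sub_riemannSum_le {g : C(H, ℤ_[p])} {ε : ℝ} {W : OpenNormalSubgroup H}
    (hg : ∀ h h' : H, (h : H ⧸ W.toSubgroup) = h' → ‖g h - g h'‖ ≤ ε)
    (x : CompleteGroupAlgebra p H) : ‖integral x g - riemannSum W Quotient.out x g‖ ≤ ε := by
  refine le_of_tendsto (((hasIntegral_integral x g _
    (fun U c => QuotientGroup.out_eq' c)).sub_const _).norm) ?_
  filter_upwards [eventually_le_atBot W] with U hU
  exact norm_riemannSum_sub_le hU hg (fun c => QuotientGroup.out_eq' c)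
    (fun c => QuotientGroup.out_eq' c) x

/-- A level `W` that depends only on `g` makes the Riemann sum `ε/2`-close to the integral for all
`x` simultaneously, and at a fixed level the Riemann sum is a finite combination of coefficients. -/
lemma continuous_integralLeft (g : C(H, ℤ_[p])) : Continuous (integralLeft g) := by
  refine continuous_iff_continuousAt.2 fun x => Metric.tendsto_nhds.2 fun ε hε => ?_
  obtain ⟨W, hW⟩ := exists_openNormalSubgroup_norm_sub_le g (ε := ε / 2) (by positivity)
  have hc : Continuous fun y => riemannSum (p := p) W Quotient.out y (g : H → ℤ_[p]) := by
    simp_rw [riemannSum_eq_sum]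
    exact continuous_finsetSum _ fun c _ => (continuous_coeff W c).smul continuous_const
  filter_upwards [Metric.tendsto_nhds.1 (hc.tendsto x) (ε / 2) (by positivity)] with y hy
  have h1 := norm_integral_sub_riemannSum_le hW y
  have h2 := norm_integral_sub_riemannSum_le hW x
  rw [dist_eq_norm] at hy ⊢
  rw [norm_sub_rev] at h2
  have : integralLeft g y - integralLeft g x = (integral y g - riemannSum W Quotient.out y g) +
      ((riemannSum W Quotient.out y g - riemannSum W Quotient.out x g) +
        (riemannSum W Quotient.out x g - integral x g)) := by
    change integral y g - integral x g = _
    abel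
  rw [this]
  refine (IsUltrametricDist.norm_add_le_max _ _).trans_lt (max_lt (by linarith) ?_)
  exact (IsUltrametricDist.norm_add_le_max _ _).trans_lt (max_lt (by linarith) (by linarith))

open Classical in
/-- The indicator function of a class `c ∈ H / U`. -/
def indicator (U : OpenNormalSubgroup H) (c : H ⧸ U.toSubgroup) : C(H, ℤ_[p]) where
  toFun h := if (h : H ⧸ U.toSubgroup) = c then 1 else 0
  continuous_toFun := by
    have : DiscreteTopology (H ⧸ U.toSubgroup) := QuotientGroup.discreteTopology
      U.toOpenSubgroup.isOpen
    exact (continuous_of_discreteTopology (f := fun d : H ⧸ U.toSubgroup =>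
      if d = c then (1 : ℤ_[p]) else 0)).comp QuotientGroup.continuous_mk

omit [CompactSpace H] [TotallyDisconnectedSpace H] in
open Classical in
lemma indicator_apply (U : OpenNormalSubgroup H) (c : H ⧸ U.toSubgroup) (h : H) :
    indicator (p := p) U c h = if (h : H ⧸ U.toSubgroup) = c then 1 else 0 := rfl

lemma integral_indicator (x : CompleteGroupAlgebra p H) (U : OpenNormalSubgroup H)
    (c : H ⧸ U.toSubgroup) : integral x (indicator U c) = coeff p U c x := by
  classical
  -- The indicator is constant on cosets of `U`, so the error bound holds with `ε = 0` and the
  -- Riemann sum at level `U` is exact.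
  have h := norm_integral_sub_riemannSum_le (g := indicator U c) (ε := 0) (W := U)
    (fun h h' e => by simp [indicator_apply, e]) x
  rw [norm_le_zero_iff, sub_eq_zero] at h
  rw [h, riemannSum_eq_sum]
  simp [indicator_apply]

omit [TotallyDisconnectedSpace H] in
open Classical in
lemma coeff_eq_sum (x : CompleteGroupAlgebra p H) {U W : OpenNormalSubgroup H} (h : U ≤ W)
    (c : H ⧸ W.toSubgroup) : coeff p W c x = ∑ d, if QuotientGroup.map U.toSubgroup W.toSubgroup
      (MonoidHom.id H) h d = c then coeff p U d x else 0 := by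
  change (x.1 W).coeff c = _
  rw [← mapDomain_level x h, MonoidAlgebra.coeff_mapDomain, Finsupp.mapDomain, Finsupp.sum_apply,
    Finsupp.sum_fintype _ _ (by simp)]
  simp only [Finsupp.single_apply]
  rfl

open Classical in
/-- The element of `ℤ_p[[H]]` with a given coherent system of coefficients. -/
def ofCoeffs (b : ∀ U : OpenNormalSubgroup H, H ⧸ U.toSubgroup → ℤ_[p])
    (hb : ∀ (U W : OpenNormalSubgroup H) (h : U ≤ W) (c : H ⧸ W.toSubgroup),
      b W c = ∑ d, if QuotientGroup.map U.toSubgroup W.toSubgroup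
        (MonoidHom.id H) h d = c then b U d else 0) : CompleteGroupAlgebra p H :=
  ⟨fun U => MonoidAlgebra.ofCoeff (Finsupp.equivFunOnFinite.symm (b U)), by
    intro U W hUW
    apply MonoidAlgebra.coeff_injective
    ext c
    simp only [MonoidAlgebra.mapDomainAlgHom_apply, MonoidAlgebra.coeff_mapDomain,
      Finsupp.mapDomain, Finsupp.sum_apply]
    rw [Finsupp.sum_fintype _ _ (by simp)]
    simp only [Finsupp.single_apply, Finsupp.equivFunOnFinite_symm_apply_apply]
    exact (hb U W hUW c).symm⟩

omit [TotallyDisconnectedSpace H] in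
/-- `ℤ_p[[H]]` is closed under limits of coefficients. -/
lemma exists_tendsto_of_coeff {ι : Type*} {l : Filter ι} [l.NeBot]
    {F : ι → CompleteGroupAlgebra p H}
    (h : ∀ U c, ∃ v, Tendsto (fun i => coeff p U c (F i)) l (𝓝 v)) :
    ∃ x, Tendsto F l (𝓝 x) := by
  classical
  choose b hb using h
  refine ⟨ofCoeffs b fun U W hUW c => tendsto_nhds_unique (hb W c) ?_,
    tendsto_completeGroupAlgebra.2 hb⟩
  simp_rw [coeff_eq_sum _ hUW c]
  refine tendsto_finsetSum _ fun d _ => ?_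
  split_ifs
  · exact hb U d
  · exact tendsto_const_nhds

omit [TotallyDisconnectedSpace H] in
open Classical in
lemma indicator_eq_sum {U W : OpenNormalSubgroup H} (hUW : U ≤ W) (c : H ⧸ W.toSubgroup) :
    indicator (p := p) W c = ∑ d, if QuotientGroup.map U.toSubgroup W.toSubgroup
      (MonoidHom.id H) hUW d = c then indicator U d else 0 := by
  ext h
  rw [ContinuousMap.sum_apply, Finset.sum_eq_single (h : H ⧸ U.toSubgroup)]
  · split_ifs with hc
    · rw [indicator_apply, indicator_apply, if_pos rfl, if_pos]
      exact hc
    · rw [indicator_apply, if_neg]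
      · rfl
      · exact hc
  · intro d _ hd
    split_ifs <;> simp [indicator_apply, hd.symm]
  · simp

/-- The element of `ℤ_p[[H]]` that a functional on the continuous functions represents. -/
def ofFunctional (L : C(H, ℤ_[p]) →ₗ[ℤ_[p]] ℤ_[p]) : CompleteGroupAlgebra p H :=
  ofCoeffs (fun U c => L (indicator U c)) fun U W hUW c => by
    rw [indicator_eq_sum hUW, map_sum]
    exact Finset.sum_congr rfl fun d _ => by split_ifs <;> simp

omit [TotallyDisconnectedSpace H] in
lemma coeff_ofFunctional (L : C(H, ℤ_[p]) →ₗ[ℤ_[p]] ℤ_[p]) (U : OpenNormalSubgroup H)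
    (c : H ⧸ U.toSubgroup) : coeff p U c (ofFunctional L) = L (indicator U c) := rfl

omit [Group H] [IsTopologicalGroup H] [CompactSpace H] [TotallyDisconnectedSpace H] in
-- Linear functionals are automatically bounded: a function of norm at most `p^(-k)` is `p^k` times
-- a continuous `ℤ_p`-valued function, and `L` commutes with `p^k`.
lemma norm_functional_le (L : C(H, ℤ_[p]) →ₗ[ℤ_[p]] ℤ_[p]) (g : C(H, ℤ_[p])) (k : ℕ)
    (hg : ∀ h, ‖g h‖ ≤ (p : ℝ) ^ (-(k : ℤ))) : ‖L g‖ ≤ (p : ℝ) ^ (-(k : ℤ)) := by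
  have hp : (p : ℤ_[p]) ^ k ≠ 0 := pow_ne_zero _ (by exact_mod_cast (Fact.out : p.Prime).ne_zero)
  have hd (h : H) : ∃ t : ℤ_[p], g h = (p : ℤ_[p]) ^ k * t := by
    obtain ⟨t, ht⟩ := (PadicInt.norm_le_pow_iff_mem_span_pow _ k).1 (hg h) |>
      Ideal.mem_span_singleton.1
    exact ⟨t, ht⟩
  choose t ht using hd
  have hnorm (s s' : ℤ_[p]) : ‖s - s'‖ = (p : ℝ) ^ k * ‖(p : ℤ_[p]) ^ k * s - p ^ k * s'‖ := by
    rw [← mul_sub, norm_mul, norm_pow, PadicInt.norm_p, ← mul_assoc, ← mul_pow,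
      mul_inv_cancel₀ (by exact_mod_cast (Fact.out : p.Prime).ne_zero), one_pow, one_mul]
  have hcont : Continuous t := by
    refine continuous_iff_continuousAt.2 fun x => tendsto_iff_norm_sub_tendsto_zero.2 ?_
    have e (y : H) : ‖t y - t x‖ = (p : ℝ) ^ k * ‖g y - g x‖ := by rw [hnorm, ← ht, ← ht]
    simp_rw [e]
    have := (tendsto_iff_norm_sub_tendsto_zero.1 (g.continuous.tendsto x)).const_mul ((p : ℝ) ^ k)
    simpa using this
  have : g = (p : ℤ_[p]) ^ k • (⟨t, hcont⟩ : C(H, ℤ_[p])) := by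
    ext h; simp [ht]
  rw [this, map_smul, smul_eq_mul, norm_mul, norm_pow, PadicInt.norm_p, zpow_neg, zpow_natCast,
    inv_pow]
  exact mul_le_of_le_one_right (by positivity) (PadicInt.norm_le_one _)

/-- At each level, the Riemann sum of `g` is the value of `L` at a locally constant approximation of
`g`. Automatic boundedness of `L` makes this close to `L g`, and the Riemann sum is equally close to
the integral. -/
lemma integral_ofFunctional (L : C(H, ℤ_[p]) →ₗ[ℤ_[p]] ℤ_[p]) (g : C(H, ℤ_[p])) :
    integral (ofFunctional L) g = L g := by
  classical
  rw [← sub_eq_zero, ← norm_le_zero_iff]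
  have hp1 : (1 : ℝ) < p := by exact_mod_cast (Fact.out : p.Prime).one_lt
  have hlim : Tendsto (fun k : ℕ => (p : ℝ) ^ (-(k : ℤ))) atTop (𝓝 0) := by
    simpa [Function.comp_def] using tendsto_inv_atTop_zero.comp (tendsto_pow_atTop_atTop_of_one_lt hp1)
  refine ge_of_tendsto' hlim fun k => ?_
  have hk : (0 : ℝ) < (p : ℝ) ^ (-(k : ℤ)) := by positivity
  obtain ⟨W, hW⟩ := exists_openNormalSubgroup_norm_sub_le g hk
  have h1 := norm_integral_sub_riemannSum_le hW (ofFunctional L)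
  have h2 : riemannSum W Quotient.out (ofFunctional L) (g : H → ℤ_[p]) =
      L (∑ c : H ⧸ W.toSubgroup, g c.out • indicator W c) := by
    rw [riemannSum_eq_sum, map_sum]
    simp [coeff_ofFunctional, mul_comm]
  have h3 : ‖riemannSum W Quotient.out (ofFunctional L) g - L g‖ ≤ (p : ℝ) ^ (-(k : ℤ)) := by
    rw [h2, ← map_sub]
    refine norm_functional_le L _ k fun h => ?_
    have : (∑ c : H ⧸ W.toSubgroup, g c.out • indicator W c) h =
        g (h : H ⧸ W.toSubgroup).out := by
      simp [indicator_apply]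
    rw [ContinuousMap.sub_apply, this]
    exact hW _ _ (QuotientGroup.out_eq' _)
  rw [← sub_add_sub_cancel]
  exact (IsUltrametricDist.norm_add_le_max _ _).trans (max_le h1 h3)

lemma ext_integral {x y : CompleteGroupAlgebra p H}
    (h : ∀ g, integral x g = integral y g) : x = y :=
  CompleteGroupAlgebra.ext_coeff fun U c => by
    rw [← integral_indicator, ← integral_indicator, h]

end Profinite

/-! ## Integrals of functions with values in `Q̄_p` -/

section Scalars

variable {p : ℕ} [Fact p.Prime]

lemma algebraMap_padicInt_eq (t : ℤ_[p]) :
    algebraMap ℤ_[p] (PadicAlgCl p) t = algebraMap ℚ_[p] (PadicAlgCl p) (t : ℚ_[p]) := rfl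

lemma norm_algebraMap_padicInt (t : ℤ_[p]) : ‖algebraMap ℤ_[p] (PadicAlgCl p) t‖ = ‖t‖ := by
  rw [algebraMap_padicInt_eq, norm_algebraMap']; rfl

lemma continuous_algebraMap_padicInt : Continuous (algebraMap ℤ_[p] (PadicAlgCl p)) :=
  AddMonoidHomClass.continuous_of_bound (algebraMap ℤ_[p] (PadicAlgCl p)) 1
    fun t => by rw [norm_algebraMap_padicInt, one_mul]

lemma algebraMap_padicInt_injective : Function.Injective (algebraMap ℤ_[p] (PadicAlgCl p)) := by
  intro s t h
  exact Subtype.ext ((algebraMap ℚ_[p] (PadicAlgCl p)).injective h)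

end Scalars

section Tame

variable (p : ℕ) [Fact p.Prime] (H : Type*) [TopologicalSpace H]

/-- The functions `H → Q̄_p` that are finite sums of multiples of continuous `ℤ_p`-valued
functions. -/
def tame : Submodule (PadicAlgCl p) (H → PadicAlgCl p) :=
  Submodule.span _ (Set.range fun (g : C(H, ℤ_[p])) (h : H) => algebraMap ℤ_[p] (PadicAlgCl p) (g h))

variable {p H}

lemma coe_mem_tame (g : C(H, ℤ_[p])) :
    (fun h : H => algebraMap ℤ_[p] (PadicAlgCl p) (g h)) ∈ tame p H :=
  Submodule.subset_span ⟨g, rfl⟩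

lemma continuous_of_mem_tame {g : H → PadicAlgCl p} (hg : g ∈ tame p H) : Continuous g := by
  induction hg using Submodule.span_induction with
  | mem x hx => obtain ⟨g, rfl⟩ := hx; exact continuous_algebraMap_padicInt.comp g.continuous
  | zero => exact continuous_const
  | add x y _ _ hx hy => exact hx.add hy
  | smul q x _ hx => exact continuous_const.mul hx

lemma mul_mem_tame {g g' : H → PadicAlgCl p} (hg : g ∈ tame p H) (hg' : g' ∈ tame p H) :
    g * g' ∈ tame p H := by
  induction hg using Submodule.span_induction with
  | mem x hx =>
    induction hg' using Submodule.span_induction with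
    | mem y hy =>
      obtain ⟨g, rfl⟩ := hx
      obtain ⟨g', rfl⟩ := hy
      convert coe_mem_tame (g * g') using 1
      ext h; simp
    | zero => simp
    | add y z _ _ hy hz => rw [mul_add]; exact add_mem hy hz
    | smul q y _ hy => rw [mul_smul_comm]; exact Submodule.smul_mem _ _ hy
  | zero => simp
  | add y z _ _ hy hz => rw [add_mul]; exact add_mem hy hz
  | smul q y _ hy => rw [smul_mul_assoc]; exact Submodule.smul_mem _ _ hy

lemma comp_mem_tame {K : Type*} [TopologicalSpace K] {g : K → PadicAlgCl p} (hg : g ∈ tame p K)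
    {f : H → K} (hf : Continuous f) : g ∘ f ∈ tame p H := by
  induction hg using Submodule.span_induction with
  | mem x hx => obtain ⟨g, rfl⟩ := hx; exact coe_mem_tame (g.comp ⟨f, hf⟩)
  | zero => exact zero_mem _
  | add x y _ _ hx hy => exact add_mem hx hy
  | smul q x _ hx => exact Submodule.smul_mem _ q hx

/-- The coordinates of `g` in a basis of `E` are continuous `ℚ_p`-valued functions on a compact
space, hence bounded, so a power of `p` makes each of them `ℤ_p`-valued. The inverse powers go into
the `Q̄_p`-coefficients. -/
lemma mem_tame_of_finiteDimensional [CompactSpace H] {g : H → PadicAlgCl p} (hg : Continuous g)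
    (E : Submodule ℚ_[p] (PadicAlgCl p)) [FiniteDimensional ℚ_[p] E] (hE : ∀ h, g h ∈ E) :
    g ∈ tame p H := by
  let b := Module.finBasis ℚ_[p] E
  let g' : H → E := fun h => ⟨g h, hE h⟩
  have hg' : Continuous g' := hg.subtype_mk _
  have hk (i) : Continuous fun h => b.repr (g' h) i :=
    (LinearMap.continuous_of_finiteDimensional (b.coord i)).comp hg'
  have hp0 : (p : ℚ_[p]) ≠ 0 := by exact_mod_cast (Fact.out : p.Prime).ne_zero
  have hp1 : (1 : ℝ) < p := by exact_mod_cast (Fact.out : p.Prime).one_lt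
  have hN (i) : ∃ N : ℕ, ∀ h, ‖(p : ℚ_[p]) ^ N * b.repr (g' h) i‖ ≤ 1 := by
    obtain ⟨C, hC⟩ := isCompact_univ.exists_bound_of_continuousOn (hk i).continuousOn
    obtain ⟨N, hN⟩ := pow_unbounded_of_one_lt C hp1
    refine ⟨N, fun h => ?_⟩
    rw [norm_mul, norm_pow, Padic.norm_p, inv_pow, inv_mul_le_iff₀ (by positivity), mul_one]
    exact (hC h trivial).trans hN.le
  choose N hN using hN
  let f (i) : C(H, ℤ_[p]) :=
    ⟨fun h => ⟨(p : ℚ_[p]) ^ N i * b.repr (g' h) i, hN i h⟩,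
      (continuous_const.mul (hk i)).subtype_mk _⟩
  have key : g = ∑ i, (((b i : PadicAlgCl p)) * (algebraMap ℚ_[p] (PadicAlgCl p) (p ^ N i))⁻¹) •
      fun h => algebraMap ℤ_[p] (PadicAlgCl p) (f i h) := by
    ext h
    have h1 : (g' h : PadicAlgCl p) = ((∑ i, b.repr (g' h) i • b i : E) : PadicAlgCl p) := by
      rw [b.sum_repr]
    change (g' h : PadicAlgCl p) = _
    rw [h1, Finset.sum_apply, AddSubmonoidClass.coe_finsetSum]
    refine Finset.sum_congr rfl fun i _ => ?_
    have h2 : algebraMap ℚ_[p] (PadicAlgCl p) (p ^ N i) ≠ 0 :=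
      (map_ne_zero _).2 (pow_ne_zero _ hp0)
    have h3 : algebraMap ℤ_[p] (PadicAlgCl p) (f i h) =
      algebraMap ℚ_[p] (PadicAlgCl p) (p ^ N i) *
        algebraMap ℚ_[p] (PadicAlgCl p) (b.repr (g' h) i) := by
      rw [algebraMap_padicInt_eq, ← map_mul]
      rfl
    rw [Pi.smul_apply, h3, smul_eq_mul, mul_assoc, inv_mul_cancel_left₀ h2, Submodule.coe_smul,
      Algebra.smul_def, mul_comm]
  rw [key]
  exact sum_mem fun i _ => Submodule.smul_mem _ _ (coe_mem_tame _)

end Tame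

/-! ### Integrals of tame functions -/

section TameIntegral

variable {p : ℕ} [Fact p.Prime] {H : Type*} [Group H] [TopologicalSpace H]

/-- The integral of a tame function. -/
def tameIntegral (x : CompleteGroupAlgebra p H) (g : H → PadicAlgCl p) : PadicAlgCl p :=
  Classical.epsilon (HasIntegral x g)

lemma HasIntegral.tameIntegral_eq {x : CompleteGroupAlgebra p H} {g : H → PadicAlgCl p}
    {v : PadicAlgCl p} (h : HasIntegral x g v) : tameIntegral x g = v :=
  (Classical.epsilon_spec (p := HasIntegral x g) ⟨v, h⟩).unique h


lemma HasIntegral.smul_bar {x : CompleteGroupAlgebra p H} {g : H → PadicAlgCl p}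
    {v : PadicAlgCl p} (h : HasIntegral x g v) (q : PadicAlgCl p) :
    HasIntegral x (q • g) (q * v) :=
  h.map (LinearMap.mulLeft ℤ_[p] q) (continuous_const.mul continuous_id)

variable [IsTopologicalGroup H] [CompactSpace H] [TotallyDisconnectedSpace H]

lemma hasIntegral_coe (x : CompleteGroupAlgebra p H) (g : C(H, ℤ_[p])) :
    HasIntegral x (fun h : H => algebraMap ℤ_[p] (PadicAlgCl p) (g h))
      (algebraMap ℤ_[p] (PadicAlgCl p) (integral x g)) :=
  (hasIntegral_integral x g).map (Algebra.linearMap ℤ_[p] (PadicAlgCl p))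
    continuous_algebraMap_padicInt

/-- No Cauchy argument is available, as `Q̄_p` is not complete. The limit is built by induction over
the span from integrals of `ℤ_p`-valued functions. -/
lemma hasIntegral_tameIntegral (x : CompleteGroupAlgebra p H) {g : H → PadicAlgCl p}
    (hg : g ∈ tame p H) : HasIntegral x g (tameIntegral x g) := by
  refine Classical.epsilon_spec (p := HasIntegral x g) ?_
  induction hg using Submodule.span_induction with
  | mem y hy => obtain ⟨g, rfl⟩ := hy; exact ⟨_, hasIntegral_coe x g⟩
  | zero => exact ⟨0, by simpa using (hasIntegral_coe x 0).smul_bar 0⟩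
  | add y z _ _ hy hz =>
    obtain ⟨v, hv⟩ := hy
    obtain ⟨w, hw⟩ := hz
    exact ⟨_, hv.add hw⟩
  | smul q y _ hy =>
    obtain ⟨v, hv⟩ := hy
    exact ⟨_, hv.smul_bar q⟩

lemma tameIntegral_coe (x : CompleteGroupAlgebra p H) (g : C(H, ℤ_[p])) :
    tameIntegral x (fun h : H => algebraMap ℤ_[p] (PadicAlgCl p) (g h)) =
      algebraMap ℤ_[p] (PadicAlgCl p) (integral x g) :=
  (hasIntegral_coe x g).tameIntegral_eq

lemma tameIntegral_zero (x : CompleteGroupAlgebra p H) :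
    tameIntegral x (0 : H → PadicAlgCl p) = 0 := by
  simpa using ((hasIntegral_coe x 0).smul_bar 0).tameIntegral_eq

lemma tameIntegral_add (x : CompleteGroupAlgebra p H) {g g' : H → PadicAlgCl p}
    (hg : g ∈ tame p H) (hg' : g' ∈ tame p H) :
    tameIntegral x (g + g') = tameIntegral x g + tameIntegral x g' :=
  ((hasIntegral_tameIntegral x hg).add (hasIntegral_tameIntegral x hg')).tameIntegral_eq

lemma tameIntegral_smul (x : CompleteGroupAlgebra p H) (q : PadicAlgCl p) {g : H → PadicAlgCl p}
    (hg : g ∈ tame p H) : tameIntegral x (q • g) = q * tameIntegral x g :=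
  ((hasIntegral_tameIntegral x hg).smul_bar q).tameIntegral_eq

lemma tameIntegral_groupLike (h : H) {g : H → PadicAlgCl p} (hg : g ∈ tame p H) :
    tameIntegral (groupLike p h) g = g h :=
  (hasIntegral_groupLike h (continuous_of_mem_tame hg)).tameIntegral_eq

/-- The integral of a fixed tame function, as a functional on `ℤ_p[[H]]`. -/
def tameIntegralLeft {g : H → PadicAlgCl p} (hg : g ∈ tame p H) :
    CompleteGroupAlgebra p H →ₗ[ℤ_[p]] PadicAlgCl p where
  toFun x := tameIntegral x g
  map_add' x y := ((hasIntegral_tameIntegral x hg).add_left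
    (hasIntegral_tameIntegral y hg)).tameIntegral_eq
  map_smul' t x := ((hasIntegral_tameIntegral x hg).smul_left t).tameIntegral_eq

lemma continuous_tameIntegral {g : H → PadicAlgCl p} (hg : g ∈ tame p H) :
    Continuous fun x : CompleteGroupAlgebra p H => tameIntegral x g := by
  induction hg using Submodule.span_induction with
  | mem y hy =>
    obtain ⟨g, rfl⟩ := hy
    simp_rw [tameIntegral_coe]
    exact continuous_algebraMap_padicInt.comp (continuous_integralLeft g)
  | zero => simp_rw [tameIntegral_zero]; exact continuous_const
  | add y z hy hz ihy ihz => simp_rw [tameIntegral_add _ hy hz]; exact ihy.add ihz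
  | smul q y hy ihy => simp_rw [tameIntegral_smul _ q hy]; exact continuous_const.mul ihy

lemma tameIntegral_ofGroupAlgebra (y : MonoidAlgebra ℤ_[p] H) {g : H → PadicAlgCl p}
    (hg : g ∈ tame p H) :
    tameIntegral (ofGroupAlgebra p y) g = y.coeff.sum fun h t => t • g h := by
  change tameIntegralLeft hg _ = _
  rw [ofGroupAlgebra, MonoidAlgebra.lift_apply, map_finsuppSum]
  refine Finsupp.sum_congr fun h _ => ?_
  rw [map_smul]
  congr 1
  exact tameIntegral_groupLike h hg

end TameIntegral

/-! ## The topology of the free pro-`p` group -/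

section FreeProP

variable {p n : ℕ}

lemma exists_index_eq_of_pow_mem [Fact p.Prime] {K : Subgroup (FreeGroup (Fin n))} [K.Normal]
    [K.FiniteIndex] (h : ∀ w, ∃ k : ℕ, w ^ p ^ k ∈ K) : ∃ e : ℕ, K.index = p ^ e := by
  have hp : IsPGroup p (FreeGroup (Fin n) ⧸ K) := by
    intro w
    obtain ⟨w, rfl⟩ := QuotientGroup.mk_surjective w
    obtain ⟨k, hk⟩ := h w
    exact ⟨k, by rwa [← QuotientGroup.mk_pow, QuotientGroup.eq_one_iff]⟩
  exact hp.exists_card_eq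

lemma PPowerIndexSubgroup.exists_pow_mem (N : PPowerIndexSubgroup p n) :
    ∃ e : ℕ, ∀ w, w ^ p ^ e ∈ N.1 := by
  obtain ⟨e, he⟩ := N.2.2
  exact ⟨e, fun w => he ▸ Subgroup.pow_index_mem N.1 w⟩

instance [Fact p.Prime] (N : PPowerIndexSubgroup p n) : N.1.FiniteIndex := by
  obtain ⟨e, he⟩ := N.2.2
  exact ⟨he ▸ pow_ne_zero _ (Fact.out : p.Prime).ne_zero⟩

instance [Fact p.Prime] (N : PPowerIndexSubgroup p n) : Finite (FreeGroup (Fin n) ⧸ N.1) :=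
  Subgroup.finite_quotient_of_finiteIndex

instance : Nonempty (PPowerIndexSubgroup p n) :=
  ⟨⟨⊤, inferInstance, 0, by simp⟩⟩

/-- Directedness of the levels, by intersecting: a `p^(a+b)`-th power lies in both subgroups. It
makes the single levels a neighbourhood basis. -/
lemma PPowerIndexSubgroup.exists_le_le [Fact p.Prime] (M N : PPowerIndexSubgroup p n) :
    ∃ K : PPowerIndexSubgroup p n, K.1 ≤ M.1 ∧ K.1 ≤ N.1 := by
  obtain ⟨a, ha⟩ := M.exists_pow_mem
  obtain ⟨b, hb⟩ := N.exists_pow_mem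
  refine ⟨⟨M.1 ⊓ N.1, inferInstance, exists_index_eq_of_pow_mem fun w => ⟨a + b, ?_, ?_⟩⟩,
    inf_le_left, inf_le_right⟩
  · rw [pow_add, mul_comm, pow_mul]; exact ha _
  · rw [pow_add, pow_mul]; exact hb _

lemma eq_of_le {M N : PPowerIndexSubgroup p n} (h : M.1 ≤ N.1) {x y : FreeProP p n}
    (hxy : x.1 M = y.1 M) : x.1 N = y.1 N := by
  rw [← x.2 M N h, ← y.2 M N h, hxy]

lemma hasBasis_nhds_freeProP [Fact p.Prime] (x : FreeProP p n) :
    (𝓝 x).HasBasis (fun _ : PPowerIndexSubgroup p n => True)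
      fun N => {y | y.1 N = x.1 N} := by
  have h : 𝓝 x = ⨅ N : PPowerIndexSubgroup p n, 𝓟 {y : FreeProP p n | y.1 N = x.1 N} := by
    rw [nhds_iInf]
    congr 1
    ext1 N
    let _ : TopologicalSpace (FreeGroup (Fin n) ⧸ N.1) := ⊥
    have : DiscreteTopology (FreeGroup (Fin n) ⧸ N.1) := ⟨rfl⟩
    rw [nhds_induced, nhds_discrete, comap_pure]
    rfl
  rw [h]
  refine hasBasis_iInf_principal ?_
  intro M N
  obtain ⟨K, hM, hN⟩ := M.exists_le_le N
  exact ⟨K, fun y hy => eq_of_le hM hy, fun y hy => eq_of_le hN hy⟩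

lemma denseRange_ofFree [Fact p.Prime] : DenseRange (ofFree p n) := by
  intro x
  rw [mem_closure_iff_nhds_basis (hasBasis_nhds_freeProP x)]
  intro N _
  obtain ⟨w, hw⟩ := QuotientGroup.mk_surjective (x.1 N)
  exact ⟨_, ⟨w, rfl⟩, hw⟩

lemma isInducing_freeProP
    [t : ∀ N : PPowerIndexSubgroup p n, TopologicalSpace (FreeGroup (Fin n) ⧸ N.1)]
    [∀ N : PPowerIndexSubgroup p n, DiscreteTopology (FreeGroup (Fin n) ⧸ N.1)] :
    IsInducing fun (x : FreeProP p n) (N : PPowerIndexSubgroup p n) => x.1 N := by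
  constructor
  obtain rfl : t = fun _ => ⊥ := funext fun N => DiscreteTopology.eq_bot
  simp only [Pi.topologicalSpace, induced_iInf, induced_compose]
  rfl

lemma isOpen_level [Fact p.Prime] (x : FreeProP p n) (N : PPowerIndexSubgroup p n) :
    IsOpen {y : FreeProP p n | y.1 N = x.1 N} := by
  rw [isOpen_iff_mem_nhds]
  intro y hy
  rw [(hasBasis_nhds_freeProP y).mem_iff]
  exact ⟨N, trivial, fun z hz => Eq.trans hz hy⟩

instance [Fact p.Prime] : IsTopologicalGroup (FreeProP p n) where
  continuous_mul := by
    refine continuous_iff_continuousAt.2 fun ⟨x, y⟩ => ?_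
    refine (hasBasis_nhds_freeProP (x * y)).tendsto_right_iff.2 fun N _ => ?_
    rw [nhds_prod_eq]
    filter_upwards [prod_mem_prod ((isOpen_level x N).mem_nhds rfl)
      ((isOpen_level y N).mem_nhds rfl)] with z hz
    exact congrArg₂ (· * ·) hz.1 hz.2
  continuous_inv := by
    refine continuous_iff_continuousAt.2 fun x => ?_
    refine (hasBasis_nhds_freeProP x⁻¹).tendsto_right_iff.2 fun N _ => ?_
    filter_upwards [(isOpen_level x N).mem_nhds rfl] with z hz
    exact congrArg (·⁻¹) hz

instance [Fact p.Prime] : CompactSpace (FreeProP p n) := by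
  let _ (N : PPowerIndexSubgroup p n) : TopologicalSpace (FreeGroup (Fin n) ⧸ N.1) := ⊥
  have (N : PPowerIndexSubgroup p n) : DiscreteTopology (FreeGroup (Fin n) ⧸ N.1) := ⟨rfl⟩
  -- The coherence conditions are closed, so the inverse limit is a closed subset of a product of
  -- finite discrete spaces.
  have hc : IsClosed (Set.range fun (x : FreeProP p n) (N : PPowerIndexSubgroup p n) => x.1 N) := by
    have : (Set.range fun (x : FreeProP p n) (N : PPowerIndexSubgroup p n) => x.1 N) =
        ⋂ (M : PPowerIndexSubgroup p n) (N : PPowerIndexSubgroup p n) (h : M.1 ≤ N.1),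
          {x | QuotientGroup.map M.1 N.1 (MonoidHom.id _) h (x M) = x N} := by
      ext x
      simp only [Set.mem_iInter]
      exact ⟨fun ⟨y, hy⟩ => hy ▸ y.2, fun h => ⟨⟨x, h⟩, rfl⟩⟩
    rw [this]
    refine isClosed_iInter fun M => isClosed_iInter fun N => isClosed_iInter fun h => ?_
    exact isClosed_eq (continuous_of_discreteTopology.comp (continuous_apply M))
      (continuous_apply N)
  have hi := isInducing_freeProP (p := p) (n := n)
  rw [← isCompact_univ_iff, hi.isCompact_iff, Set.image_univ]
  exact hc.isCompact

instance : TotallyDisconnectedSpace (FreeProP p n) := by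
  let _ (N : PPowerIndexSubgroup p n) : TopologicalSpace (FreeGroup (Fin n) ⧸ N.1) := ⊥
  have (N : PPowerIndexSubgroup p n) : DiscreteTopology (FreeGroup (Fin n) ⧸ N.1) := ⟨rfl⟩
  exact ⟨isTotallyDisconnected_of_image
    (isInducing_freeProP (p := p) (n := n)).continuous.continuousOn (fun x y h => Subtype.ext h)
    (isTotallyDisconnected_of_totallyDisconnectedSpace _)⟩

lemma exists_forall_mem [Fact p.Prime] (U : OpenNormalSubgroup (FreeProP p n)) :
    ∃ N : PPowerIndexSubgroup p n, ∀ x : FreeProP p n, x.1 N = 1 → x ∈ U := by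
  obtain ⟨N, _, hN⟩ := (hasBasis_nhds_freeProP (1 : FreeProP p n)).mem_iff.1
    (U.toOpenSubgroup.isOpen.mem_nhds (one_mem U))
  exact ⟨N, fun x hx => hN hx⟩

end FreeProP

/-! ## Fox derivatives -/

section FreeFox

variable {n : ℕ}

/-- The action of a generator in the Magnus-type representation that defines `∂/∂g_i`. -/
def magnusGen (i j : Fin n) :
    (Matrix (Fin 2) (Fin 2) (MonoidAlgebra ℤ (FreeGroup (Fin n))))ˣ where
  val := !![MonoidAlgebra.of ℤ _ (FreeGroup.of j), if j = i then 1 else 0; 0, 1]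
  inv := !![MonoidAlgebra.of ℤ _ (FreeGroup.of j)⁻¹,
    if j = i then -MonoidAlgebra.of ℤ _ (FreeGroup.of j)⁻¹ else 0; 0, 1]
  val_inv := by
    simp only [Matrix.mul_fin_two, ← map_mul, Matrix.one_fin_two]
    split_ifs <;> simp [MonoidAlgebra.one_def]
  inv_val := by
    simp only [Matrix.mul_fin_two, ← map_mul, Matrix.one_fin_two]
    split_ifs <;> simp [MonoidAlgebra.one_def]

/-- The recursion of `foxWord` is multiplication by a matrix of `magnusGen`. Since the left side is
a homomorphism on the free group, the Fox derivative is independent of the chosen word, and the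
product rule follows by comparing upper right entries. -/
lemma lift_magnusGen_mk (i : Fin n) (L : List (Fin n × Bool)) :
    (FreeGroup.lift (magnusGen i) (FreeGroup.mk L) : Matrix (Fin 2) (Fin 2) _) =
      !![MonoidAlgebra.of ℤ _ (FreeGroup.mk L), foxWord i L; 0, 1] := by
  induction L with
  | nil =>
    rw [← FreeGroup.one_eq_mk, map_one]
    simp [foxWord, Matrix.one_fin_two, MonoidAlgebra.one_def]
  | cons a L ih =>
    obtain ⟨j, b⟩ := a
    have hL : FreeGroup.mk ((j, b) :: L) = FreeGroup.mk [(j, b)] * FreeGroup.mk L := by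
      simp [FreeGroup.mul_mk]
    rw [hL, map_mul, Units.val_mul, ih, map_mul]
    cases b
    · have hj : FreeGroup.mk [(j, false)] = (FreeGroup.of j)⁻¹ := rfl
      rw [hj, map_inv, FreeGroup.lift_apply_of]
      change !![_, _; _, _] * _ = _
      rw [Matrix.mul_fin_two]
      simp [foxWord, add_comm]
    · have hj : FreeGroup.mk [(j, true)] = FreeGroup.of j := rfl
      rw [hj, FreeGroup.lift_apply_of]
      change !![_, _; _, _] * _ = _
      rw [Matrix.mul_fin_two]
      simp [foxWord, add_comm]

lemma lift_magnusGen (i : Fin n) (w : FreeGroup (Fin n)) :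
    (FreeGroup.lift (magnusGen i) w : Matrix (Fin 2) (Fin 2) _) =
      !![MonoidAlgebra.of ℤ _ w, foxFree i w; 0, 1] := by
  have := lift_magnusGen_mk i w.toWord
  rwa [FreeGroup.mk_toWord] at this

lemma foxFree_mul (i : Fin n) (w v : FreeGroup (Fin n)) :
    foxFree i (w * v) = foxFree i w + MonoidAlgebra.of ℤ _ w * foxFree i v := by
  have h := lift_magnusGen i (w * v)
  rw [map_mul, Units.val_mul, lift_magnusGen, lift_magnusGen, Matrix.mul_fin_two] at h
  have := congrFun (congrFun h 0) 1
  simp at this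
  rw [← this]; simp [add_comm]

lemma foxFree_of (i j : Fin n) : foxFree i (FreeGroup.of j) = if j = i then 1 else 0 := by
  simp [foxFree, foxWord]

end FreeFox

/-! ### Convergence and continuity of the pro-`p` Fox derivative -/

section FoxLimit

variable {p : ℕ} [Fact p.Prime] {n : ℕ}

/-- The pair `(ρ, d)` is a homomorphism to triangular matrices over a finite ring. A `p^e`-th power
of each image is unipotent, and a further `p^k`-th power kills it because `p^k = 0` in `B`. Hence
the kernel has `p`-power index, and `d` is constant on its cosets. -/
lemma exists_subgroup_of_crossed {B : Type*} [Ring B] [Finite B] {k : ℕ} (hk : ((p ^ k : ℕ) : B) = 0)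
    (ρ : FreeGroup (Fin n) →* B) (hρ : ∀ w, ∃ e : ℕ, ρ w ^ p ^ e = 1)
    (d : FreeGroup (Fin n) → B) (hd : ∀ w v, d (w * v) = d w + ρ w * d v) :
    ∃ N : PPowerIndexSubgroup p n, ∀ w v : FreeGroup (Fin n),
      (w : FreeGroup (Fin n) ⧸ N.1) = v → d w = d v := by
  have hd1 : d 1 = 0 := by simpa using hd 1 1
  let T : FreeGroup (Fin n) →* Matrix (Fin 2) (Fin 2) B :=
    { toFun := fun w => !![ρ w, d w; 0, 1]
      map_one' := by simp [hd1, Matrix.one_fin_two]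
      map_mul' := fun w v => by simp [hd, add_comm] }
  have hT (w) : T w = !![ρ w, d w; 0, 1] := rfl
  let K := T.toHomUnits.ker
  have hK (w) : w ∈ K ↔ T w = 1 := by
    rw [MonoidHom.mem_ker, Units.ext_iff]; rfl
  have hpow (w) : ∃ e : ℕ, w ^ p ^ e ∈ K := by
    obtain ⟨e, he⟩ := hρ w
    refine ⟨e + k, ?_⟩
    rw [pow_add, pow_mul, hK, map_pow, hT, map_pow, he]
    have (b : B) (m : ℕ) : !![1, b; 0, 1] ^ m = !![1, m * b; 0, 1] := by
      induction m with
      | zero => simp [Matrix.one_fin_two]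
      | succ m ih => rw [pow_succ, ih, Matrix.mul_fin_two]; simp [add_mul, add_comm]
    rw [this, hk]
    simp [Matrix.one_fin_two]
  refine ⟨⟨K, inferInstance, exists_index_eq_of_pow_mem hpow⟩, fun w v h => ?_⟩
  have h1 : w⁻¹ * v ∈ K := QuotientGroup.eq.1 h
  have h2 : T w = T v := by
    have : T (w * (w⁻¹ * v)) = T w := by rw [map_mul, (hK _).1 h1, mul_one]
    rwa [mul_inv_cancel_left, eq_comm] at this
  exact congrFun (congrFun h2 0) 1

/-- The image of the classical Fox derivative in the complete group algebra. -/
def foxImage (p : ℕ) [Fact p.Prime] {n : ℕ} (i : Fin n) (w : FreeGroup (Fin n)) :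
    CompleteGroupAlgebra p (FreeProP p n) :=
  MonoidAlgebra.lift ℤ (CompleteGroupAlgebra p (FreeProP p n)) (FreeGroup (Fin n))
    ((groupLike p).comp (ofFree p n)) (foxFree i w)

lemma foxImage_mul (i : Fin n) (w v : FreeGroup (Fin n)) :
    foxImage p i (w * v) = foxImage p i w + groupLike p (ofFree p n w) * foxImage p i v := by
  simp only [foxImage, foxFree_mul, map_add, map_mul, MonoidAlgebra.lift_of, MonoidHom.comp_apply]

lemma foxImage_of (i j : Fin n) :
    foxImage p i (FreeGroup.of j) = if j = i then 1 else 0 := by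
  rw [foxImage, foxFree_of]; split_ifs <;> simp

/-- Reduced modulo `p^k` at level `U`, the Fox derivative is a crossed homomorphism into a finite
group ring. It is therefore constant on cosets of a `p`-power index subgroup, which is uniform
continuity for the pro-`p` topology. -/
lemma exists_norm_coeff_foxImage_le (i : Fin n) (U : OpenNormalSubgroup (FreeProP p n))
    (c : FreeProP p n ⧸ U.toSubgroup) (k : ℕ) :
    ∃ N : PPowerIndexSubgroup p n, ∀ w v : FreeGroup (Fin n),
      (w : FreeGroup (Fin n) ⧸ N.1) = v →
        ‖coeff p U c (foxImage p i w) - coeff p U c (foxImage p i v)‖ ≤ (p : ℝ) ^ (-(k : ℤ)) := by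
  have : NeZero (p ^ k) := ⟨pow_ne_zero _ (Fact.out : p.Prime).ne_zero⟩
  let B := MonoidAlgebra (ZMod (p ^ k)) (FreeProP p n ⧸ U.toSubgroup)
  have : Finite B := .of_injective (fun b : B => (b.coeff : _ → ZMod (p ^ k)))
    fun b b' h => MonoidAlgebra.ext (DFunLike.coe_injective h)
  let red : MonoidAlgebra ℤ_[p] (FreeProP p n ⧸ U.toSubgroup) →+* B :=
    MonoidAlgebra.mapRingHom _ (PadicInt.toZModPow k)
  let ρ : FreeGroup (Fin n) →* B :=
    (MonoidAlgebra.of _ _).comp ((QuotientGroup.mk' U.toSubgroup).comp (ofFree p n))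
  -- `U` contains the kernel of the projection to some level `F / N`, a finite `p`-group.
  have hρ (w) : ∃ e : ℕ, ρ w ^ p ^ e = 1 := by
    obtain ⟨N, hN⟩ := exists_forall_mem U
    obtain ⟨e, he⟩ := N.exists_pow_mem
    refine ⟨e, ?_⟩
    have h1 : ofFree p n (w ^ p ^ e) ∈ U :=
      hN _ ((QuotientGroup.eq_one_iff (N := N.1) (w ^ p ^ e)).2 (he w))
    have h2 : ((ofFree p n (w ^ p ^ e) : FreeProP p n) : FreeProP p n ⧸ U.toSubgroup) = 1 :=
      (QuotientGroup.eq_one_iff _).2 h1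
    rw [← map_pow]
    change MonoidAlgebra.of _ _ ((ofFree p n (w ^ p ^ e) : FreeProP p n) :
      FreeProP p n ⧸ U.toSubgroup) = 1
    rw [h2, map_one]
  obtain ⟨N, hN⟩ := exists_subgroup_of_crossed (p := p) (B := B) (k := k)
    (by rw [← map_natCast (algebraMap (ZMod (p ^ k)) B)]; simp) ρ hρ
    (fun w => red ((foxImage p i w).1 U)) (fun w v => by
      have h : (foxImage p i (w * v)).1 U = (foxImage p i w).1 U +
          (groupLike p (ofFree p n w)).1 U * (foxImage p i v).1 U := by
        rw [foxImage_mul]; rfl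
      rw [h, map_add, map_mul, groupLike_level]
      congr 2
      exact (MonoidAlgebra.map_single _ _ _).trans (congrArg (MonoidAlgebra.single _)
        (map_one (PadicInt.toZModPow k))))
  refine ⟨N, fun w v h => ?_⟩
  rw [PadicInt.norm_le_pow_iff_mem_span_pow, ← PadicInt.ker_toZModPow, RingHom.mem_ker, map_sub,
    sub_eq_zero]
  exact DFunLike.congr_fun (congrArg MonoidAlgebra.coeff (hN w v h)) c

lemma comap_ofFree_neBot (x : FreeProP p n) : (comap (ofFree p n) (𝓝 x)).NeBot :=
  comap_neBot fun t ht =>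
    let ⟨_, hy, w, hw⟩ := mem_closure_iff_nhds.1 (denseRange_ofFree x) t ht
    ⟨w, hw ▸ hy⟩

lemma exists_tendsto_foxImage (i : Fin n) (x : FreeProP p n) :
    ∃ y, Tendsto (foxImage p i) (comap (ofFree p n) (𝓝 x)) (𝓝 y) := by
  have := comap_ofFree_neBot x
  refine exists_tendsto_of_coeff fun U c => ?_
  have hp1 : (1 : ℝ) < p := by exact_mod_cast (Fact.out : p.Prime).one_lt
  have hc : Cauchy (map (fun w => coeff p U c (foxImage p i w))
      (comap (ofFree p n) (𝓝 x))) := by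
    rw [Metric.cauchy_iff]
    refine ⟨inferInstance, fun ε hε => ?_⟩
    obtain ⟨k, hk⟩ := exists_pow_lt_of_lt_one hε (inv_lt_one_of_one_lt₀ hp1)
    obtain ⟨N, hN⟩ := exists_norm_coeff_foxImage_le i U c k
    refine ⟨_, image_mem_map (preimage_mem_comap ((isOpen_level x N).mem_nhds rfl)), ?_⟩
    rintro _ ⟨w, hw, rfl⟩ _ ⟨v, hv, rfl⟩
    rw [dist_eq_norm]
    refine (hN w v (Eq.trans hw hv.symm)).trans_lt ?_
    rwa [zpow_neg, zpow_natCast, ← inv_pow]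
  exact CompleteSpace.complete hc

/-- With the topology induced from `F_n` on the discrete free group, `fox` is by definition an
extension along a dense inducing map. Its continuity then follows from the existence of all limits,
the target being regular. -/
lemma isDenseInducing_ofFree :
    @IsDenseInducing _ _ (TopologicalSpace.induced (ofFree p n) inferInstance) _ (ofFree p n) :=
  @IsDenseInducing.mk _ _ (_) _ _ (@IsInducing.mk _ _ (_) _ _ rfl) denseRange_ofFree

lemma fox_eq_extend (i : Fin n) : fox p i = @IsDenseInducing.extend _ _ _
    (TopologicalSpace.induced (ofFree p n) inferInstance) _ _ _ isDenseInducing_ofFree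
      (foxImage p i) := rfl

lemma continuous_fox (i : Fin n) : Continuous (fox p (n := n) i) := by
  rw [fox_eq_extend]
  exact @IsDenseInducing.continuous_extend _ _ _ (_) _ _ _ _ _ isDenseInducing_ofFree
    (exists_tendsto_foxImage i)

lemma fox_ofFree (i : Fin n) (w : FreeGroup (Fin n)) : fox p i (ofFree p n w) = foxImage p i w := by
  have := comap_ofFree_neBot (ofFree p n w)
  obtain ⟨y, hy⟩ := exists_tendsto_foxImage i (ofFree p n w)
  have h : Tendsto (foxImage p i) (pure w) (𝓝 y) :=
    hy.mono_left (map_le_iff_le_comap.1 (by rw [map_pure]; exact pure_le_nhds _))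
  rw [tendsto_nhds_unique h (tendsto_pure_nhds _ w)] at hy
  exact hy.limUnder_eq

end FoxLimit

/-! ## The ring `Q̄_p ⊗ ℤ_p[[Γ]]` -/

section Iwasawa

variable {p : ℕ} [Fact p.Prime]

instance : Module.IsTorsionFree ℤ_[p] (PadicAlgCl p) :=
  Module.isTorsionFree_iff_algebraMap_injective.2 algebraMap_padicInt_injective

/-- Every tensor can be written with linearly independent left components. -/
lemma exists_eq_sum_tmul {M : Type*} [AddCommGroup M] [Module ℤ_[p] M]
    (f : PadicAlgCl p ⊗[ℤ_[p]] M) : ∃ (d : ℕ) (e : Fin d → PadicAlgCl p) (y : Fin d → M),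
      LinearIndependent ℤ_[p] e ∧ f = ∑ j, e j ⊗ₜ y j := by
  obtain ⟨N, hN, hf⟩ := TensorProduct.exists_finite_submodule_left_of_setFinite {f}
    (Set.finite_singleton f)
  obtain ⟨f', rfl⟩ := hf rfl
  have : Module.Free ℤ_[p] N := Module.free_of_finite_type_torsion_free'
  let b := Module.finBasis ℤ_[p] N
  have key : ∃ y : Fin (Module.finrank ℤ_[p] N) → M, f' = ∑ j, b j ⊗ₜ y j := by
    clear hf
    induction f' using TensorProduct.induction_on with
    | zero => exact ⟨0, by simp⟩
    | tmul q x =>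
      refine ⟨fun j => b.repr q j • x, ?_⟩
      conv_lhs => rw [← b.sum_repr q]
      simp_rw [TensorProduct.sum_tmul, TensorProduct.smul_tmul]
    | add u v hu hv =>
      obtain ⟨y, rfl⟩ := hu
      obtain ⟨z, rfl⟩ := hv
      exact ⟨y + z, by simp [TensorProduct.tmul_add, Finset.sum_add_distrib]⟩
  obtain ⟨y, rfl⟩ := key
  refine ⟨_, fun j => (b j : PadicAlgCl p), y,
    b.linearIndependent.map' N.subtype (Submodule.ker_subtype N), ?_⟩
  simp

lemma coeffBar_tmul (U : OpenNormalSubgroup (Gam p)) (c : Gam p ⧸ U.toSubgroup) (q : PadicAlgCl p)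
    (x : CompleteGroupAlgebra p (Gam p)) :
    coeffBar p U c (q ⊗ₜ x) = q * algebraMap ℤ_[p] (PadicAlgCl p) (coeff p U c x) := rfl

/-- Once the left components are linearly independent over `ℤ_p`, a vanishing coefficient of the sum
forces that coefficient of every right component to vanish. This makes the coefficient topology on
`R` Hausdorff. -/
lemma IwasawaRing.ext_coeffBar {f g : IwasawaRing p}
    (h : ∀ U c, coeffBar p U c f = coeffBar p U c g) : f = g := by
  rw [← sub_eq_zero]
  have h0 (U c) : coeffBar p U c (f - g) = 0 := by rw [map_sub, h, sub_self]
  generalize f - g = f at h0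
  obtain ⟨d, e, y, he, rfl⟩ := exists_eq_sum_tmul f
  refine Finset.sum_eq_zero fun j _ => ?_
  have : y j = 0 := CompleteGroupAlgebra.ext_coeff fun U c => by
    have h1 := h0 U c
    simp_rw [map_sum, coeffBar_tmul, mul_comm (e _), ← Algebra.smul_def] at h1
    rw [map_zero]
    exact Fintype.linearIndependent_iff.1 he _ h1 j
  rw [this, TensorProduct.tmul_zero]

lemma tendsto_iwasawaRing {ι : Type*} {l : Filter ι} {F : ι → IwasawaRing p}
    {x : IwasawaRing p} :
    Tendsto F l (𝓝 x) ↔ ∀ U c, Tendsto (fun i => coeffBar p U c (F i)) l (𝓝 (coeffBar p U c x)) := by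
  simp only [nhds_iInf, nhds_induced, tendsto_iInf, tendsto_comap_iff, Function.comp_def]

lemma continuous_coeffBar (U : OpenNormalSubgroup (Gam p)) (c : Gam p ⧸ U.toSubgroup) :
    Continuous (coeffBar p U c) :=
  continuous_iInf_dom (i := U) (continuous_iInf_dom (i := c) continuous_induced_dom)

instance : T2Space (IwasawaRing p) := by
  refine .of_injective_continuous
    (f := fun x (q : Σ U : OpenNormalSubgroup (Gam p), Gam p ⧸ U.toSubgroup) =>
      coeffBar p q.1 q.2 x) (fun _ _ h => ?_) (continuous_pi fun q => continuous_coeffBar _ _)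
  exact IwasawaRing.ext_coeffBar fun U c => congrFun h ⟨U, c⟩

/-- The pairing `q ⊗ x ↦ q ∫ h dx` of `Q̄_p ⊗ ℤ_p[[Γ]]` with a tame function `h`. -/
def pairing {h : Gam p → PadicAlgCl p} (hh : h ∈ tame p (Gam p)) :
    IwasawaRing p →ₗ[ℤ_[p]] PadicAlgCl p :=
  TensorProduct.lift ((LinearMap.mul ℤ_[p] (PadicAlgCl p)).compl₂ (tameIntegralLeft hh))

lemma pairing_tmul {h : Gam p → PadicAlgCl p} (hh : h ∈ tame p (Gam p)) (q : PadicAlgCl p)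
    (x : CompleteGroupAlgebra p (Gam p)) : pairing hh (q ⊗ₜ x) = q * tameIntegral x h := rfl

lemma pairing_mul_left {h : Gam p → PadicAlgCl p} (hh : h ∈ tame p (Gam p)) (q : PadicAlgCl p)
    (f : IwasawaRing p) : pairing hh ((q ⊗ₜ 1) * f) = q * pairing hh f := by
  induction f using TensorProduct.induction_on with
  | zero => simp
  | tmul r x =>
    rw [Algebra.TensorProduct.tmul_mul_tmul, one_mul, pairing_tmul, pairing_tmul, mul_assoc]
  | add u v hu hv => rw [mul_add, map_add, hu, hv, map_add, mul_add]

/-- The indicator function of a class `c ∈ Γ / U` with values in `Q̄_p`. -/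
def indicatorBar (U : OpenNormalSubgroup (Gam p)) (c : Gam p ⧸ U.toSubgroup) (h : Gam p) :
    PadicAlgCl p := algebraMap ℤ_[p] (PadicAlgCl p) (indicator U c h)

lemma indicatorBar_mem_tame (U : OpenNormalSubgroup (Gam p)) (c : Gam p ⧸ U.toSubgroup) :
    indicatorBar U c ∈ tame p (Gam p) :=
  coe_mem_tame _

lemma pairing_indicatorBar (U : OpenNormalSubgroup (Gam p)) (c : Gam p ⧸ U.toSubgroup) :
    pairing (indicatorBar_mem_tame U c) = coeffBar p U c := by
  refine TensorProduct.ext' fun q x => ?_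
  rw [pairing_tmul, coeffBar_tmul, ← integral_indicator]
  congr 1
  exact tameIntegral_coe x (indicator U c)

/-- Push-forward along `ψ` of the product of `f` with a tame function `g`. -/
lemma exists_pairing_eq {H : Type*} [Group H] [TopologicalSpace H] [IsTopologicalGroup H]
    [CompactSpace H] [TotallyDisconnectedSpace H] (f : CompleteGroupAlgebra p H)
    {g : H → PadicAlgCl p} (hg : g ∈ tame p H) (ψ : C(H, Gam p)) :
    ∃ W : IwasawaRing p, ∀ (h : Gam p → PadicAlgCl p) (hh : h ∈ tame p (Gam p)),
      pairing hh W = tameIntegral f (g * h ∘ ψ) := by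
  induction hg using Submodule.span_induction with
  | mem g hg =>
    obtain ⟨g, rfl⟩ := hg
    have hg := coe_mem_tame g
    set G : H → PadicAlgCl p := fun h => algebraMap ℤ_[p] (PadicAlgCl p) (g h)
    -- For `ℤ_p`-valued `g` the push-forward is a functional on `C(Γ, ℤ_p)`, so it is represented by
    -- an element of `ℤ_p[[Γ]]`. The scalars of `Q̄_p` enter only through the span, which keeps the
    -- result in the algebraic tensor product.
    let L : C(Gam p, ℤ_[p]) →ₗ[ℤ_[p]] ℤ_[p] :=
      { toFun := fun h => integral f (g * h.comp ψ)
        map_add' := fun h h' => by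
          rw [ContinuousMap.add_comp, mul_add, map_add]
        map_smul' := fun t h => by
          rw [ContinuousMap.smul_comp, mul_smul_comm, map_smul]; rfl }
    refine ⟨1 ⊗ₜ ofFunctional L, fun h hh => ?_⟩
    rw [pairing_tmul, one_mul]
    induction hh using Submodule.span_induction with
    | mem h hh =>
      obtain ⟨h, rfl⟩ := hh
      simp only
      rw [tameIntegral_coe, integral_ofFunctional]
      change algebraMap _ _ (integral f (g * h.comp ψ)) = _
      rw [← tameIntegral_coe]
      congr 1
      ext x
      simp
    | zero =>
      have : G * (0 : Gam p → PadicAlgCl p) ∘ ψ = 0 := by ext; simp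
      rw [tameIntegral_zero, this, tameIntegral_zero]
    | add u v hu hv ihu ihv =>
      have : G * (u + v) ∘ ψ = G * u ∘ ψ + G * v ∘ ψ := by ext; simp [mul_add]
      rw [tameIntegral_add _ hu hv, ihu, ihv, this, tameIntegral_add]
      · exact mul_mem_tame hg (comp_mem_tame hu ψ.continuous)
      · exact mul_mem_tame hg (comp_mem_tame hv ψ.continuous)
    | smul q u hu ihu =>
      have : G * (q • u) ∘ ψ = q • (G * u ∘ ψ) := by ext; simp [mul_left_comm]
      rw [tameIntegral_smul _ q hu, ihu, this, tameIntegral_smul]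
      exact mul_mem_tame hg (comp_mem_tame hu ψ.continuous)
  | zero => exact ⟨0, fun h hh => by rw [zero_mul, tameIntegral_zero, map_zero]⟩
  | add u v hu hv ihu ihv =>
    obtain ⟨W, hW⟩ := ihu
    obtain ⟨W', hW'⟩ := ihv
    refine ⟨W + W', fun h hh => ?_⟩
    have ht := comp_mem_tame hh ψ.continuous
    rw [map_add, hW, hW', add_mul, tameIntegral_add _ (mul_mem_tame hu ht) (mul_mem_tame hv ht)]
  | smul q u hu ihu =>
    obtain ⟨W, hW⟩ := ihu
    refine ⟨(q ⊗ₜ 1) * W, fun h hh => ?_⟩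
    rw [pairing_mul_left, hW, smul_mul_assoc,
      tameIntegral_smul _ _ (mul_mem_tame hu (comp_mem_tame hh ψ.continuous))]

end Iwasawa

/-! ## Evaluation at `γ = a` -/

section Eval

variable {p : ℕ} [Fact p.Prime] {γ : Gam p} {a : PadicAlgCl p}

/-- Otherwise `⟨γ⟩` stays in the closed ball of radius `‖γ‖ < 1`, which misses the element `1` of
`ℤ_p`. -/
lemma isUnit_of_dense (hγ : Dense (Subgroup.zpowers γ : Set (Gam p))) :
    IsUnit (Multiplicative.toAdd γ) := by
  by_contra hu
  rw [PadicInt.isUnit_iff] at hu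
  have hlt : ‖Multiplicative.toAdd γ‖ < 1 := lt_of_le_of_ne (PadicInt.norm_le_one _) hu
  have hc : IsClosed {z : Gam p | ‖Multiplicative.toAdd z‖ ≤ ‖Multiplicative.toAdd γ‖} :=
    isClosed_le (continuous_toAdd.norm) continuous_const
  have hsub : (Subgroup.zpowers γ : Set (Gam p)) ⊆
      {z : Gam p | ‖Multiplicative.toAdd z‖ ≤ ‖Multiplicative.toAdd γ‖} := by
    rintro _ ⟨k, rfl⟩
    simp only [Set.mem_ofPred_eq, toAdd_zpow, zsmul_eq_mul, norm_mul]
    exact mul_le_of_le_one_left (norm_nonneg _) (PadicInt.norm_le_one _)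
  have := closure_minimal hsub hc (hγ (Multiplicative.ofAdd 1))
  simp only [Set.mem_ofPred_eq, toAdd_ofAdd, norm_one] at this
  linarith

/-- The continuous character `γ ^ z ↦ a ^ z`. -/
lemma exists_character (hγ : Dense (Subgroup.zpowers γ : Set (Gam p))) (ha : ‖a - 1‖ < 1) :
    ∃ χ : Gam p →* PadicAlgCl p, (χ : Gam p → PadicAlgCl p) ∈ tame p (Gam p) ∧ χ γ = a := by
  obtain ⟨u, hu⟩ := isUnit_of_dense hγ
  -- The powers `a^z = (1 + r)^z` are constructed in the finite extension `ℚ_p(a)`, which is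
  -- complete. Finite dimensionality also gives tameness.
  let E := IntermediateField.adjoin ℚ_[p] {a}
  have : FiniteDimensional ℚ_[p] E := IntermediateField.adjoin.finiteDimensional
    (Algebra.IsIntegral.isIntegral a)
  have : CompleteSpace E := FiniteDimensional.complete ℚ_[p] E
  have : IsBoundedSMul ℤ_[p] E := IsBoundedSMul.of_norm_smul_le fun t e => by
    change ‖((t • e : E) : PadicAlgCl p)‖ ≤ ‖t‖ * ‖(e : PadicAlgCl p)‖
    rw [IntermediateField.coe_smul, Algebra.smul_def, norm_mul, norm_algebraMap_padicInt]
  let r : E := ⟨a, IntermediateField.mem_adjoin_simple_self _ a⟩ - 1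
  have hr : Tendsto (r ^ ·) atTop (𝓝 0) := tendsto_pow_atTop_nhds_zero_of_norm_lt_one ha
  let κ := PadicInt.addChar_of_value_at_one (p := p) r hr
  -- `κ` takes the value `a` at `1`, while the exponent of `γ` is the unit `u`; dividing by `u`
  -- moves the prescribed value to `γ`.
  refine ⟨{ toFun := fun g => (κ (Multiplicative.toAdd g * ↑u⁻¹) : PadicAlgCl p)
            map_one' := by simp
            map_mul' := fun g h => by simp [add_mul, AddChar.map_add_eq_mul] }, ?_, ?_⟩
  · refine mem_tame_of_finiteDimensional ?_ E.toSubmodule fun h => (κ _).2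
    exact continuous_subtype_val.comp ((PadicInt.continuous_addChar_of_value_at_one (p := p) hr).comp
      (continuous_toAdd.mul continuous_const))
  · change (κ (Multiplicative.toAdd γ * ↑u⁻¹) : PadicAlgCl p) = a
    rw [← hu, Units.mul_inv, PadicInt.addChar_of_value_at_one_def]
    simp [r]

/-- Integration of a tame character is a homomorphism of algebras. -/
def characterHom {H : Type*} [Group H] [TopologicalSpace H] [IsTopologicalGroup H]
    [CompactSpace H] [TotallyDisconnectedSpace H] (χ : H →* PadicAlgCl p)
    (hχ : (χ : H → PadicAlgCl p) ∈ tame p H) : CompleteGroupAlgebra p H →ₐ[ℤ_[p]] PadicAlgCl p :=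
  AlgHom.ofLinearMap (tameIntegralLeft hχ)
    ((tameIntegral_groupLike 1 hχ).trans (map_one χ))
    (fun x y => by
      have := comul_of_groupLike (p := p) {()} (T := tameIntegralLeft hχ)
        (S := fun _ => tameIntegralLeft hχ) (S' := fun _ => tameIntegralLeft hχ)
        (continuous_tameIntegral hχ) (fun _ => continuous_tameIntegral hχ)
        (fun _ => continuous_tameIntegral hχ)
        (fun g g' => by
          change tameIntegral _ _ = ∑ i ∈ _, tameIntegral _ _ * tameIntegral _ _
          rw [Finset.sum_singleton, tameIntegral_groupLike _ hχ, tameIntegral_groupLike _ hχ,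
            tameIntegral_groupLike _ hχ, map_mul]) x y
      simpa using this)

/-- Evaluation of `Q̄_p ⊗ ℤ_p[[Γ]]` at a tame character. -/
def evalHom (χ : Gam p →* PadicAlgCl p) (hχ : (χ : Gam p → PadicAlgCl p) ∈ tame p (Gam p)) :
    IwasawaRing p →ₐ[ℤ_[p]] PadicAlgCl p :=
  Algebra.TensorProduct.productMap (AlgHom.id ℤ_[p] (PadicAlgCl p)) (characterHom χ hχ)

lemma evalHom_tmul (χ : Gam p →* PadicAlgCl p) (hχ : (χ : Gam p → PadicAlgCl p) ∈ tame p (Gam p))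
    (q : PadicAlgCl p) (x : CompleteGroupAlgebra p (Gam p)) :
    evalHom χ hχ (q ⊗ₜ x) = q * tameIntegral x χ := rfl

lemma evalHom_eq_pairing (χ : Gam p →* PadicAlgCl p)
    (hχ : (χ : Gam p → PadicAlgCl p) ∈ tame p (Gam p)) (f : IwasawaRing p) :
    evalHom χ hχ f = pairing hχ f := by
  have : (evalHom χ hχ).toLinearMap = pairing hχ := TensorProduct.ext' fun q x => rfl
  exact LinearMap.congr_fun this f

lemma zpowers_coe_eq_top (hγ : Dense (Subgroup.zpowers γ : Set (Gam p)))
    (U : OpenNormalSubgroup (Gam p)) (c : Gam p ⧸ U.toSubgroup) :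
    c ∈ Subgroup.zpowers (γ : Gam p ⧸ U.toSubgroup) := by
  have : DiscreteTopology (Gam p ⧸ U.toSubgroup) := QuotientGroup.discreteTopology
    U.toOpenSubgroup.isOpen
  have ho : IsOpen {h : Gam p | (h : Gam p ⧸ U.toSubgroup) = c} :=
    (isOpen_discrete {c}).preimage QuotientGroup.continuous_mk
  obtain ⟨h, hh, k, hk⟩ := hγ.inter_open_nonempty _ ho (QuotientGroup.mk_surjective c)
  refine ⟨k, ?_⟩
  rw [← hh, ← hk]; rfl

/-- Because `γ` generates every `Γ / U`, each class has a unique representative `γ^j` with `0 ≤ j <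
[Γ : U]`. With these tags the sums in `evalAt` are Riemann sums of `χ`, and `HasIntegral` permits
any choice of tags. -/
lemma evalAt_eq_evalHom (hγ : Dense (Subgroup.zpowers γ : Set (Gam p)))
    {χ : Gam p →* PadicAlgCl p} (hχ : (χ : Gam p → PadicAlgCl p) ∈ tame p (Gam p))
    (hχγ : χ γ = a) (f : IwasawaRing p) : evalAt γ a f = evalHom χ hχ f := by
  refine Tendsto.limUnder_eq ?_
  have hord (U : OpenNormalSubgroup (Gam p)) :
      orderOf (γ : Gam p ⧸ U.toSubgroup) = U.toSubgroup.index :=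
    orderOf_eq_card_of_forall_mem_zpowers (zpowers_coe_eq_top hγ U)
  have hex (U : OpenNormalSubgroup (Gam p)) (c : Gam p ⧸ U.toSubgroup) :
      ∃ j < U.toSubgroup.index, ((γ ^ j : Gam p) : Gam p ⧸ U.toSubgroup) = c := by
    classical
    have hc := zpowers_coe_eq_top hγ U c
    rw [mem_zpowers_iff_mem_range_orderOf, Finset.mem_image] at hc
    obtain ⟨j, hj, rfl⟩ := hc
    rw [hord, Finset.mem_range] at hj
    exact ⟨j, hj, rfl⟩
  choose e he he' using hex
  have heq (U : OpenNormalSubgroup (Gam p)) {j : ℕ} (hj : j < U.toSubgroup.index) :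
      e U ((γ ^ j : Gam p) : Gam p ⧸ U.toSubgroup) = j := by
    refine pow_injOn_Iio_orderOf (x := (γ : Gam p ⧸ U.toSubgroup)) ?_ ?_ (he' U _)
    · rw [hord]; exact he U _
    · rw [hord]; exact hj
  induction f using TensorProduct.induction_on with
  | zero => simp
  | tmul q x =>
    rw [evalHom_tmul]
    have h1 := (hasIntegral_tameIntegral x hχ (fun U c => γ ^ e U c) he').const_mul q
    refine h1.congr fun U => ?_
    rw [riemannSum_eq_sum, Finset.mul_sum]
    symm
    refine Finset.sum_bij (fun j _ => ((γ ^ j : Gam p) : Gam p ⧸ U.toSubgroup)) ?_ ?_ ?_ ?_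
    · simp
    · intro j hj k hk h
      rw [← heq U (Finset.mem_range.1 hj), h, heq U (Finset.mem_range.1 hk)]
    · intro c _
      exact ⟨e U c, Finset.mem_range.2 (he U c), he' U c⟩
    · intro j hj
      rw [heq U (Finset.mem_range.1 hj), coeffBar_tmul, map_pow, hχγ, Algebra.smul_def, mul_assoc]
  | add u v hu hv =>
    simp_rw [map_add, add_mul, Finset.sum_add_distrib]
    exact hu.add hv

end Eval

/-! ## Twisted Fox Jacobians and crossed homomorphisms -/

section Rep

variable {p : ℕ} [Fact p.Prime] {n l m : ℕ}

lemma freeProP_ext {X : Type*} [TopologicalSpace X] [T2Space X] {f g : FreeProP p n → X}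
    (hf : Continuous f) (hg : Continuous g) (h : ∀ w, f (ofFree p n w) = g (ofFree p n w)) :
    f = g :=
  denseRange_ofFree.equalizer hf hg (funext h)

lemma continuous_entry (φ : FreeProP p n →ₜ* GL (Fin l) (PadicAlgCl p)) (s t : Fin l) :
    Continuous fun x => (φ x : Matrix (Fin l) (Fin l) (PadicAlgCl p)) s t :=
  (Units.continuous_val.comp φ.continuous_toFun).matrix_elem s t

/-- The matrix entries at the finitely many `g_i` and `g_i⁻¹` generate a finite extension of `ℚ_p`.
It contains all entries on the dense free group and is closed, so it contains all entries on `F_n`.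
-/
lemma entry_mem_tame (φ : FreeProP p n →ₜ* GL (Fin l) (PadicAlgCl p)) (s t : Fin l) :
    (fun x => (φ x : Matrix (Fin l) (Fin l) (PadicAlgCl p)) s t) ∈ tame p (FreeProP p n) := by
  let S : Set (PadicAlgCl p) :=
    (Set.range fun q : Fin n × Fin l × Fin l =>
      (φ (gen p q.1) : Matrix (Fin l) (Fin l) (PadicAlgCl p)) q.2.1 q.2.2) ∪
    (Set.range fun q : Fin n × Fin l × Fin l =>
      (φ (gen p q.1)⁻¹ : Matrix (Fin l) (Fin l) (PadicAlgCl p)) q.2.1 q.2.2)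
  have hS : S.Finite := (Set.finite_range _).union (Set.finite_range _)
  let E := IntermediateField.adjoin ℚ_[p] S
  have : Finite S := hS
  have : FiniteDimensional ℚ_[p] E := IntermediateField.finiteDimensional_adjoin
    fun x _ => Algebra.IsIntegral.isIntegral x
  have hcl : IsClosed (E : Set (PadicAlgCl p)) :=
    Submodule.closed_of_finiteDimensional (Subalgebra.toSubmodule E.toSubalgebra)
  have hE : ∀ (w : FreeGroup (Fin n)) s t,
      (φ (ofFree p n w) : Matrix (Fin l) (Fin l) (PadicAlgCl p)) s t ∈ E := by
    intro w
    induction w using FreeGroup.induction_on with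
    | C1 =>
      intro s t
      rw [map_one, map_one, Units.val_one, Matrix.one_apply]
      split_ifs
      exacts [one_mem E, zero_mem E]
    | of i => exact fun s t => IntermediateField.subset_adjoin _ _ (Or.inl ⟨(i, s, t), rfl⟩)
    | inv_of i _ =>
      intro s t
      rw [map_inv]
      exact IntermediateField.subset_adjoin _ _ (Or.inr ⟨(i, s, t), rfl⟩)
    | mul w v hw hv =>
      intro s t
      rw [map_mul, map_mul, Units.val_mul, Matrix.mul_apply]
      exact sum_mem fun r _ => mul_mem (hw s r) (hv r t)
  refine mem_tame_of_finiteDimensional (continuous_entry φ s t)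
    (Subalgebra.toSubmodule E.toSubalgebra) fun x => ?_
  refine (hcl.preimage (continuous_entry φ s t)).closure_subset_iff.2 ?_ (denseRange_ofFree x)
  rintro _ ⟨w, rfl⟩
  exact hE w s t

lemma coeffBar_tensorRep (φ : FreeProP p n →ₜ* GL (Fin l) (PadicAlgCl p))
    (ψ : FreeProP p n →ₜ* Gam p) (U : OpenNormalSubgroup (Gam p)) (c : Gam p ⧸ U.toSubgroup)
    (x : FreeProP p n) (s t : Fin l) : coeffBar p U c (tensorRep φ ψ x s t) =
      (φ x : Matrix (Fin l) (Fin l) (PadicAlgCl p)) s t * indicatorBar U c (ψ x) := by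
  rw [tensorRep, Matrix.map_apply, coeffBar_tmul, ← integral_indicator, integral_groupLike]
  rfl

/-- On `ℤ_p[F_n]` the coefficients of the finite sums are tame integrals, and tame integrals are
continuous in `f`. Any matrix over `R` with the limiting coefficients is therefore the limit. -/
lemma tendsto_tensorRepAlg (φ : FreeProP p n →ₜ* GL (Fin l) (PadicAlgCl p))
    (ψ : FreeProP p n →ₜ* Gam p) (f : CompleteGroupAlgebra p (FreeProP p n))
    (W : Matrix (Fin l) (Fin l) (IwasawaRing p))
    (hW : ∀ s t U c, coeffBar p U c (W s t) = tameIntegral f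
      ((fun x => (φ x : Matrix (Fin l) (Fin l) (PadicAlgCl p)) s t) * indicatorBar U c ∘ ψ)) :
    tensorRepAlg φ ψ f = W := by
  have : (comap (ofGroupAlgebra p (H := FreeProP p n)) (𝓝 f)).NeBot :=
    comap_neBot fun t ht =>
      let ⟨_, hy, w, hw⟩ := mem_closure_iff_nhds.1 (denseRange_ofGroupAlgebra f) t ht
      ⟨w, hw ▸ hy⟩
  refine Tendsto.limUnder_eq (tendsto_pi_nhds.2 fun s => tendsto_pi_nhds.2 fun t =>
    tendsto_iwasawaRing.2 fun U c => ?_)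
  have ht := mul_mem_tame (entry_mem_tame φ s t)
    (comp_mem_tame (indicatorBar_mem_tame U c) ψ.continuous_toFun)
  rw [hW]
  refine (((continuous_tameIntegral ht).tendsto f).comp tendsto_comap).congr fun h => ?_
  rw [Function.comp_apply, tameIntegral_ofGroupAlgebra _ ht, Finsupp.sum, Finsupp.sum,
    Matrix.sum_apply, map_sum]
  refine Finset.sum_congr rfl fun x _ => ?_
  rw [Matrix.smul_apply, map_smul, coeffBar_tensorRep]
  rfl

/-- `exists_pairing_eq` supplies a candidate limit in `R`, and testing it on indicator functions
verifies its coefficients. -/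
lemma pairing_tensorRepAlg (φ : FreeProP p n →ₜ* GL (Fin l) (PadicAlgCl p))
    (ψ : FreeProP p n →ₜ* Gam p) (f : CompleteGroupAlgebra p (FreeProP p n))
    {h : Gam p → PadicAlgCl p} (hh : h ∈ tame p (Gam p)) (s t : Fin l) :
    pairing hh (tensorRepAlg φ ψ f s t) = tameIntegral f
      ((fun x => (φ x : Matrix (Fin l) (Fin l) (PadicAlgCl p)) s t) * h ∘ ψ) := by
  choose W hW using fun s t : Fin l =>
    exists_pairing_eq f (entry_mem_tame φ s t) ⟨ψ, ψ.continuous_toFun⟩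
  rw [tendsto_tensorRepAlg φ ψ f (Matrix.of W) fun s t U c => ?_]
  · exact hW s t h hh
  · rw [← pairing_indicatorBar]
    exact hW s t _ _

/-- The specialization `x ↦ χ(ψ(x)) φ(x)` of the tensor product representation. -/
def repAt (φ : FreeProP p n →ₜ* GL (Fin l) (PadicAlgCl p)) (ψ : FreeProP p n →ₜ* Gam p)
    (χ : Gam p →* PadicAlgCl p) : FreeProP p n →* Matrix (Fin l) (Fin l) (PadicAlgCl p) where
  toFun x := χ (ψ x) • (φ x : Matrix (Fin l) (Fin l) (PadicAlgCl p))
  map_one' := by simp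
  map_mul' x y := by
    simp only [map_mul, Units.val_mul, smul_mul_smul_comm]

variable (φ : FreeProP p n →ₜ* GL (Fin l) (PadicAlgCl p)) (ψ : FreeProP p n →ₜ* Gam p)
  {χ : Gam p →* PadicAlgCl p} (hχ : (χ : Gam p → PadicAlgCl p) ∈ tame p (Gam p))
  {γ : Gam p} {a : PadicAlgCl p} (hγ : Dense (Subgroup.zpowers γ : Set (Gam p))) (hχγ : χ γ = a)

include hχ in
lemma repAt_entry_mem_tame (s t : Fin l) :
    (fun x => repAt φ ψ χ x s t) ∈ tame p (FreeProP p n) := by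
  convert mul_mem_tame (comp_mem_tame hχ ψ.continuous_toFun) (entry_mem_tame φ s t)
  rfl

include hχ in
lemma continuous_repAt : Continuous (repAt φ ψ χ) :=
  continuous_matrix fun s t => continuous_of_mem_tame (repAt_entry_mem_tame φ ψ hχ s t)

include hχ hγ hχγ

lemma map_evalAt_tensorRep (x : FreeProP p n) :
    (tensorRep φ ψ x).map (evalAt γ a) = repAt φ ψ χ x := by
  ext s t
  rw [Matrix.map_apply, evalAt_eq_evalHom hγ hχ hχγ, tensorRep, Matrix.map_apply, evalHom_tmul,
    tameIntegral_groupLike _ hχ, mul_comm]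
  rfl

lemma evalAt_tensorRepAlg (f : CompleteGroupAlgebra p (FreeProP p n)) (s t : Fin l) :
    evalAt γ a (tensorRepAlg φ ψ f s t) = tameIntegral f fun x => repAt φ ψ χ x s t := by
  rw [evalAt_eq_evalHom hγ hχ hχγ, evalHom_eq_pairing, pairing_tensorRepAlg, mul_comm]
  rfl

omit hχ hγ hχγ

variable (χ) in
/-- The crossed homomorphism with prescribed values on the generators, given by the fundamental
formula of Fox calculus. -/
def crossedOf (b : Fin n × Fin l → PadicAlgCl p) (x : FreeProP p n) (s : Fin l) : PadicAlgCl p :=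
  ∑ t : Fin n × Fin l, tameIntegral (fox p t.1 x) (fun y => repAt φ ψ χ y s t.2) * b t

include hχ hγ hχγ in
-- This turns the linear system `Q|_{γ=a} b = 0` into the vanishing of a crossed homomorphism at the
-- relators.
lemma mulVec_foxJacobian (r : Fin m → FreeProP p n) (b : Fin n × Fin l → PadicAlgCl p) :
    ((foxJacobian r φ ψ).map (evalAt γ a)).mulVec b = fun s => crossedOf φ ψ χ b (r s.1) s.2 := by
  ext s
  rw [Matrix.mulVec, dotProduct]
  refine Finset.sum_congr rfl fun t _ => ?_
  rw [Matrix.map_apply, foxJacobian, Matrix.of_apply, foxJacobianBlock,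
    evalAt_tensorRepAlg φ ψ hχ hγ hχγ]

include hχ in
lemma continuous_crossedOf (b : Fin n × Fin l → PadicAlgCl p) :
    Continuous (crossedOf φ ψ χ b) :=
  continuous_pi fun s => continuous_finsetSum _ fun t _ =>
    ((continuous_tameIntegral (repAt_entry_mem_tame φ ψ hχ s t.2)).comp
      (continuous_fox t.1)).mul continuous_const

include hχ in
lemma tameIntegral_groupLike_mul (x : FreeProP p n) (y : CompleteGroupAlgebra p (FreeProP p n))
    (s t : Fin l) : tameIntegral (groupLike p x * y) (fun z => repAt φ ψ χ z s t) =
      ∑ r, repAt φ ψ χ x s r * tameIntegral y (fun z => repAt φ ψ χ z r t) := by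
  have hm := repAt_entry_mem_tame φ ψ hχ
  have := comul_of_groupLike (p := p) Finset.univ (T := tameIntegralLeft (hm s t))
    (S := fun r => tameIntegralLeft (hm s r)) (S' := fun r => tameIntegralLeft (hm r t))
    (continuous_tameIntegral (hm s t)) (fun r => continuous_tameIntegral (hm s r))
    (fun r => continuous_tameIntegral (hm r t)) (fun g g' => by
      change tameIntegral _ _ = ∑ i, tameIntegral _ _ * tameIntegral _ _
      simp_rw [tameIntegral_groupLike _ (hm _ _)]
      rw [map_mul, Matrix.mul_apply]) (groupLike p x) y
  refine this.trans (Finset.sum_congr rfl fun r _ => ?_)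
  congr 1
  exact tameIntegral_groupLike x (hm s r)

include hχ in
-- Both sides are continuous in the pair `(x, y)`, so the identity only has to be checked on the
-- discrete free group, where it is the product rule for Fox derivatives.
lemma crossedOf_mul (b : Fin n × Fin l → PadicAlgCl p) (x y : FreeProP p n) :
    crossedOf φ ψ χ b (x * y) =
      crossedOf φ ψ χ b x + (repAt φ ψ χ x).mulVec (crossedOf φ ψ χ b y) := by
  have hc := continuous_crossedOf φ ψ hχ b
  refine congrFun ((denseRange_ofFree.prodMap denseRange_ofFree).equalizer
    (g := fun q : FreeProP p n × FreeProP p n => crossedOf φ ψ χ b (q.1 * q.2))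
    (h := fun q => crossedOf φ ψ χ b q.1 + (repAt φ ψ χ q.1).mulVec (crossedOf φ ψ χ b q.2))
    (hc.comp continuous_mul) ((hc.comp continuous_fst).add
      (((continuous_repAt φ ψ hχ).comp continuous_fst).matrix_mulVec (hc.comp continuous_snd)))
    (funext fun ⟨w, v⟩ => ?_)) (x, y)
  ext s
  simp only [Function.comp_apply, Prod.map_apply, Pi.add_apply, crossedOf, Matrix.mulVec,
    dotProduct, Finset.mul_sum]
  rw [Finset.sum_comm, ← Finset.sum_add_distrib]
  refine Finset.sum_congr rfl fun t _ => ?_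
  rw [← map_mul, fox_ofFree, fox_ofFree, fox_ofFree, foxImage_mul]
  have hm := repAt_entry_mem_tame φ ψ hχ
  have h1 := (tameIntegralLeft (hm s t.2)).map_add (foxImage p t.1 w)
    (groupLike p (ofFree p n w) * foxImage p t.1 v)
  refine (congrArg (· * b t) h1).trans ?_
  rw [add_mul]
  congr 1
  refine (congrArg (· * b t) (tameIntegral_groupLike_mul φ ψ hχ _ _ s t.2)).trans ?_
  simp only [Finset.sum_mul, mul_assoc]

include hχ in
lemma crossedOf_gen (b : Fin n × Fin l → PadicAlgCl p) (j : Fin n) (s : Fin l) :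
    crossedOf φ ψ χ b (gen p j) s = b (j, s) := by
  have hm := repAt_entry_mem_tame φ ψ hχ
  have h (t : Fin n × Fin l) : tameIntegral (fox p t.1 (gen p j))
      (fun y => repAt φ ψ χ y s t.2) = if t = (j, s) then 1 else 0 := by
    rw [gen, fox_ofFree, foxImage_of]
    by_cases ht : j = t.1
    · rw [if_pos ht, ← map_one (groupLike p), tameIntegral_groupLike _ (hm _ _), map_one,
        Matrix.one_apply]
      exact if_congr ⟨fun h => Prod.ext ht.symm h.symm, fun h => by rw [h]⟩ rfl rfl
    · rw [if_neg ht, if_neg fun h => ht (by rw [h])]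
      exact (tameIntegralLeft (hm s t.2)).map_zero
  simp [crossedOf, h]

include hχ hγ hχγ

lemma isCrossedHom_iff (β : FreeProP p n → Fin l → PadicAlgCl p) :
    IsCrossedHom φ ψ γ a β ↔
      Continuous β ∧ ∀ x y, β (x * y) = β x + (repAt φ ψ χ x).mulVec (β y) := by
  simp_rw [IsCrossedHom, map_evalAt_tensorRep φ ψ hχ hγ hχγ]

lemma isCrossedHom_crossedOf (b : Fin n × Fin l → PadicAlgCl p) :
    IsCrossedHom φ ψ γ a (crossedOf φ ψ χ b) :=
  (isCrossedHom_iff φ ψ hχ hγ hχγ _).2 ⟨continuous_crossedOf φ ψ hχ b, crossedOf_mul φ ψ hχ b⟩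

/-- The cocycle identity determines the values on products and inverses, hence on the free group;
density and continuity do the rest. -/
lemma IsCrossedHom.ext {β β' : FreeProP p n → Fin l → PadicAlgCl p}
    (hβ : IsCrossedHom φ ψ γ a β) (hβ' : IsCrossedHom φ ψ γ a β')
    (h : ∀ i, β (gen p i) = β' (gen p i)) : β = β' := by
  obtain ⟨hc, hm⟩ := (isCrossedHom_iff φ ψ hχ hγ hχγ _).1 hβ
  obtain ⟨hc', hm'⟩ := (isCrossedHom_iff φ ψ hχ hγ hχγ _).1 hβ'
  have h1 {β : FreeProP p n → Fin l → PadicAlgCl p}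
      (hm : ∀ x y, β (x * y) = β x + (repAt φ ψ χ x).mulVec (β y)) : β 1 = 0 := by
    simpa using hm 1 1
  refine freeProP_ext hc hc' fun w => ?_
  induction w using FreeGroup.induction_on with
  | C1 => rw [map_one, h1 hm, h1 hm']
  | of i => exact h i
  | inv_of i _ =>
    have key {β : FreeProP p n → Fin l → PadicAlgCl p}
        (hm : ∀ x y, β (x * y) = β x + (repAt φ ψ χ x).mulVec (β y)) (x : FreeProP p n) :
        β x⁻¹ = -(repAt φ ψ χ x⁻¹).mulVec (β x) := by
      rw [eq_neg_iff_add_eq_zero, ← hm, inv_mul_cancel, h1 hm]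
    rw [map_inv, key hm, key hm']
    change -(repAt φ ψ χ _).mulVec (β (gen p i)) = -(repAt φ ψ χ _).mulVec (β' (gen p i))
    rw [h]
  | mul w v hw hv => rw [map_mul, hm, hm', hw, hv]

lemma IsCrossedHom.eq_crossedOf {β : FreeProP p n → Fin l → PadicAlgCl p}
    (hβ : IsCrossedHom φ ψ γ a β) : β = crossedOf φ ψ χ fun t => β (gen p t.1) t.2 :=
  hβ.ext φ ψ hχ hγ hχγ (isCrossedHom_crossedOf φ ψ hχ hγ hχγ _) fun i => funext fun s => by
    rw [crossedOf_gen φ ψ hχ]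

end Rep

/-! ## Extensions of representations -/

section Factor

variable {p : ℕ} [Fact p.Prime] {n m : ℕ} {G : Type*} [Group G] [TopologicalSpace G]

omit [Fact p.Prime] in
lemma ProPPresentation.proj_rel (P : ProPPresentation p n m G) (j : Fin m) :
    P.proj (P.rel j) = 1 := by
  have : P.rel j ∈ {x : FreeProP p n | P.proj x = 1} := by
    rw [P.ker_proj]
    exact subset_closure (Subgroup.subset_normalClosure ⟨j, rfl⟩)
  exact this

/-- The set where `φ'` is trivial is a closed normal subgroup, so it contains `ker π` once it
contains the relators. Continuity of the induced map holds because `π`, from a compact to a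
Hausdorff space, is a quotient map. -/
lemma factorsThrough_iff [T2Space G] (P : ProPPresentation p n m G) {M : Type*} [Group M]
    [TopologicalSpace M] [T2Space M] (φ' : FreeProP p n →ₜ* M) :
    FactorsThrough φ' P.proj ↔ ∀ j, φ' (P.rel j) = 1 := by
  constructor
  · rintro ⟨ρ, rfl⟩ j
    change ρ (P.proj (P.rel j)) = 1
    rw [P.proj_rel, map_one]
  · intro h
    have hker : ∀ x, P.proj x = 1 → φ' x = 1 := by
      intro x hx
      have hx' : x ∈ {x : FreeProP p n | P.proj x = 1} := hx
      rw [P.ker_proj] at hx'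
      have hcl : IsClosed {x : FreeProP p n | φ' x = 1} :=
        isClosed_eq φ'.continuous_toFun continuous_const
      refine closure_minimal (?_ : _ ⊆ {x : FreeProP p n | φ' x = 1}) hcl hx'
      have : Subgroup.normalClosure (Set.range P.rel) ≤ φ'.toMonoidHom.ker :=
        Subgroup.normalClosure_le_normal (by rintro _ ⟨j, rfl⟩; exact h j)
      exact this
    have hle : P.proj.toMonoidHom.ker ≤ φ'.toMonoidHom.ker := fun x hx => hker x hx
    let ρ := P.proj.toMonoidHom.liftOfSurjective P.surjective_proj ⟨φ'.toMonoidHom, hle⟩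
    have hρ : ∀ x, ρ (P.proj x) = φ' x := fun x =>
      MonoidHom.liftOfRightInverse_comp_apply _ _ _ _ x
    have hq : IsQuotientMap P.proj :=
      (P.proj.continuous_toFun.isClosedMap).isQuotientMap P.proj.continuous_toFun P.surjective_proj
    refine ⟨⟨ρ, hq.continuous_iff.2 ?_⟩, ContinuousMonoidHom.ext hρ⟩
    exact φ'.continuous_toFun.congr fun x => (hρ x).symm

end Factor

section Affine

variable {K : Type*} [Field K] {l : ℕ}

lemma affineMatrix_mul (A A' : Matrix (Fin l) (Fin l) K) (b b' : Fin l → K) :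
    affineMatrix A b * affineMatrix A' b' = affineMatrix (A * A') (b + A.mulVec b') := by
  rw [affineMatrix, affineMatrix, Matrix.fromBlocks_multiply, affineMatrix]
  congr 1
  · simp
  · ext i j
    simp [Matrix.mul_apply, Matrix.mulVec, dotProduct, add_comm]
  · simp
  · simp

lemma affineMatrix_one_zero : affineMatrix (1 : Matrix (Fin l) (Fin l) K) 0 = 1 := by
  rw [affineMatrix]
  convert Matrix.fromBlocks_one using 1
  congr 1

lemma affineMatrix_eq_one_iff {A : Matrix (Fin l) (Fin l) K} {b : Fin l → K} :
    affineMatrix A b = 1 ↔ A = 1 ∧ b = 0 := by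
  constructor
  · intro h
    rw [affineMatrix, ← Matrix.fromBlocks_one, Matrix.fromBlocks_inj] at h
    exact ⟨h.1, funext fun i => congrFun (congrFun h.2.1 i) ()⟩
  · rintro ⟨rfl, rfl⟩
    exact affineMatrix_one_zero

end Affine

section Extension

variable {p : ℕ} [Fact p.Prime] {n l m : ℕ}
variable (φ : FreeProP p n →ₜ* GL (Fin l) (PadicAlgCl p)) (ψ : FreeProP p n →ₜ* Gam p)
  {χ : Gam p →* PadicAlgCl p} (hχ : (χ : Gam p → PadicAlgCl p) ∈ tame p (Gam p))
  {γ : Gam p} {a : PadicAlgCl p} (hγ : Dense (Subgroup.zpowers γ : Set (Gam p))) (hχγ : χ γ = a)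

lemma continuousMonoidHom_ext_gen {M : Type*} [Group M] [TopologicalSpace M] [T2Space M]
    {f g : FreeProP p n →ₜ* M} (h : ∀ i, f (gen p i) = g (gen p i)) : f = g := by
  have h1 : f.toMonoidHom.comp (ofFree p n) = g.toMonoidHom.comp (ofFree p n) :=
    FreeGroup.ext_hom _ _ h
  exact ContinuousMonoidHom.ext (congrFun
    (freeProP_ext f.continuous_toFun g.continuous_toFun fun w => DFunLike.congr_fun h1 w))

lemma IsExtensionHom.unique {β : FreeProP p n → Fin l → PadicAlgCl p}
    {φ' φ'' : FreeProP p n →ₜ* GL (Fin l ⊕ Unit) (PadicAlgCl p)}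
    (h : IsExtensionHom φ ψ γ a β φ') (h' : IsExtensionHom φ ψ γ a β φ'') : φ' = φ'' :=
  continuousMonoidHom_ext_gen fun i => Units.ext ((h i).trans (h' i).symm)

include hχ hγ hχγ

/-- The cocycle identity is exactly multiplicativity of the block matrices. The formula at every
`x`, not only at generators, is what allows evaluation at the relators. -/
lemma exists_isExtensionHom {β : FreeProP p n → Fin l → PadicAlgCl p}
    (hβ : IsCrossedHom φ ψ γ a β) :
    ∃ φ' : FreeProP p n →ₜ* GL (Fin l ⊕ Unit) (PadicAlgCl p), IsExtensionHom φ ψ γ a β φ' ∧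
      ∀ x, (φ' x : Matrix (Fin l ⊕ Unit) (Fin l ⊕ Unit) (PadicAlgCl p)) =
        affineMatrix (repAt φ ψ χ x) (β x) := by
  obtain ⟨hc, hm⟩ := (isCrossedHom_iff φ ψ hχ hγ hχγ _).1 hβ
  have h1 : β 1 = 0 := by simpa using hm 1 1
  let T : FreeProP p n →* Matrix (Fin l ⊕ Unit) (Fin l ⊕ Unit) (PadicAlgCl p) :=
    { toFun := fun x => affineMatrix (repAt φ ψ χ x) (β x)
      map_one' := by rw [map_one, h1, affineMatrix_one_zero]
      map_mul' := fun x y => by rw [affineMatrix_mul, map_mul, hm] }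
  have hT : Continuous T := by
    refine (continuous_repAt φ ψ hχ).matrix_fromBlocks ?_ continuous_const continuous_const
    exact continuous_matrix fun i _ => (continuous_apply i).comp hc
  refine ⟨⟨T.toHomUnits, Units.continuous_iff.2 ⟨hT, ?_⟩⟩, fun i => ?_, fun x => rfl⟩
  · exact hT.comp continuous_inv
  · rw [map_evalAt_tensorRep φ ψ hχ hγ hχγ]
    rfl

/-- At a relator the diagonal block is the identity, because `φ` and `ψ` are trivial there, so the
extension is trivial exactly when `β` vanishes. -/
lemma factorsThrough_extension_iff {G : Type*} [Group G] [TopologicalSpace G] [T2Space G]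
    (P : ProPPresentation p n m G) (hφ : ∀ j, φ (P.rel j) = 1) (hψ : ∀ j, ψ (P.rel j) = 1)
    {β : FreeProP p n → Fin l → PadicAlgCl p} (hβ : IsCrossedHom φ ψ γ a β)
    {φ' : FreeProP p n →ₜ* GL (Fin l ⊕ Unit) (PadicAlgCl p)} (h : IsExtensionHom φ ψ γ a β φ') :
    FactorsThrough φ' P.proj ↔
      ((foxJacobian P.rel φ ψ).map (evalAt γ a)).mulVec (fun t => β (gen p t.1) t.2) = 0 := by
  obtain ⟨φ'', h'', hx⟩ := exists_isExtensionHom φ ψ hχ hγ hχγ hβ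
  obtain rfl := h.unique φ ψ h''
  rw [factorsThrough_iff, mulVec_foxJacobian φ ψ hχ hγ hχγ, ← hβ.eq_crossedOf φ ψ hχ hγ hχγ]
  have hr (j) : repAt φ ψ χ (P.rel j) = 1 := by
    change χ (ψ _) • (φ _ : Matrix (Fin l) (Fin l) (PadicAlgCl p)) = 1
    rw [hφ, hψ, map_one, one_smul, Units.val_one]
  simp_rw [Units.ext_iff, hx, Units.val_one, affineMatrix_eq_one_iff, hr, true_and]
  exact ⟨fun h => funext fun s => congrFun (h s.1) s.2,
    fun h j => funext fun s => congrFun h (j, s)⟩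

end Extension

/-! ## Linear algebra -/

section Minors

variable {K : Type*} [Field K]

lemma exists_linearIndependent_rows {rows cols : Type*} [Finite rows] [Fintype cols]
    (A : Matrix rows cols K) {N : ℕ} (hN : N ≤ A.rank) :
    ∃ s : Fin N ↪ rows, LinearIndependent K fun i => A (s i) := by
  obtain ⟨κ, e, he, hspan, hli⟩ := exists_linearIndependent' K A.row
  have := Finite.of_injective e he
  have := Fintype.ofFinite κ
  rw [A.rank_eq_finrank_span_row, ← hspan, finrank_span_eq_card hli] at hN
  obtain ⟨g⟩ : Nonempty (Fin N ↪ κ) := Function.Embedding.nonempty_of_card_le (by simpa using hN)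
  exact ⟨g.trans ⟨e, he⟩, hli.comp g g.injective⟩

/-- The rank of a matrix is at least `N` if and only if some minor of size `N` is non-zero. -/
lemma le_rank_iff_exists_minor {rows cols : Type*} [Finite rows] [Fintype cols]
    (A : Matrix rows cols K) (N : ℕ) :
    N ≤ A.rank ↔ ∃ (s : Fin N ↪ rows) (t : Fin N ↪ cols), (A.submatrix s t).det ≠ 0 := by
  have := Fintype.ofFinite rows
  constructor
  · intro hN
    obtain ⟨s, hs⟩ := exists_linearIndependent_rows A hN
    have h1 : (A.submatrix s id).rank = N := by
      have : LinearIndependent K (A.submatrix s id).row := hs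
      simpa using this.rank_matrix
    rw [← Matrix.rank_transpose] at h1
    obtain ⟨t, ht⟩ := exists_linearIndependent_rows _ h1.ge
    refine ⟨s, t, ?_⟩
    have h2 : LinearIndependent K ((A.submatrix s t).transpose).row := ht
    rw [Matrix.linearIndependent_rows_iff_isUnit, Matrix.isUnit_transpose,
      Matrix.isUnit_iff_isUnit_det] at h2
    exact h2.ne_zero
  · rintro ⟨s, t, h⟩
    have h1 : LinearIndependent K (A.submatrix s t).row := by
      rw [Matrix.linearIndependent_rows_iff_isUnit, Matrix.isUnit_iff_isUnit_det]
      exact isUnit_iff_ne_zero.2 h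
    have h2 : LinearIndependent K fun i => A (s i) :=
      LinearIndependent.of_comp (LinearMap.funLeft K K t) h1
    rw [A.rank_eq_finrank_span_row]
    have h3 := finrank_span_eq_card h2
    rw [Fintype.card_fin] at h3
    rw [← h3]
    exact Submodule.finrank_mono (Submodule.span_mono (by rintro _ ⟨i, rfl⟩; exact ⟨s i, rfl⟩))

/-- Rank-nullity: nullity above `l` means rank below `card cols - l`. The bound `hl` keeps the
natural number subtraction from truncating. -/
lemma le_finrank_ker_iff {rows cols : Type*} [Finite rows] [Fintype cols]
    (A : Matrix rows cols K) {l : ℕ} (hl : l ≤ Fintype.card cols) :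
    l + 1 ≤ Module.finrank K (LinearMap.ker A.mulVecLin) ↔
      ∀ (s : Fin (Fintype.card cols - l) ↪ rows) (t : Fin (Fintype.card cols - l) ↪ cols),
        (A.submatrix s t).det = 0 := by
  have h1 := LinearMap.finrank_range_add_finrank_ker A.mulVecLin
  rw [Module.finrank_fintype_fun_eq_card] at h1
  have h2 := le_rank_iff_exists_minor A (Fintype.card cols - l)
  have h3 : (∀ (s : Fin (Fintype.card cols - l) ↪ rows) (t : Fin (Fintype.card cols - l) ↪ cols),
        (A.submatrix s t).det = 0) ↔ ¬ (Fintype.card cols - l ≤ A.rank) := by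
    rw [h2]; push Not; rfl
  rw [h3, Matrix.rank]
  omega

end Minors

/-! ## The Mahler transform `ℤ_p[[Γ]] ≃ ℤ_p⟦X⟧` -/

section Mahler

open scoped PowerSeries

variable {p : ℕ} [Fact p.Prime]

/-- Automatic continuity is what allows a functional to be applied termwise to a Mahler series. -/
lemma continuous_functional {X : Type*} [TopologicalSpace X] [CompactSpace X]
    (L : C(X, ℤ_[p]) →ₗ[ℤ_[p]] ℤ_[p]) : Continuous L := by
  refine continuous_of_continuousAt_zero L (Metric.tendsto_nhds.2 fun ε hε => ?_)
  have hp1 : (1 : ℝ) < p := by exact_mod_cast (Fact.out : p.Prime).one_lt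
  obtain ⟨k, hk⟩ := exists_pow_lt_of_lt_one hε (inv_lt_one_of_one_lt₀ hp1)
  rw [inv_pow, ← zpow_natCast, ← zpow_neg] at hk
  have hpos : (0 : ℝ) < (p : ℝ) ^ (-(k : ℤ)) := by positivity
  filter_upwards [Metric.ball_mem_nhds (0 : C(X, ℤ_[p])) hpos] with g hg
  rw [map_zero, dist_zero_right]
  rw [mem_ball_zero_iff] at hg
  exact (norm_functional_le L g k fun h => (g.norm_coe_le_norm h).trans hg.le).trans_lt hk

variable (u : ℤ_[p]ˣ)

/-- The homeomorphism `z ↦ u z` from `ℤ_p` to `Γ`. -/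
def scale : C(ℤ_[p], Gam p) :=
  ⟨fun z => Multiplicative.ofAdd (z * u), continuous_ofAdd.comp (continuous_id.mul continuous_const)⟩

/-- The inverse of `z ↦ u z`. -/
def unscale : C(Gam p, ℤ_[p]) where
  toFun g := Multiplicative.toAdd g * ((u⁻¹ : ℤ_[p]ˣ) : ℤ_[p])
  continuous_toFun := Continuous.mul continuous_toAdd continuous_const

lemma scale_unscale (g : Gam p) : scale u (unscale u g) = g := by
  simp [scale, unscale, mul_assoc]

lemma unscale_scale (z : ℤ_[p]) : unscale u (scale u z) = z := by
  simp [scale, unscale, mul_assoc]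

/-- The functions `u z ↦ binom(z, k)` on `Γ`. -/
def mahlerFun (k : ℕ) : C(Gam p, ℤ_[p]) := (mahler k).comp (unscale u)

lemma mahlerFun_apply (k : ℕ) (g : Gam p) : mahlerFun u k g = Ring.choose (unscale u g) k := rfl

/-- On group elements this is Vandermonde's identity for binomial coefficients; `comul_of_groupLike`
extends it to the whole algebra. -/
lemma integral_mul_mahlerFun (k : ℕ) (x y : CompleteGroupAlgebra p (Gam p)) :
    integral (x * y) (mahlerFun u k) = ∑ i ∈ Finset.HasAntidiagonal.antidiagonal k,
      integral x (mahlerFun u i.1) * integral y (mahlerFun u i.2) := by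
  refine comul_of_groupLike (p := p) (H := Gam p) (Finset.HasAntidiagonal.antidiagonal k)
    (T := integralLeft (mahlerFun u k)) (continuous_integralLeft _)
    (S := fun i => integralLeft (mahlerFun u i.1)) (S' := fun i => integralLeft (mahlerFun u i.2))
    (fun i => continuous_integralLeft _) (fun i => continuous_integralLeft _)
    (fun g g' => ?_) x y
  change integral _ _ = ∑ i ∈ _, integral _ _ * integral _ _
  simp_rw [integral_groupLike, mahlerFun_apply]
  have : unscale u (g * g') = unscale u g + unscale u g' := by simp [unscale, add_mul]
  rw [this, Ring.add_choose_eq k (Commute.all _ _)]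

/-- The Mahler transform `x ↦ ∑_k (∫ binom(z, k) dx(z)) X^k`. -/
def mahlerTransform : CompleteGroupAlgebra p (Gam p) →ₐ[ℤ_[p]] ℤ_[p]⟦X⟧ :=
  AlgHom.ofLinearMap
    { toFun := fun x => PowerSeries.mk fun k => integral x (mahlerFun u k)
      map_add' := fun x y => by
        ext k; simp [integral_add_left]
      map_smul' := fun t x => by
        ext k; simp [integral_smul_left] }
    (by
      ext k
      change PowerSeries.coeff k (PowerSeries.mk fun k =>
        integral (1 : CompleteGroupAlgebra p (Gam p)) (mahlerFun u k)) = PowerSeries.coeff k 1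
      rw [PowerSeries.coeff_mk, ← map_one (groupLike p), integral_groupLike, mahlerFun_apply,
        PowerSeries.coeff_one]
      simp [unscale, Ring.choose_zero_ite])
    (fun x y => by
      ext k
      change PowerSeries.coeff k (PowerSeries.mk fun k => integral (x * y) (mahlerFun u k)) =
        PowerSeries.coeff k (PowerSeries.mk (fun k => integral x (mahlerFun u k)) *
          PowerSeries.mk (fun k => integral y (mahlerFun u k)))
      rw [PowerSeries.coeff_mul, PowerSeries.coeff_mk]
      simp_rw [PowerSeries.coeff_mk]
      exact integral_mul_mahlerFun u k x y)

lemma coeff_mahlerTransform (k : ℕ) (x : CompleteGroupAlgebra p (Gam p)) :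
    PowerSeries.coeff k (mahlerTransform u x) = integral x (mahlerFun u k) := by
  rw [mahlerTransform, AlgHom.ofLinearMap_apply]
  exact PowerSeries.coeff_mk k fun k => integral x (mahlerFun u k)

lemma mahlerTransform_groupLike (γ : Gam p) (hu : Multiplicative.toAdd γ = u) :
    mahlerTransform u (groupLike p γ) = 1 + PowerSeries.X := by
  ext k
  have : unscale u γ = ((1 : ℕ) : ℤ_[p]) := by simp [unscale, hu]
  rw [coeff_mahlerTransform, integral_groupLike, mahlerFun_apply, this, Ring.choose_natCast,
    map_add, PowerSeries.coeff_one, PowerSeries.coeff_X]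
  rcases k with _ | _ | k
  · simp
  · simp
  · simp [Nat.choose_eq_zero_of_lt (show 1 < k + 1 + 1 by omega)]

/-- By Mahler's theorem every continuous function is a convergent series in binomial functions, so a
functional that kills these is zero. -/
lemma mahlerTransform_injective : Function.Injective (mahlerTransform u) := by
  rw [injective_iff_map_eq_zero]
  intro x hx
  refine ext_integral fun g => ?_
  let L : C(ℤ_[p], ℤ_[p]) →ₗ[ℤ_[p]] ℤ_[p] :=
    { toFun := fun f => integral x (f.comp (unscale u))
      map_add' := fun f f' => by rw [ContinuousMap.add_comp, map_add]
      map_smul' := fun t f => by rw [ContinuousMap.smul_comp, map_smul]; rfl }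
  have hL (k : ℕ) : L (mahler k) = 0 := by
    rw [← map_zero (PowerSeries.coeff (R := ℤ_[p]) k), ← hx, coeff_mahlerTransform]; rfl
  have hg : g = (g.comp (scale u)).comp (unscale u) := by
    ext z; simp [scale_unscale]
  have h1 := (PadicInt.hasSum_mahler (g.comp (scale u))).map L (continuous_functional L)
  have h2 : L ∘ (fun n => PadicInt.mahlerTerm ((fwdDiff 1)^[n] (g.comp (scale u)) 0) n) = 0 := by
    funext k
    have : PadicInt.mahlerTerm ((fwdDiff 1)^[k] (g.comp (scale u)) 0) k =
        ((fwdDiff 1)^[k] (g.comp (scale u)) 0) • (mahler k : C(ℤ_[p], ℤ_[p])) := by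
      ext z; simp [PadicInt.mahlerTerm_apply, mul_comm]
    rw [Function.comp_apply, this, map_smul, hL, smul_zero]; rfl
  rw [h2] at h1
  have h3 : L (g.comp (scale u)) = 0 := h1.unique hasSum_zero
  rw [hg]
  refine Eq.trans h3 ?_
  exact ((integralLeft _).map_zero).symm

/-- The Mahler coefficients of a continuous function tend to zero, so pairing them with the integral
coefficients of `F` converges and defines a functional. Its value at the `k`-th binomial function is
the `k`-th coefficient of `F`. -/
lemma mahlerTransform_surjective : Function.Surjective (mahlerTransform u) := by
  intro F
  have hsum (f : C(ℤ_[p], ℤ_[p])) :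
      Summable fun k => PowerSeries.coeff k F * PadicInt.mahlerEquiv ℤ_[p] f k := by
    refine NonarchimedeanAddGroup.summable_of_tendsto_cofinite_zero ?_
    rw [Nat.cofinite_eq_atTop, tendsto_zero_iff_norm_tendsto_zero]
    have h := tendsto_zero_iff_norm_tendsto_zero.1 (PadicInt.fwdDiff_tendsto_zero f)
    refine squeeze_zero (fun _ => norm_nonneg _) (fun k => ?_) h
    rw [norm_mul]
    exact mul_le_of_le_one_left (norm_nonneg _) (PadicInt.norm_le_one _)
  let L : C(Gam p, ℤ_[p]) →ₗ[ℤ_[p]] ℤ_[p] :=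
    { toFun := fun g => ∑' k, PowerSeries.coeff k F *
        PadicInt.mahlerEquiv ℤ_[p] (g.comp (scale u)) k
      map_add' := fun g g' => by
        rw [ContinuousMap.add_comp, ← (hsum _).tsum_add (hsum _)]
        simp [mul_add]
      map_smul' := fun t g => by
        rw [ContinuousMap.smul_comp, RingHom.id_apply, smul_eq_mul, ← (hsum _).tsum_mul_left]
        refine tsum_congr fun k => ?_
        rw [map_smul, mul_left_comm]
        rfl }
  refine ⟨ofFunctional L, PowerSeries.ext fun k => ?_⟩
  rw [coeff_mahlerTransform, integral_ofFunctional]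
  change ∑' j, PowerSeries.coeff j F *
    PadicInt.mahlerEquiv ℤ_[p] ((mahlerFun u k).comp (scale u)) j = _
  have h1 : (mahlerFun u k).comp (scale u) = (mahler k : C(ℤ_[p], ℤ_[p])) := by
    ext z; simp [mahlerFun, unscale_scale]
  have ht : Tendsto (Pi.single k (1 : ℤ_[p]) : ℕ → ℤ_[p]) atTop (𝓝 0) := by
    refine tendsto_const_nhds.congr' ?_
    filter_upwards [eventually_gt_atTop k] with j hj
    rw [Pi.single_eq_of_ne hj.ne']
  have h2 : (mahler k : C(ℤ_[p], ℤ_[p])) = PadicInt.mahlerSeries (Pi.single k (1 : ℤ_[p])) := by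
    rw [PadicInt.mahlerSeries, tsum_eq_single k, Pi.single_eq_same, PadicInt.mahlerTerm_one]
    intro j hj
    rw [Pi.single_eq_of_ne hj]
    ext z; simp [PadicInt.mahlerTerm_apply]
  have h3 (j : ℕ) : PadicInt.mahlerEquiv ℤ_[p] (mahler k : C(ℤ_[p], ℤ_[p])) j =
      (Pi.single k (1 : ℤ_[p]) : ℕ → ℤ_[p]) j := by
    rw [PadicInt.mahlerEquiv_apply, h2]
    exact PadicInt.fwdDiff_mahlerSeries ht j
  simp_rw [h1, h3]
  rw [tsum_eq_single k, Pi.single_eq_same, mul_one]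
  intro j hj
  rw [Pi.single_eq_of_ne hj, mul_zero]

instance : IsDomain (CompleteGroupAlgebra p (Gam p)) :=
  (mahlerTransform_injective (1 : ℤ_[p]ˣ)).isDomain (mahlerTransform (1 : ℤ_[p]ˣ)).toRingHom

/-- The embedding of `Q̄_p ⊗ ℤ_p[[Γ]]` into the power series over `Q̄_p`. -/
def toPowerSeries : IwasawaRing p →ₐ[ℤ_[p]] (PadicAlgCl p)⟦X⟧ :=
  Algebra.TensorProduct.productMap (IsScalarTower.toAlgHom ℤ_[p] (PadicAlgCl p) _)
    ((PowerSeries.mapAlgHom (Algebra.ofId ℤ_[p] (PadicAlgCl p))).comp (mahlerTransform 1))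

lemma toPowerSeries_injective : Function.Injective (toPowerSeries (p := p)) := by
  rw [injective_iff_map_eq_zero]
  intro f hf
  obtain ⟨d, e, y, he, rfl⟩ := exists_eq_sum_tmul f
  refine Finset.sum_eq_zero fun j _ => ?_
  have : y j = 0 := mahlerTransform_injective 1 (PowerSeries.ext fun k => by
    have h1 := congrArg (PowerSeries.coeff k) hf
    have h2 (i) : PowerSeries.coeff k (toPowerSeries (e i ⊗ₜ[ℤ_[p]] y i)) =
        PowerSeries.coeff k (mahlerTransform 1 (y i)) • e i := by
      rw [toPowerSeries, Algebra.TensorProduct.productMap_apply_tmul, Algebra.smul_def]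
      change PowerSeries.coeff k (algebraMap (PadicAlgCl p) (PadicAlgCl p)⟦X⟧ (e i) *
        PowerSeries.map (algebraMap ℤ_[p] (PadicAlgCl p)) (mahlerTransform 1 (y i))) = _
      rw [← Algebra.smul_def, PowerSeries.coeff_smul, PowerSeries.coeff_map, smul_eq_mul, mul_comm]
    simp_rw [map_sum, h2, map_zero] at h1
    rw [map_zero, map_zero]
    exact Fintype.linearIndependent_iff.1 he _ h1 j)
  rw [this, TensorProduct.tmul_zero]

instance : IsDomain (IwasawaRing p) :=
  toPowerSeries_injective.isDomain (toPowerSeries (p := p)).toRingHom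

end Mahler

/-! ## Finitely generated ideals of `Q̄_p ⊗ ℤ_p[[Γ]]` are principal -/

section Bezout

open scoped PowerSeries Polynomial

variable {p : ℕ} [Fact p.Prime]

instance : FaithfulSMul ℤ_[p] (CompleteGroupAlgebra p (Gam p)) := by
  rw [faithfulSMul_iff_algebraMap_injective, injective_iff_map_eq_zero]
  intro c hc
  have h := congrArg (mahlerTransform (1 : ℤ_[p]ˣ)) hc
  rw [map_zero, AlgHom.commutes] at h
  exact PowerSeries.C_injective (h.trans (map_zero _).symm)

instance : Algebra.IsAlgebraic ℤ_[p] (PadicAlgCl p) :=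
  (IsFractionRing.comap_isAlgebraic_iff (A := ℤ_[p]) (K := ℚ_[p])).2 inferInstance

variable (p) in
/-- The element `[1] - 1` of `ℤ_p[[Γ]]`, whose Mahler transform is `X`. -/
def tvar : CompleteGroupAlgebra p (Gam p) := groupLike p (Multiplicative.ofAdd 1) - 1

lemma mahlerTransform_tvar : mahlerTransform 1 (tvar p) = PowerSeries.X := by
  rw [tvar, map_sub, map_one (mahlerTransform 1), mahlerTransform_groupLike 1 (Multiplicative.ofAdd 1) (by simp), add_sub_cancel_left]

lemma mahlerTransform_aeval_tvar (r : ℤ_[p][X]) :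
    mahlerTransform 1 (Polynomial.aeval (tvar p) r) = (r : ℤ_[p]⟦X⟧) := by
  have : (mahlerTransform 1).comp (Polynomial.aeval (tvar p)) =
      Polynomial.coeToPowerSeries.algHom (R := ℤ_[p]) ℤ_[p] := by
    refine Polynomial.algHom_ext ?_
    simp [mahlerTransform_tvar, Polynomial.coeToPowerSeries.algHom_apply]
  simpa [Polynomial.coeToPowerSeries.algHom_apply] using DFunLike.congr_fun this r

variable (p) in
/-- The homomorphism `Q̄_p[X] → Q̄_p ⊗ ℤ_p[[Γ]]`, `X ↦ [1] - 1`. -/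
def polyHom : (PadicAlgCl p)[X] →ₐ[PadicAlgCl p] IwasawaRing p :=
  Polynomial.aeval (1 ⊗ₜ[ℤ_[p]] tvar p)

lemma polyHom_map (r : ℤ_[p][X]) :
    polyHom p (r.map (algebraMap ℤ_[p] (PadicAlgCl p))) =
      1 ⊗ₜ[ℤ_[p]] Polynomial.aeval (tvar p) r := by
  rw [polyHom, Polynomial.aeval_map_algebraMap]
  exact (Polynomial.aeval_algHom_apply
    (Algebra.TensorProduct.includeRight : CompleteGroupAlgebra p (Gam p) →ₐ[ℤ_[p]] IwasawaRing p)
    (tvar p) r)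

/-- `Q̄_p` is algebraic over `ℤ_p`, so `R` is algebraic over `ℤ_p[[Γ]]`, and a nonzero algebraic
element of a domain divides a nonzero element of the base. -/
lemma exists_dvd_one_tmul {f : IwasawaRing p} (hf : f ≠ 0) :
    ∃ c : CompleteGroupAlgebra p (Gam p), c ≠ 0 ∧ f ∣ 1 ⊗ₜ[ℤ_[p]] c := by
  let e := Algebra.TensorProduct.comm ℤ_[p] (PadicAlgCl p) (CompleteGroupAlgebra p (Gam p))
  have : IsDomain (CompleteGroupAlgebra p (Gam p) ⊗[ℤ_[p]] PadicAlgCl p) :=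
    e.symm.injective.isDomain e.symm.toRingEquiv.toRingHom
  have h1 : IsAlgebraic (CompleteGroupAlgebra p (Gam p)) (e f) :=
    (Algebra.IsAlgebraic.tensorProduct ℤ_[p] (PadicAlgCl p)
      (CompleteGroupAlgebra p (Gam p))).isAlgebraic _
  obtain ⟨c, hc, h2⟩ := h1.exists_nonzero_dvd
    (mem_nonZeroDivisors_of_ne_zero (by simpa using hf))
  refine ⟨c, hc, ?_⟩
  have h3 := map_dvd e.symm h2
  rw [AlgEquiv.symm_apply_apply] at h3
  exact h3

/-- Removes the `p`-content, which is finite because some coefficient is nonzero. Weierstrass theory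
needs a series that is nonzero modulo `p`. -/
lemma exists_eq_pow_smul {F : ℤ_[p]⟦X⟧} (hF : F ≠ 0) :
    ∃ (k : ℕ) (F₀ : ℤ_[p]⟦X⟧), F = (p : ℤ_[p]) ^ k • F₀ ∧
      F₀.map (IsLocalRing.residue ℤ_[p]) ≠ 0 := by
  obtain ⟨i, hi⟩ : ∃ i, PowerSeries.coeff i F ≠ 0 := by
    by_contra! h
    exact hF (PowerSeries.ext h)
  have hfin : FiniteMultiplicity (PowerSeries.C (p : ℤ_[p])) F := by
    obtain ⟨k, hk⟩ := FiniteMultiplicity.of_not_isUnit PadicInt.prime_p.not_isUnit hi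
    refine ⟨k, fun h => hk ?_⟩
    obtain ⟨H, hH⟩ := h
    refine ⟨PowerSeries.coeff i H, ?_⟩
    rw [hH, ← map_pow, PowerSeries.coeff_C_mul]
  obtain ⟨F₀, h1, h2⟩ := hfin.exists_eq_pow_mul_and_not_dvd
  refine ⟨multiplicity (PowerSeries.C (p : ℤ_[p])) F, F₀, ?_, fun h3 => h2 ?_⟩
  · rw [PowerSeries.smul_eq_C_mul, map_pow]
    exact h1
  · have h4 (j : ℕ) : (p : ℤ_[p]) ∣ PowerSeries.coeff j F₀ := by
      have h5 := congrArg (PowerSeries.coeff j) h3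
      rwa [PowerSeries.coeff_map, map_zero, IsLocalRing.residue_eq_zero_iff,
        PadicInt.maximalIdeal_eq_span_p, Ideal.mem_span_singleton] at h5
    choose c hc using h4
    refine ⟨PowerSeries.mk c, PowerSeries.ext fun j => ?_⟩
    rw [PowerSeries.coeff_C_mul, PowerSeries.coeff_mk, hc]

lemma isUnit_natCast_prime : IsUnit ((p : ℤ_[p]) • (1 : IwasawaRing p)) := by
  have h : ((p : ℕ) : PadicAlgCl p) ≠ 0 := by
    have : CharZero (PadicAlgCl p) := algebraRat.charZero _
    exact Nat.cast_ne_zero.2 (Fact.out : p.Prime).ne_zero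
  have h1 := h.isUnit.map (algebraMap (PadicAlgCl p) (IwasawaRing p))
  rwa [map_natCast, ← map_natCast (algebraMap ℤ_[p] (IwasawaRing p)),
    Algebra.algebraMap_eq_smul_one] at h1

/-- It suffices to treat a series `c₀` in `ℤ_p[[Γ]]` without `p`-content, since `p` is a unit of
`R`. Preparation makes `c₀` a polynomial times a unit, and division by `c₀`, applied to the right
factor of each pure tensor, produces the polynomial remainders. -/
lemma exists_weierstrass {f : IwasawaRing p} (hf : f ≠ 0) :
    ∃ P : (PadicAlgCl p)[X], f ∣ polyHom p P ∧
      ∀ y : IwasawaRing p, ∃ r : (PadicAlgCl p)[X], polyHom p P ∣ y - polyHom p r := by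
  obtain ⟨c, hc, hfc⟩ := exists_dvd_one_tmul hf
  obtain ⟨k, F₀, hF, hF₀⟩ := exists_eq_pow_smul
    ((map_ne_zero_iff _ (mahlerTransform_injective 1)).2 hc)
  obtain ⟨c₀, rfl⟩ := mahlerTransform_surjective 1 F₀
  rw [← map_smul] at hF
  rw [mahlerTransform_injective 1 hF] at hfc
  obtain ⟨P, h, hP⟩ := PowerSeries.exists_isWeierstrassFactorization hF₀
  obtain ⟨h, rfl⟩ := mahlerTransform_surjective 1 h
  have hu : IsUnit h := by
    obtain ⟨g, hg⟩ := isUnit_iff_exists_inv.1 hP.isUnit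
    obtain ⟨g, rfl⟩ := mahlerTransform_surjective 1 g
    exact .of_mul_eq_one g (mahlerTransform_injective 1 (by rw [map_mul, hg, map_one]))
  have hc₀ : c₀ = Polynomial.aeval (tvar p) P * h := mahlerTransform_injective 1 (by
    rw [map_mul, mahlerTransform_aeval_tvar, hP.eq_mul])
  have hu' : IsUnit ((1 : PadicAlgCl p) ⊗ₜ[ℤ_[p]] h) :=
    hu.map (Algebra.TensorProduct.includeRight :
      CompleteGroupAlgebra p (Gam p) →ₐ[ℤ_[p]] IwasawaRing p)
  have key : (1 : PadicAlgCl p) ⊗ₜ[ℤ_[p]] c₀ =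
      polyHom p (P.map (algebraMap ℤ_[p] (PadicAlgCl p))) * 1 ⊗ₜ[ℤ_[p]] h := by
    rw [polyHom_map, Algebra.TensorProduct.tmul_mul_tmul, mul_one, hc₀]
  refine ⟨P.map (algebraMap ℤ_[p] (PadicAlgCl p)), ?_, fun y => ?_⟩
  · rw [← hu'.dvd_mul_right, ← key]
    have : (1 : PadicAlgCl p) ⊗ₜ[ℤ_[p]] ((p : ℤ_[p]) ^ k • c₀) =
        1 ⊗ₜ[ℤ_[p]] c₀ * ((p : ℤ_[p]) • (1 : IwasawaRing p)) ^ k := by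
      rw [smul_pow, one_pow, mul_smul_comm, mul_one, TensorProduct.tmul_smul]
    rwa [this, (isUnit_natCast_prime.pow k).dvd_mul_right] at hfc
  · induction y using TensorProduct.induction_on with
    | zero => exact ⟨0, by simp⟩
    | add x y hx hy =>
      obtain ⟨r, hr⟩ := hx
      obtain ⟨s, hs⟩ := hy
      exact ⟨r + s, by rw [map_add, add_sub_add_comm]; exact dvd_add hr hs⟩
    | tmul q y =>
      obtain ⟨z, r, hr⟩ :=
        PowerSeries.exists_isWeierstrassDivision (mahlerTransform 1 y) hF₀
      obtain ⟨z, rfl⟩ := mahlerTransform_surjective 1 z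
      have hy : y = c₀ * z + Polynomial.aeval (tvar p) r := mahlerTransform_injective 1 (by
        rw [map_add, map_mul, mahlerTransform_aeval_tvar, hr.eq_mul_add])
      refine ⟨Polynomial.C q * r.map (algebraMap ℤ_[p] (PadicAlgCl p)), ?_⟩
      have h1 : polyHom p (Polynomial.C q) = q ⊗ₜ[ℤ_[p]] 1 := by
        rw [polyHom, Polynomial.aeval_C]; rfl
      have h2 : q ⊗ₜ[ℤ_[p]] y - polyHom p (Polynomial.C q *
          r.map (algebraMap ℤ_[p] (PadicAlgCl p))) = 1 ⊗ₜ[ℤ_[p]] c₀ * q ⊗ₜ[ℤ_[p]] z := by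
        rw [map_mul, h1, polyHom_map, Algebra.TensorProduct.tmul_mul_tmul,
          Algebra.TensorProduct.tmul_mul_tmul, mul_one, one_mul, one_mul, ← TensorProduct.tmul_sub,
          hy, add_sub_cancel_right]
      rw [h2]
      have h3 : polyHom p (P.map (algebraMap ℤ_[p] (PadicAlgCl p))) ∣ 1 ⊗ₜ[ℤ_[p]] c₀ :=
        ⟨_, key⟩
      exact h3.mul_right (q ⊗ₜ[ℤ_[p]] z)

/-- If `f` divides `ι P` and `f ≡ ι r` modulo `ι P`, then `(f) = (ι P, ι r)`. -/
lemma exists_span_singleton_eq_map {A S : Type*} [CommRing A] [CommRing S] (ι : A →+* S)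
    (h : ∀ f : S, f ≠ 0 → ∃ P : A, f ∣ ι P ∧ ∀ y, ∃ r, ι P ∣ y - ι r) (f : S) :
    ∃ I : Ideal A, Ideal.span {f} = I.map ι := by
  by_cases hf : f = 0
  · exact ⟨⊥, by rw [Ideal.map_bot, hf, Ideal.span_singleton_eq_bot]⟩
  obtain ⟨P, hP, h⟩ := h f hf
  obtain ⟨r, hr⟩ := h f
  refine ⟨Ideal.span {P, r}, ?_⟩
  rw [Ideal.map_span, Set.image_pair]
  apply le_antisymm
  · rw [Ideal.span_singleton_le_iff_mem]
    obtain ⟨c, hc⟩ := hr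
    exact Ideal.mem_span_pair.2 ⟨c, 1, by rw [one_mul, mul_comm c, ← hc, sub_add_cancel]⟩
  · rw [Ideal.span_le]
    rintro x (rfl | rfl)
    · exact Ideal.mem_span_singleton.2 hP
    · refine Ideal.mem_span_singleton.2 ?_
      rw [← sub_sub_cancel f (ι r)]
      exact dvd_sub dvd_rfl (hP.trans hr)

lemma isBezout_of_forall_exists_dvd {A S : Type*} [CommRing A] [IsPrincipalIdealRing A]
    [CommRing S] (ι : A →+* S)
    (h : ∀ f : S, f ≠ 0 → ∃ P : A, f ∣ ι P ∧ ∀ y, ∃ r, ι P ∣ y - ι r) : IsBezout S := by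
  rw [IsBezout.iff_span_pair_isPrincipal]
  intro x y
  obtain ⟨I, hI⟩ := exists_span_singleton_eq_map ι h x
  obtain ⟨J, hJ⟩ := exists_span_singleton_eq_map ι h y
  rw [Ideal.span_insert, hI, hJ, ← Ideal.map_sup]
  obtain ⟨P, hP⟩ := (IsPrincipalIdealRing.principal (I ⊔ J)).principal
  refine ⟨ι P, ?_⟩
  rw [hP, Ideal.submodule_span_eq, Ideal.map_span, Set.image_singleton, Ideal.submodule_span_eq]

instance : IsBezout (IwasawaRing p) :=
  isBezout_of_forall_exists_dvd (A := (PadicAlgCl p)[X]) (S := IwasawaRing p)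
    (polyHom p).toRingHom fun _ hf => exists_weierstrass hf

end Bezout

/-! ### Greatest common divisors of Fitting ideals -/

lemma isGCDOfIdeal_span_singleton_iff {R : Type*} [CommRing R] [IsDomain R] (D₀ D : R) :
    IsGCDOfIdeal (Ideal.span {D₀}) D ↔ Associated D D₀ := by
  constructor
  · rintro ⟨h1, h2⟩
    exact associated_of_dvd_dvd (h1 _ (Ideal.mem_span_singleton_self _))
      (h2 _ fun x hx => Ideal.mem_span_singleton.1 hx)
  · intro h
    exact ⟨fun x hx => h.dvd.trans (Ideal.mem_span_singleton.1 hx),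
      fun c hc => (hc _ (Ideal.mem_span_singleton_self _)).trans h.symm.dvd⟩

lemma fittingIdeal_fg {R : Type*} [CommRing R] {rows cols : Type*} [Finite rows] [Fintype cols]
    (Q : Matrix rows cols R) (d : ℕ) : (fittingIdeal Q d).FG := by
  refine Submodule.fg_span ((Set.finite_range fun st : (Fin (Fintype.card cols - d) ↪ rows) ×
    (Fin (Fintype.card cols - d) ↪ cols) => (Q.submatrix st.1 st.2).det).subset ?_)
  rintro x ⟨s, t, rfl⟩
  exact ⟨(s, t), rfl⟩

lemma exists_isGCDOfIdeal {R : Type*} [CommRing R] [IsDomain R] [IsBezout R] {I : Ideal R}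
    (hI : I.FG) : ∃ D, IsGCDOfIdeal I D := by
  obtain ⟨D, rfl⟩ := (IsBezout.isPrincipal_of_FG I hI).principal
  exact ⟨D, (isGCDOfIdeal_span_singleton_iff D D).2 (Associated.refl D)⟩

/-- Over a Bézout domain, a ring homomorphism kills the greatest common divisor of a Fitting ideal
if and only if it kills the minors. -/
lemma map_fittingIdeal_gcd_eq_zero_iff {R K : Type*} [CommRing R] [IsDomain R] [IsBezout R]
    [CommRing K] {rows cols : Type*} [Finite rows] [Fintype cols]
    (Q : Matrix rows cols R) (d : ℕ) {D : R} (hD : IsGCDOfIdeal (fittingIdeal Q d) D)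
    (ε : R →+* K) :
    ε D = 0 ↔ ∀ (s : Fin (Fintype.card cols - d) ↪ rows) (t : Fin (Fintype.card cols - d) ↪ cols),
      ((Q.map ε).submatrix s t).det = 0 := by
  obtain ⟨D₀, hD₀⟩ := (IsBezout.isPrincipal_of_FG _ (fittingIdeal_fg Q d)).principal
  rw [Ideal.submodule_span_eq] at hD₀
  have hD' : Associated D D₀ := by
    rwa [hD₀, isGCDOfIdeal_span_singleton_iff] at hD
  -- This is where Bézout enters: the gcd generates the ideal. In a general domain, a common zero of
  -- the minors need not be a zero of their gcd.
  have h1 : D ∈ RingHom.ker ε ↔ fittingIdeal Q d ≤ RingHom.ker ε := by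
    rw [hD₀, ← Ideal.span_singleton_eq_span_singleton.2 hD', Ideal.span_singleton_le_iff_mem]
  rw [← RingHom.mem_ker, h1, fittingIdeal, Ideal.span_le]
  constructor
  · intro h s t
    have : (Q.submatrix s t).det ∈ RingHom.ker ε := h ⟨s, t, rfl⟩
    rw [RingHom.mem_ker, RingHom.map_det] at this
    exact this
  · rintro h x ⟨s, t, rfl⟩
    change _ ∈ RingHom.ker ε
    rw [RingHom.mem_ker, RingHom.map_det]
    exact h s t

/-! ## Homomorphisms from `A_φ̃` and linearly independent extensions -/

section HomSpace

variable {p : ℕ} [Fact p.Prime] {n l m : ℕ} {r : Fin m → FreeProP p n}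
  {φ : FreeProP p n →ₜ* GL (Fin l) (PadicAlgCl p)} {ψ : FreeProP p n →ₜ* Gam p}
  {γ : Gam p} {a : PadicAlgCl p}

lemma apply_mk_of_mem_homSpace {f : DiffModule r φ ψ → Fin l → PadicAlgCl p}
    (hf : f ∈ homSpace r φ ψ γ a) (v : Fin n → Matrix (Fin l) (Fin l) (IwasawaRing p)) :
    f (Submodule.Quotient.mk v) =
      ∑ i, ((v i).map (evalAt γ a)).mulVec (f (Submodule.Quotient.mk (Pi.single i 1))) := by
  let F : DiffModule r φ ψ →+ (Fin l → PadicAlgCl p) := AddMonoidHom.mk' f hf.1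
  have hv : v = ∑ i, v i • Pi.single i (1 : Matrix (Fin l) (Fin l) (IwasawaRing p)) := by
    rw [← Finset.univ_sum_single v]
    refine Finset.sum_congr rfl fun i _ => ?_
    rw [Finset.univ_sum_single]
    ext j : 1
    rcases eq_or_ne j i with rfl | h
    · simp
    · simp [Pi.single_eq_of_ne h]
  have h1 : (Submodule.Quotient.mk v : DiffModule r φ ψ) =
      ∑ i, v i • Submodule.Quotient.mk (Pi.single i 1) := by
    conv_lhs => rw [hv]
    exact map_sum (Submodule.mkQ _) _ _
  rw [h1]
  exact (map_sum F _ _).trans (Finset.sum_congr rfl fun i _ => hf.2 _ _)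

lemma mulVec_foxJacobian_apply (b : Fin n × Fin l → PadicAlgCl p) (j : Fin m) (s : Fin l) :
    ((foxJacobian r φ ψ).map (evalAt γ a)).mulVec b (j, s) =
      (∑ i, ((foxJacobianBlock r φ ψ j i).map (evalAt γ a)).mulVec fun u => b (i, u)) s := by
  rw [Matrix.mulVec, dotProduct, Fintype.sum_prod_type, Finset.sum_apply]
  rfl

variable (r φ ψ γ a) in
/-- The values of a homomorphism `A_φ̃ → Q̄_p^l` at the generators `dg_i`. -/
def homSpaceToKer : homSpace r φ ψ γ a →ₗ[PadicAlgCl p]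
    LinearMap.ker ((foxJacobian r φ ψ).map (evalAt γ a)).mulVecLin where
  toFun f := ⟨fun t => f.1 (Submodule.Quotient.mk (Pi.single t.1 1)) t.2, by
    rw [LinearMap.mem_ker, Matrix.mulVecLin_apply]
    ext ⟨j, s⟩
    rw [mulVec_foxJacobian_apply]
    refine (congrFun (apply_mk_of_mem_homSpace f.2 (foxJacobianBlock r φ ψ j)) s).symm.trans ?_
    have h0 : (Submodule.Quotient.mk (foxJacobianBlock r φ ψ j) : DiffModule r φ ψ) = 0 :=
      (Submodule.Quotient.mk_eq_zero _).2 (Submodule.subset_span (Set.mem_range_self j))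
    rw [h0]
    exact congrFun (map_zero (AddMonoidHom.mk' f.1 f.2.1)) s⟩
  map_add' _ _ := rfl
  map_smul' _ _ := rfl

lemma homSpaceToKer_injective : Function.Injective (homSpaceToKer r φ ψ γ a) := by
  intro f g h
  refine Subtype.ext (funext fun u => ?_)
  obtain ⟨v, rfl⟩ := Submodule.Quotient.mk_surjective _ u
  rw [apply_mk_of_mem_homSpace f.2, apply_mk_of_mem_homSpace g.2]
  refine Finset.sum_congr rfl fun i _ => congrArg _ (funext fun s => ?_)
  exact congrFun (congrArg Subtype.val h) (i, s)

lemma homSpaceToKer_surjective {ε : IwasawaRing p →+* PadicAlgCl p} (hε : evalAt γ a = ⇑ε) :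
    Function.Surjective (homSpaceToKer r φ ψ γ a) := by
  rintro ⟨b, hb⟩
  let F (v : Fin n → Matrix (Fin l) (Fin l) (IwasawaRing p)) : Fin l → PadicAlgCl p :=
    ∑ i, ((v i).map (evalAt γ a)).mulVec fun s => b (i, s)
  have hadd (v w) : F (v + w) = F v + F w := by
    simp only [F, hε, Pi.add_apply, Matrix.map_add _ (map_add ε), Matrix.add_mulVec,
      Finset.sum_add_distrib]
  have hsmul (X : Matrix (Fin l) (Fin l) (IwasawaRing p)) (v) :
      F (X • v) = (X.map (evalAt γ a)).mulVec (F v) := by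
    simp only [F, hε, Pi.smul_apply, smul_eq_mul, Matrix.map_mul, Matrix.mulVec_sum,
      Matrix.mulVec_mulVec]
  have hzero : F 0 = 0 := by simp [F, hε]
  have hrel (v) (hv : v ∈ Submodule.span (Matrix (Fin l) (Fin l) (IwasawaRing p))
      (Set.range (foxJacobianBlock r φ ψ))) : F v = 0 := by
    induction hv using Submodule.span_induction with
    | mem v hv =>
      obtain ⟨j, rfl⟩ := hv
      ext s
      exact (mulVec_foxJacobian_apply b j s).symm.trans (congrFun hb (j, s))
    | zero => exact hzero
    | add v w _ _ hv hw => rw [hadd, hv, hw, add_zero]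
    | smul X v _ hv => rw [hsmul, hv, Matrix.mulVec_zero]
  -- `F` kills the relations, so it descends to the quotient; the descent uses a set-theoretic
  -- section, and `hf` records independence of the representative.
  let f (u : DiffModule r φ ψ) : Fin l → PadicAlgCl p :=
    F (Function.surjInv (Submodule.Quotient.mk_surjective _) u)
  have hf (v) : f (Submodule.Quotient.mk v) = F v := by
    have h1 := Function.surjInv_eq (Submodule.Quotient.mk_surjective
      (Submodule.span (Matrix (Fin l) (Fin l) (IwasawaRing p))
        (Set.range (foxJacobianBlock r φ ψ)))) (Submodule.Quotient.mk v)
    have h2 := hrel _ ((Submodule.Quotient.eq _).1 h1)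
    have h3 := hadd (Function.surjInv (Submodule.Quotient.mk_surjective
      (Submodule.span (Matrix (Fin l) (Fin l) (IwasawaRing p))
        (Set.range (foxJacobianBlock r φ ψ)))) (Submodule.Quotient.mk v) - v) v
    rw [sub_add_cancel, h2, zero_add] at h3
    exact h3
  refine ⟨⟨f, fun u w => ?_, fun X u => ?_⟩, Subtype.ext (funext fun t => ?_)⟩
  · obtain ⟨u, rfl⟩ := Submodule.Quotient.mk_surjective _ u
    obtain ⟨w, rfl⟩ := Submodule.Quotient.mk_surjective _ w
    rw [← Submodule.Quotient.mk_add, hf, hf, hf, hadd]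
  · obtain ⟨u, rfl⟩ := Submodule.Quotient.mk_surjective _ u
    rw [← Submodule.Quotient.mk_smul, hf, hf, hsmul]
  · refine (congrFun (hf _) t.2).trans ?_
    simp only [F, hε]
    rw [Finset.sum_eq_single t.1, Pi.single_eq_same, Matrix.map_one _ (map_zero ε) (map_one ε),
      Matrix.one_mulVec]
    · intro i _ hi
      rw [Pi.single_eq_of_ne hi, Matrix.map_zero _ (map_zero ε), Matrix.zero_mulVec]
    · simp

lemma le_rank_homSpace_iff {ε : IwasawaRing p →+* PadicAlgCl p} (hε : evalAt γ a = ⇑ε) (k : ℕ) :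
    (k : Cardinal) ≤ Module.rank (PadicAlgCl p) (homSpace r φ ψ γ a) ↔
      k ≤ Module.finrank (PadicAlgCl p)
        (LinearMap.ker ((foxJacobian r φ ψ).map (evalAt γ a)).mulVecLin) := by
  let e := LinearEquiv.ofBijective (homSpaceToKer r φ ψ γ a)
    ⟨homSpaceToKer_injective, homSpaceToKer_surjective hε⟩
  have := Module.Finite.equiv e.symm
  rw [← e.finrank_eq, ← Module.finrank_eq_rank, Nat.cast_le]

end HomSpace

section Extensions

variable {p : ℕ} [Fact p.Prime] {n l m : ℕ} (φ : FreeProP p n →ₜ* GL (Fin l) (PadicAlgCl p))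
  (ψ : FreeProP p n →ₜ* Gam p) {χ : Gam p →* PadicAlgCl p}
  (hχ : (χ : Gam p → PadicAlgCl p) ∈ tame p (Gam p)) {γ : Gam p} {a : PadicAlgCl p}
  (hγ : Dense (Subgroup.zpowers γ : Set (Gam p))) (hχγ : χ γ = a)

variable (χ) in
/-- The linear map that sends prescribed values on the generators to a crossed homomorphism. -/
def crossedMap : (Fin n × Fin l → PadicAlgCl p) →ₗ[PadicAlgCl p]
    (FreeProP p n → Fin l → PadicAlgCl p) where
  toFun := crossedOf φ ψ χ
  map_add' b c := by
    ext x s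
    simp only [crossedOf, Pi.add_apply, mul_add, Finset.sum_add_distrib]
  map_smul' q b := by
    ext x s
    simp only [crossedOf, Pi.smul_apply, smul_eq_mul, Finset.mul_sum, RingHom.id_apply,
      mul_left_comm]

include hχ in
lemma crossedMap_injective : Function.Injective (crossedMap φ ψ χ) := fun b c h =>
  funext fun t => by
    rw [← crossedOf_gen φ ψ hχ b t.1 t.2, ← crossedOf_gen φ ψ hχ c t.1 t.2]
    exact congrFun (congrFun h _) _

include hχ hγ hχγ

/-- Restriction to the generators and `crossedMap` are inverse linear maps between crossed
homomorphisms and vectors `b`. They match the crossed homomorphisms whose extension factors through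
`G` with the kernel of the evaluated Jacobian, so linear independence transfers both ways. -/
lemma exists_linearIndependent_extensions_iff {G : Type*} [Group G] [TopologicalSpace G] [T2Space G]
    (P : ProPPresentation p n m G) (hφ : ∀ j, φ (P.rel j) = 1) (hψ : ∀ j, ψ (P.rel j) = 1)
    (k : ℕ) :
    (∃ B : Fin k → FreeProP p n → Fin l → PadicAlgCl p,
      LinearIndependent (PadicAlgCl p) B ∧
      ∀ s, IsCrossedHom φ ψ γ a (B s) ∧
        ∃ φ', IsExtensionHom φ ψ γ a (B s) φ' ∧ FactorsThrough φ' P.proj) ↔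
      k ≤ Module.finrank (PadicAlgCl p)
        (LinearMap.ker ((foxJacobian P.rel φ ψ).map (evalAt γ a)).mulVecLin) := by
  constructor
  · rintro ⟨B, hB, h⟩
    let v (s : Fin k) : LinearMap.ker ((foxJacobian P.rel φ ψ).map (evalAt γ a)).mulVecLin :=
      ⟨fun t => B s (gen p t.1) t.2, by
        obtain ⟨h1, φ', h2, h3⟩ := h s
        exact (factorsThrough_extension_iff φ ψ hχ hγ hχγ P hφ hψ h1 h2).1 h3⟩
    have hv : LinearIndependent (PadicAlgCl p) v := by
      refine LinearIndependent.of_comp ((crossedMap φ ψ χ).comp (Submodule.subtype _)) ?_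
      have h1 : (crossedMap φ ψ χ).comp (Submodule.subtype _) ∘ v = B :=
        funext fun s => ((h s).1.eq_crossedOf φ ψ hχ hγ hχγ).symm
      rwa [h1]
    simpa using hv.fintype_card_le_finrank
  · intro hk
    let v := Module.finBasis (PadicAlgCl p)
      (LinearMap.ker ((foxJacobian P.rel φ ψ).map (evalAt γ a)).mulVecLin)
    refine ⟨fun s => crossedOf φ ψ χ (v (Fin.castLE hk s)).1, ?_, fun s => ?_⟩
    · have h1 := (v.linearIndependent.comp _ (Fin.castLE_injective hk)).map'
        ((crossedMap φ ψ χ).comp (Submodule.subtype _))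
        (LinearMap.ker_eq_bot.2 ((crossedMap_injective φ ψ hχ).comp Subtype.val_injective))
      exact h1
    · have hc := isCrossedHom_crossedOf φ ψ hχ hγ hχγ (v (Fin.castLE hk s)).1
      obtain ⟨φ', h1, -⟩ := exists_isExtensionHom φ ψ hχ hγ hχγ hc
      refine ⟨hc, φ', h1, (factorsThrough_extension_iff φ ψ hχ hγ hχγ P hφ hψ hc h1).2 ?_⟩
      simp_rw [crossedOf_gen φ ψ hχ]
      exact (v (Fin.castLE hk s)).2

end Extensions

/-- Without generators every continuous homomorphism on `F_n` is trivial, whereas `Γ` is not.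
Positivity of `n` gives `k - 1 ≤ n(k - 1)`, so the minor size is a genuine difference. -/
lemma pos_of_surjective {p : ℕ} [Fact p.Prime] {n m : ℕ} {G : Type*} [Group G]
    [TopologicalSpace G] (P : ProPPresentation p n m G) (α : G →ₜ* Gam p)
    (hα : Function.Surjective α) : 0 < n := by
  rcases Nat.eq_zero_or_pos n with rfl | hn
  · have h1 : α.comp P.proj = 1 := continuousMonoidHom_ext_gen fun i => i.elim0
    obtain ⟨x, hx⟩ := (hα.comp P.surjective_proj) (Multiplicative.ofAdd 1)
    have h2 := DFunLike.congr_fun h1 x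
    have h3 : (Multiplicative.ofAdd (1 : ℤ_[p])) = Multiplicative.ofAdd 0 := hx.symm.trans h2
    exact absurd (Multiplicative.ofAdd.injective h3) one_ne_zero
  · exact hn

end ArithAlexander

end

open ArithAlexander

theorem theorem3p1 (p : ℕ) [Fact p.Prime] (n m : ℕ) (G : Type*) [Group G] [TopologicalSpace G]
    [IsTopologicalGroup G] [T2Space G] (P : ProPPresentation p n m G)
    (hdeg : ∀ j, totalDegree p (P.rel j) = 0)
    (γ : Gam p) (hγ : Dense (Subgroup.zpowers γ : Set (Gam p)))
    (α : G →ₜ* Gam p) (hα : Function.Surjective α) (hαγ : ∀ i, α (P.proj (gen p i)) = γ)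
    (k : ℕ) (hk : 2 ≤ k)
    (φ : FreeProP p n →ₜ* GL (Fin (k - 1)) (PadicAlgCl p)) (hφ : FactorsThrough φ P.proj)
    (a : PadicAlgCl p) (ha : ‖a - 1‖ < 1) :
    -- the homomorphism `φ_{k-1}` exists, is unique, and factors through `G` iff `Q b = 0`
    (∀ β, IsCrossedHom φ (α.comp P.proj) γ a β →
      (∃! φ', IsExtensionHom φ (α.comp P.proj) γ a β φ') ∧
      ∀ φ', IsExtensionHom φ (α.comp P.proj) γ a β φ' →
        (FactorsThrough φ' P.proj ↔
          ((foxJacobian P.rel φ (α.comp P.proj)).map (evalAt γ a)).mulVec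
            (fun t => β (gen p t.1) t.2) = 0)) ∧
    -- the twisted Alexander polynomial exists
    (∃ D, IsAlexanderPolynomial P.rel φ (α.comp P.proj) (k - 1) D) ∧
    ∀ D, IsAlexanderPolynomial P.rel φ (α.comp P.proj) (k - 1) D →
      -- `dim Hom(A, Q̄_p^(k-1)) ≥ k` iff `a` is a zero
      ((k : Cardinal) ≤ Module.rank (PadicAlgCl p) (homSpace P.rel φ (α.comp P.proj) γ a) ↔
        evalAt γ a D = 0) ∧
      -- there are `k` linearly independent extensions iff `a` is a zero
      ((∃ B : Fin k → FreeProP p n → Fin (k - 1) → PadicAlgCl p,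
          LinearIndependent (PadicAlgCl p) B ∧
          ∀ s, IsCrossedHom φ (α.comp P.proj) γ a (B s) ∧
            ∃ φ', IsExtensionHom φ (α.comp P.proj) γ a (B s) φ' ∧ FactorsThrough φ' P.proj) ↔
        evalAt γ a D = 0) := by
  obtain ⟨χ, hχ, hχγ⟩ := exists_character hγ ha
  have hψ (j) : (α.comp P.proj) (P.rel j) = 1 := by
    rw [ContinuousMonoidHom.comp_toFun, P.proj_rel, map_one]
  have hφ' := (factorsThrough_iff P φ).1 hφ
  have hε : evalAt γ a = ⇑(evalHom χ hχ).toRingHom :=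
    funext fun f => evalAt_eq_evalHom hγ hχ hχγ f
  refine ⟨fun β hβ => ⟨?_, fun φ' h => ?_⟩, exists_isGCDOfIdeal (fittingIdeal_fg _ _),
    fun D hD => ?_⟩
  · obtain ⟨φ', h, -⟩ := exists_isExtensionHom φ _ hχ hγ hχγ hβ
    exact ⟨φ', h, fun φ'' h' => IsExtensionHom.unique φ _ h' h⟩
  · exact factorsThrough_extension_iff φ _ hχ hγ hχγ P hφ' hψ hβ h
  · have hn := pos_of_surjective P α hα
    have hcard : k - 1 ≤ Fintype.card (Fin n × Fin (k - 1)) := by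
      rw [Fintype.card_prod, Fintype.card_fin, Fintype.card_fin]
      exact Nat.le_mul_of_pos_left _ hn
    -- Conditions (a), (b) and (c) are all compared with the dimension of the kernel of the
    -- evaluated Jacobian.
    have key : evalAt γ a D = 0 ↔ k ≤ Module.finrank (PadicAlgCl p) (LinearMap.ker
        ((foxJacobian P.rel φ (α.comp P.proj)).map (evalAt γ a)).mulVecLin) := by
      have h1 := le_finrank_ker_iff
        ((foxJacobian P.rel φ (α.comp P.proj)).map (evalAt γ a)) hcard
      rw [Nat.sub_add_cancel (by omega)] at h1
      rw [h1, hε]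
      exact map_fittingIdeal_gcd_eq_zero_iff _ _ hD _
    rw [key, le_rank_homSpace_iff hε]
    exact ⟨Iff.rfl, exists_linearIndependent_extensions_iff φ _ hχ hγ hχγ P hφ' hψ k⟩
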